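/- Let $n\ge 3$, $\lambda>0$, $n<q\le\infty$, and let $C_n>0$ be a constant for which the Sobolev inequality $\|\phi\|_{L^{2n/(n-2)}(\mathbb R^n)}\le C_n\|\nabla \phi\|_{L^2(\mathbb R^n)}$ holds for all $\phi\in C_c^\infty(\mathbb R^n)$ (such constants exist). For a vector field $h\in L^n(\Omega)$ and $t,\varepsilon>0$ put $$R_h(t)=\big\|\,|h|\,\mathbf 1_{\{|h|\ge t\}}\big\|_{L^n(\Omega)},\qquad r_h(\varepsilon)=\inf\{t>0: R_h(t)<\varepsilon\}.$$ Let $\Omega\subset\mathbb R^n$ be a domain (nonempty, open, connected) with $|\Omega|\le 1$. Let $\mathbf A=(a^{ij})$ be a measurable, bounded $n\times n$ matrix function on $\Omega$ with $\lambda|\xi|^2\le \mathbf A(x)\xi\cdot\xi$ for all $\xi\in\mathbb R^n$ and a.e. $x\in\Omega$. Let $\vec b,\vec c\in L^n(\Omega)$, $d\in L^{n/2}(\Omega)$ with $d\ge\operatorname{div}\vec b$ in the sense of distributions, i.e. $\int_\Omega (d\phi+\vec b\cdot\nabla\phi)\ge0$ for all $0\le\phi\in C_c^\infty(\Omega)$.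 Let $\vec f\in L^q(\Omega)$ and $g\in L^{q/2}(\Omega)$. Let $u\in W^{1,2}(\Omega)$ be a subsolution of $$-\operatorname{div}(\mathbf A\nabla u+\vec b u)+\vec c\cdot\nabla u+du=g+\operatorname{div}\vec f\quad\text{in }\Omega,$$ i.e. for all $\phi\in C_c^\infty(\Omega)$ with $\phi\ge0$, $$\int_\Omega \mathbf A\nabla u\cdot\nabla\phi+(\vec b\cdot\nabla\phi)\,u+(\vec c\cdot\nabla u)\,\phi+du\phi\le\int_\Omega g\phi-\vec f\cdot\nabla\phi .$$ Then $$\sup_\Omega u\le\sup_{\partial\Omega}u^++C\big(\|\vec f\|_{L^q(\Omega)}+\|g\|_{L^{q/2}(\Omega)}\big),$$ where $C$ depends only on $n$, $\lambda$, $q$ (and the chosen $C_n$) and on the number $r_{\vec b-\vec c}\big(\tfrac{\lambda}{3C_n}\big)$. Here $u^+=\max(u,0)$, $\sup_\Omega$ is the essential supremum, and $\sup_{\partial\Omega}v=\inf\{k\in\mathbb R:(v-k)^+\in W^{1,2}_0(\Omega)\}$, which is $+\infty$ if no such $k$ exists. -/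

import Mathlib

open MeasureTheory
open scoped ENNReal NNReal ContDiff

noncomputable section

/-- `φ ∈ C_c^∞(Ω)`: smooth, with compact support contained in `Ω`. -/
structure IsTestFunction {n : ℕ} (Ω : Set (EuclideanSpace ℝ (Fin n)))
    (φ : EuclideanSpace ℝ (Fin n) → ℝ) : Prop where
  contDiff : ContDiff ℝ ∞ φ
  hasCompactSupport : HasCompactSupport φ
  tsupport_subset : tsupport φ ⊆ Ω

/-- `u ∈ W^{1,2}(Ω)`, with weak (distributional) gradient `Du ∈ L^2(Ω)`. Functions are defined
on the whole space, but only their restrictions to `Ω` matter. -/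
structure IsW12With {n : ℕ} (Ω : Set (EuclideanSpace ℝ (Fin n)))
    (u : EuclideanSpace ℝ (Fin n) → ℝ)
    (Du : EuclideanSpace ℝ (Fin n) → EuclideanSpace ℝ (Fin n)) : Prop where
  memLp : MemLp u 2 (volume.restrict Ω)
  memLp_grad : MemLp Du 2 (volume.restrict Ω)
  weak_grad : ∀ φ, IsTestFunction Ω φ → ∀ i : Fin n,
    ∫ x in Ω, u x * (gradient φ x) i = -∫ x in Ω, (Du x) i * φ x

/-- `u ∈ W_0^{1,2}(Ω)`: the closure of `C_c^∞(Ω)` in `W^{1,2}(Ω)`. -/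
def MemW12Zero {n : ℕ} (Ω : Set (EuclideanSpace ℝ (Fin n)))
    (u : EuclideanSpace ℝ (Fin n) → ℝ) : Prop :=
  ∃ Du : EuclideanSpace ℝ (Fin n) → EuclideanSpace ℝ (Fin n), IsW12With Ω u Du ∧
    ∀ ε : ℝ≥0∞, 0 < ε → ∃ φ, IsTestFunction Ω φ ∧
      eLpNorm (fun x => u x - φ x) 2 (volume.restrict Ω) +
        eLpNorm (fun x => Du x - gradient φ x) 2 (volume.restrict Ω) < ε

/-- `v ≤ k` on `∂Ω` in the sense of `W^{1,2}(Ω)`, i.e. `(v - k)⁺ ∈ W_0^{1,2}(Ω)`. -/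
def BoundaryLE {n : ℕ} (Ω : Set (EuclideanSpace ℝ (Fin n)))
    (v : EuclideanSpace ℝ (Fin n) → ℝ) (k : ℝ) : Prop :=
  MemW12Zero Ω (fun x => max (v x - k) 0)

/-- `sup_{∂Ω} v = inf {k ∈ ℝ : v ≤ k on ∂Ω}`, equal to `+∞` if there is no such `k`. -/
def boundarySup {n : ℕ} (Ω : Set (EuclideanSpace ℝ (Fin n)))
    (v : EuclideanSpace ℝ (Fin n) → ℝ) : EReal :=
  ⨅ (k : ℝ) (_ : BoundaryLE Ω v k), (k : EReal)

/-- `A ξ · η = ∑ a^{ij} ξ^j η^i`. -/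
def matrixForm {n : ℕ} (A : Matrix (Fin n) (Fin n) ℝ) (ξ η : EuclideanSpace ℝ (Fin n)) : ℝ :=
  ∑ i, ∑ j, A i j * ξ j * η i

/-- The coefficient matrix is measurable, bounded, and uniformly elliptic on `Ω` with
constant `lam > 0`. -/
structure IsBoundedElliptic {n : ℕ} (Ω : Set (EuclideanSpace ℝ (Fin n))) (lam : ℝ)
    (A : EuclideanSpace ℝ (Fin n) → Matrix (Fin n) (Fin n) ℝ) : Prop where
  measurable : ∀ i j, AEStronglyMeasurable (fun x => A x i j) (volume.restrict Ω)
  bounded : ∃ M : ℝ, ∀ᵐ x ∂(volume.restrict Ω), ∀ i j, |A x i j| ≤ M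
  pos : 0 < lam
  elliptic : ∀ᵐ x ∂(volume.restrict Ω), ∀ ξ : EuclideanSpace ℝ (Fin n),
    lam * ‖ξ‖ ^ 2 ≤ matrixForm (A x) ξ ξ

/-- `d ≥ div b` in `Ω` in the sense of distributions. -/
def GEDiv {n : ℕ} (Ω : Set (EuclideanSpace ℝ (Fin n)))
    (d : EuclideanSpace ℝ (Fin n) → ℝ)
    (b : EuclideanSpace ℝ (Fin n) → EuclideanSpace ℝ (Fin n)) : Prop :=
  ∀ φ, IsTestFunction Ω φ → (∀ x, 0 ≤ φ x) →
    0 ≤ ∫ x in Ω, (d x * φ x + inner ℝ (b x) (gradient φ x))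

/-- `u ∈ W^{1,2}(Ω)` is a weak subsolution of
`-div (A ∇u + b u) + c · ∇u + d u = g + div f` in `Ω`. -/
def IsSubsolution {n : ℕ} (Ω : Set (EuclideanSpace ℝ (Fin n)))
    (A : EuclideanSpace ℝ (Fin n) → Matrix (Fin n) (Fin n) ℝ)
    (b c : EuclideanSpace ℝ (Fin n) → EuclideanSpace ℝ (Fin n))
    (d : EuclideanSpace ℝ (Fin n) → ℝ)
    (g : EuclideanSpace ℝ (Fin n) → ℝ)
    (f : EuclideanSpace ℝ (Fin n) → EuclideanSpace ℝ (Fin n))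
    (u : EuclideanSpace ℝ (Fin n) → ℝ) : Prop :=
  ∃ Du : EuclideanSpace ℝ (Fin n) → EuclideanSpace ℝ (Fin n), IsW12With Ω u Du ∧
    ∀ φ, IsTestFunction Ω φ → (∀ x, 0 ≤ φ x) →
      ∫ x in Ω, (matrixForm (A x) (Du x) (gradient φ x)
          + inner ℝ (b x) (gradient φ x) * u x
          + inner ℝ (c x) (Du x) * φ x + d x * u x * φ x)
        ≤ ∫ x in Ω, (g x * φ x - inner ℝ (f x) (gradient φ x))

/-- `R_f(t) = ‖ |f| 1_{|f| ≥ t} ‖_{L^n(Ω)}`. -/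
def bigR {n : ℕ} (Ω : Set (EuclideanSpace ℝ (Fin n)))
    (f : EuclideanSpace ℝ (Fin n) → EuclideanSpace ℝ (Fin n)) (t : ℝ) : ℝ≥0∞ :=
  eLpNorm (Set.indicator {x | t ≤ ‖f x‖} (fun x => ‖f x‖)) (n : ℝ≥0∞) (volume.restrict Ω)

/-- `r_f(ε) = inf {t > 0 : R_f(t) < ε}`. -/
def smallR {n : ℕ} (Ω : Set (EuclideanSpace ℝ (Fin n)))
    (f : EuclideanSpace ℝ (Fin n) → EuclideanSpace ℝ (Fin n)) (ε : ℝ) : ℝ :=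
  sInf {t : ℝ | 0 < t ∧ bigR Ω f t < ENNReal.ofReal ε}

/-- `K` is an admissible constant in the Sobolev inequality
`‖φ‖_{2n/(n-2)} ≤ K ‖∇φ‖_2` on `ℝⁿ`. By density the inequality then holds on `W_0^{1,2}(Ω)` for
every open `Ω`. -/
def IsSobolevConstant (n : ℕ) (K : ℝ) : Prop :=
  0 < K ∧ ∀ φ : EuclideanSpace ℝ (Fin n) → ℝ, IsTestFunction Set.univ φ →
    eLpNorm φ (ENNReal.ofReal (2 * n / (n - 2))) volume
      ≤ ENNReal.ofReal K * eLpNorm (gradient φ) 2 volume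

/-- Admissible Sobolev constants exist in every dimension `n ≥ 3`. -/
theorem exists_isSobolevConstant (n : ℕ) (hn : 3 ≤ n) : ∃ K, IsSobolevConstant n K := by
  have hn' : (3 : ℝ) ≤ n := by exact_mod_cast hn
  have hfr : Module.finrank ℝ (EuclideanSpace ℝ (Fin n)) = n := by simp
  have key := fun (φ : EuclideanSpace ℝ (Fin n) → ℝ) (hφ : IsTestFunction Set.univ φ) =>
    eLpNorm_le_eLpNorm_fderiv_of_eq (μ := (volume : Measure (EuclideanSpace ℝ (Fin n))))
    (F := ℝ) (u := φ) (p := 2) (p' := Real.toNNReal (2 * n / (n - 2)))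
    (hφ.contDiff.of_le (by exact_mod_cast le_top)) hφ.hasCompactSupport
    (by norm_num) (by rw [hfr]; omega)
    (by
      rw [hfr, Real.coe_toNNReal _ (div_nonneg (by linarith) (by linarith))]
      have : (n : ℝ) - 2 ≠ 0 := by linarith
      have : (n : ℝ) ≠ 0 := by linarith
      push_cast
      field_simp)
  have hgrad : ∀ φ : EuclideanSpace ℝ (Fin n) → ℝ,
      eLpNorm (gradient φ) 2 volume = eLpNorm (fderiv ℝ φ) 2 volume := fun φ =>
    eLpNorm_congr_norm_ae (Filter.Eventually.of_forall fun x => by simp [gradient])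
  refine ⟨SNormLESNormFDerivOfEqConst ℝ
    (volume : Measure (EuclideanSpace ℝ (Fin n))) ((2 : ℝ≥0) : ℝ) + 1, by positivity,
    fun φ hφ => ?_⟩
  rw [hgrad]
  refine (key φ hφ).trans ?_
  gcongr ?_ * _
  rw [← ENNReal.ofReal_coe_nnreal]
  exact ENNReal.ofReal_le_ofReal (by linarith)

end

noncomputable section

open Filter Topology

/-! Fix a level `k ≥ 0` that bounds `u⁺` on the boundary, put `w = (u - k)⁺`, `h = b - c`, and write
`K` for the Sobolev constant. Test the equation with `Z ≥ 0` in `W_0^{1,2}(Ω)` vanishing where `u ≤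
k`. Since `b·∇Z u + d u Z = (b·∇(uZ) + d u Z) - (b·∇u) Z` and the bracket has nonnegative integral
by `d ≥ div b`, the lower-order terms leave only the drift `h·∇u Z`. This gives the energy
inequality `HasEnergyIneq`, in which `b`, `c`, `d` enter through `h` alone.

The drift is not small, so it cannot be absorbed at every level. Split `h` at a height `t`: the part
above `t` has `L^n` norm at most `λ/(3K)` and the rest is bounded by `t`. On a superlevel set `{w >
l}` of measure at most `δ = (λ/(3Kt))^n`, Hölder and Sobolev bound each part by `λ/3` times the
energy of `(w - l)⁺`, which leaves a third of the ellipticity. Because `q > n`, the resulting decay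
of level sets is superlinear, and Stampacchia's iteration gives `w ≤ l + C₁F` almost everywhere,
with `F` dominating the norms of the data (`HasEnergyIneq.integral_max_sub_le`, `stampacchia`,
`HasEnergyIneq.measureReal_eq_zero`).

It remains to control such a level `l`. If `w ≤ M`, test with `Z = 1/(M+F-w) - 1/(M+F)`. The drift
is then linear in the norm of the gradient of `log((M+F)/(M+F-w))`, so that norm is bounded with no
smallness. A level exceeded on measure at least `δ` satisfies `M + F ≤ (M + F - l) e` with a
controlled factor `e` (`HasEnergyIneq.le_of_measure_level`). Take the first multiple `iF` exceeded
on measure at most `δ`. The iteration gives `M = (i + C₁)F`; the previous multiple `l = (i-1)F`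
obeys the logarithmic bound with `M + F - l = (C₁ + 2)F`, so the unknown `i` drops out
(`HasEnergyIneq.ae_le`).

The remaining work is the calculus of `W_0^{1,2}(Ω)` needed to justify the test functions. No
regularity of the boundary is available, so `u` itself need not lie in `L^{2n/(n-2)}(Ω)`; products
with `b` and `d` are handled after multiplying by cutoffs. -/

/-- The Euclidean space of dimension `n`. -/
abbrev Eu (n : ℕ) := EuclideanSpace ℝ (Fin n)

/-! ### Gradients and test functions -/

section Gradient

variable {n : ℕ} {Ω : Set (Eu n)} {φ ψ : Eu n → ℝ}

theorem gradient_mul_apply {x : Eu n} (hφ : DifferentiableAt ℝ φ x) (hψ : DifferentiableAt ℝ ψ x) :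
    gradient (fun y => φ y * ψ y) x = φ x • gradient ψ x + ψ x • gradient φ x := by
  have := fderiv_fun_mul hφ hψ
  simp [gradient, this]

theorem gradient_add_apply {x : Eu n} (hφ : DifferentiableAt ℝ φ x) (hψ : DifferentiableAt ℝ ψ x) :
    gradient (fun y => φ y + ψ y) x = gradient φ x + gradient ψ x := by
  have := fderiv_fun_add hφ hψ
  simp [gradient, this]

theorem gradient_comp_apply {x : Eu n} {F : ℝ → ℝ} (hF : DifferentiableAt ℝ F (φ x))
    (hφ : DifferentiableAt ℝ φ x) :
    gradient (fun y => F (φ y)) x = deriv F (φ x) • gradient φ x := by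
  have h : HasFDerivAt (fun y => F (φ y)) (deriv F (φ x) • fderiv ℝ φ x) x :=
    hF.hasDerivAt.comp_hasFDerivAt x hφ.hasFDerivAt
  simp [gradient, h.fderiv]

theorem gradient_apply_eq {x : Eu n} (i : Fin n) :
    gradient φ x i = fderiv ℝ φ x (EuclideanSpace.single i 1) := by
  rw [← inner_gradient_left (𝕜 := ℝ), EuclideanSpace.inner_single_right]
  simp

namespace IsTestFunction

theorem differentiable (hφ : IsTestFunction Ω φ) : Differentiable ℝ φ :=
  hφ.contDiff.differentiable (by simp)

theorem continuous (hφ : IsTestFunction Ω φ) : Continuous φ := hφ.contDiff.continuous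

theorem continuous_gradient (hφ : IsTestFunction Ω φ) : Continuous (gradient φ) := by
  have := hφ.contDiff.continuous_fderiv (by simp)
  exact (LinearIsometryEquiv.continuous _).comp this

theorem tsupport_gradient_subset (φ : Eu n → ℝ) : tsupport (gradient φ) ⊆ tsupport φ := by
  refine (closure_mono ?_).trans (tsupport_fderiv_subset ℝ (f := φ))
  intro x hx
  simpa [gradient] using hx

theorem hasCompactSupport_gradient (hφ : IsTestFunction Ω φ) : HasCompactSupport (gradient φ) :=
  hφ.hasCompactSupport.mono' ((subset_tsupport _).trans (tsupport_gradient_subset φ))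

theorem mono {Ω' : Set (Eu n)} (hφ : IsTestFunction Ω φ) (h : Ω ⊆ Ω') : IsTestFunction Ω' φ :=
  ⟨hφ.1, hφ.2, hφ.3.trans h⟩

theorem of_support (hφ : IsTestFunction Ω φ) (hψ : ContDiff ℝ ∞ ψ)
    (h : ∀ x, φ x = 0 → ψ x = 0) : IsTestFunction Ω ψ := by
  have hs : Function.support ψ ⊆ Function.support φ := fun x hx hx' => hx (h x hx')
  exact ⟨hψ, hφ.hasCompactSupport.mono hs, (closure_mono hs).trans hφ.3⟩

theorem mul_smooth (hφ : IsTestFunction Ω φ) (hψ : ContDiff ℝ ∞ ψ) :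
    IsTestFunction Ω (fun x => φ x * ψ x) :=
  hφ.of_support (hφ.contDiff.mul hψ) (by simp +contextual)

theorem comp (hφ : IsTestFunction Ω φ) {F : ℝ → ℝ} (hF : ContDiff ℝ ∞ F) (h0 : F 0 = 0) :
    IsTestFunction Ω (fun x => F (φ x)) :=
  hφ.of_support (hF.comp hφ.contDiff) (by simp +contextual [h0])

theorem const_mul (hφ : IsTestFunction Ω φ) (a : ℝ) : IsTestFunction Ω (fun x => a * φ x) :=
  hφ.of_support (contDiff_const.mul hφ.contDiff) (by simp +contextual)

theorem add (hφ : IsTestFunction Ω φ) (hψ : IsTestFunction Ω ψ) :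
    IsTestFunction Ω (fun x => φ x + ψ x) := by
  refine ⟨hφ.1.add hψ.1, hφ.2.add hψ.2, (tsupport_add φ ψ).trans (Set.union_subset hφ.3 hψ.3)⟩

theorem memLp (hφ : IsTestFunction Ω φ) (p : ℝ≥0∞) (S : Set (Eu n)) :
    MemLp φ p (volume.restrict S) :=
  (hφ.continuous.memLp_of_hasCompactSupport hφ.hasCompactSupport).restrict S

theorem memLp_gradient (hφ : IsTestFunction Ω φ) (p : ℝ≥0∞) (S : Set (Eu n)) :
    MemLp (gradient φ) p (volume.restrict S) :=
  (hφ.continuous_gradient.memLp_of_hasCompactSupport hφ.hasCompactSupport_gradient).restrict S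

theorem exists_bound (hφ : IsTestFunction Ω φ) : ∃ K, 0 ≤ K ∧ ∀ x, |φ x| ≤ K := by
  obtain ⟨K, hK⟩ := hφ.hasCompactSupport.exists_bound_of_continuous hφ.continuous
  exact ⟨K, (norm_nonneg _).trans (hK 0), fun x => hK x⟩

theorem exists_bound_gradient (hφ : IsTestFunction Ω φ) :
    ∃ K, 0 ≤ K ∧ ∀ x, ‖gradient φ x‖ ≤ K := by
  obtain ⟨K, hK⟩ := hφ.hasCompactSupport_gradient.exists_bound_of_continuous hφ.continuous_gradient
  exact ⟨K, (norm_nonneg _).trans (hK 0), fun x => hK x⟩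

theorem eq_zero_of_notMem (hφ : IsTestFunction Ω φ) {x : Eu n} (hx : x ∉ Ω) : φ x = 0 :=
  image_eq_zero_of_notMem_tsupport fun h => hx (hφ.3 h)

theorem gradient_eq_zero_of_notMem (hφ : IsTestFunction Ω φ) {x : Eu n} (hx : x ∉ Ω) :
    gradient φ x = 0 :=
  image_eq_zero_of_notMem_tsupport fun h => hx (hφ.3 (tsupport_gradient_subset φ h))

/-- There is a cutoff function in `C_c^∞(Ω)` that is `1` near a given compact set. -/
theorem exists_cutoff (hΩ : IsOpen Ω) {K : Set (Eu n)} (hK : IsCompact K) (hKΩ : K ⊆ Ω) :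
    ∃ χ, IsTestFunction Ω χ ∧ (∀ x, 0 ≤ χ x) ∧ ∃ U, IsOpen U ∧ K ⊆ U ∧ ∀ x ∈ U, χ x = 1 := by
  obtain ⟨L, hL, hKL, hLΩ⟩ := exists_compact_between hK hΩ hKΩ
  obtain ⟨L', hL', hLL', hLΩ'⟩ := exists_compact_between hL hΩ hLΩ
  obtain ⟨χ, hs, hr, h0, h1⟩ := exists_contMDiff_support_eq_eq_one_iff
    (modelWithCornersSelf ℝ (Eu n)) (n := (⊤ : ℕ∞)) isOpen_interior hL.isClosed hLL'
  have hsub : tsupport χ ⊆ L' := by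
    rw [tsupport, h0]
    exact closure_minimal interior_subset hL'.isClosed
  refine ⟨χ, ⟨hs.contDiff, ?_, hsub.trans hLΩ'⟩, fun x => (hr ⟨x, rfl⟩).1, interior L,
    isOpen_interior, hKL, fun x hx => (h1 x).1 (interior_subset hx)⟩
  exact hL'.of_isClosed_subset (isClosed_tsupport _) hsub

end IsTestFunction

end Gradient

/-! ### Limits in `L²` -/

section Lp

variable {α : Type*} [MeasurableSpace α] {μ : Measure α} {F : Type*} [NormedAddCommGroup F]

theorem tendsto_eLpNorm_two_of_dominated {g : ℕ → α → F} {G : α → ℝ} (hG : MemLp G 2 μ)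
    (hg : ∀ j, AEStronglyMeasurable (g j) μ) (hb : ∀ j, ∀ᵐ x ∂μ, ‖g j x‖ ≤ G x)
    (hlim : ∀ᵐ x ∂μ, Tendsto (fun j => g j x) atTop (𝓝 0)) :
    Tendsto (fun j => eLpNorm (g j) 2 μ) atTop (𝓝 0) := by
  have key : Tendsto (fun j => ∫⁻ x, ‖g j x‖ₑ ^ (2:ℝ) ∂μ) atTop (𝓝 (∫⁻ _, 0 ∂μ)) := by
    refine tendsto_lintegral_of_dominated_convergence' (fun x => ‖G x‖ₑ ^ (2:ℝ))
      (fun j => (hg j).enorm.pow_const _) (fun j => ?_) ?_ ?_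
    · filter_upwards [hb j] with x hx
      gcongr
      rw [← ofReal_norm, ← ofReal_norm]
      exact ENNReal.ofReal_le_ofReal (hx.trans (Real.le_norm_self _))
    · have := lintegral_rpow_enorm_lt_top_of_eLpNorm_lt_top (p := 2) (by simp) (by simp) hG.2
      simpa using this.ne
    · filter_upwards [hlim] with x hx
      have h1 := ((ENNReal.continuous_rpow_const (y := 2)).tendsto _).comp hx.enorm
      simpa [Function.comp_def] using h1
  have h2 : ∀ j, eLpNorm (g j) 2 μ = (∫⁻ x, ‖g j x‖ₑ ^ (2:ℝ) ∂μ) ^ (1 / (2:ℝ)) := fun j => by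
    rw [eLpNorm_eq_lintegral_rpow_enorm_toReal (by simp) (by simp)]; simp
  simp_rw [h2]
  have := ((ENNReal.continuous_rpow_const (y := 1 / (2:ℝ))).tendsto _).comp key
  simpa [Function.comp_def] using this

theorem exists_subseq_tendsto_ae {g : ℕ → α → F} {f : α → F}
    (hg : ∀ j, AEStronglyMeasurable (g j) μ) (hf : AEStronglyMeasurable f μ)
    (h : Tendsto (fun j => eLpNorm (fun x => f x - g j x) 2 μ) atTop (𝓝 0)) :
    ∃ ns : ℕ → ℕ, StrictMono ns ∧ ∀ᵐ x ∂μ, Tendsto (fun j => g (ns j) x) atTop (𝓝 (f x)) := by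
  refine (tendstoInMeasure_of_tendsto_eLpNorm (p := 2) (by simp) hg hf ?_).exists_seq_tendsto_ae
  refine h.congr fun j => ?_
  exact eLpNorm_sub_comm _ _ _ _

end Lp

/-! ### Hölder inequalities and continuity of integral functionals. -/

section Holder

variable {α : Type*} [MeasurableSpace α] {μ : Measure α}
  {F G : Type*} [NormedAddCommGroup F] [NormedAddCommGroup G]

theorem integrable_norm_mul_norm {f : α → F} {g : α → G} {p q : ℝ≥0∞} [ENNReal.HolderConjugate p q]
    (hf : MemLp f p μ) (hg : MemLp g q μ) : Integrable (fun x => ‖f x‖ * ‖g x‖) μ :=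
  memLp_one_iff_integrable.1 (MemLp.mul' (p := p) (q := q) hg.norm hf.norm)

theorem integral_norm_mul_norm_le {f : α → F} {g : α → G} {p q : ℝ≥0∞}
    [ENNReal.HolderConjugate p q] (hf : MemLp f p μ) (hg : MemLp g q μ) :
    ∫ x, ‖f x‖ * ‖g x‖ ∂μ ≤ (eLpNorm f p μ).toReal * (eLpNorm g q μ).toReal := by
  have h := eLpNorm_smul_le_mul_eLpNorm (p := p) (q := q) (r := 1) hg.norm.1 hf.norm.1
  rw [eLpNorm_norm, eLpNorm_norm] at h
  rw [← ENNReal.toReal_mul]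
  have h2 := ENNReal.toReal_mono (ENNReal.mul_ne_top hf.2.ne hg.2.ne) h
  refine le_trans (le_of_eq ?_) h2
  have hm : AEStronglyMeasurable (fun x => ‖f x‖ * ‖g x‖) μ := hf.norm.1.mul hg.norm.1
  rw [integral_eq_lintegral_of_nonneg_ae (ae_of_all _ fun x => by positivity) hm, eLpNorm_one_eq_lintegral_enorm]
  congr 1
  refine lintegral_congr fun x => ?_
  rw [← ofReal_norm]
  simp

theorem tendsto_eLpNorm_of_le_mul {f : ℕ → α → F} {g : ℕ → α → G} {p : ℝ≥0∞} (K : ℝ)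
    (h : ∀ j, ∀ᵐ x ∂μ, ‖f j x‖ ≤ K * ‖g j x‖)
    (hg : Tendsto (fun j => eLpNorm (g j) p μ) atTop (𝓝 0)) :
    Tendsto (fun j => eLpNorm (f j) p μ) atTop (𝓝 0) := by
  have h1 : Tendsto (fun j => ENNReal.ofReal K * eLpNorm (g j) p μ) atTop (𝓝 0) := by
    simpa using ENNReal.Tendsto.const_mul hg (Or.inr ENNReal.ofReal_ne_top)
  exact tendsto_of_tendsto_of_tendsto_of_le_of_le tendsto_const_nhds h1 (fun _ => zero_le)
    fun j => eLpNorm_le_mul_eLpNorm_of_ae_le_mul (h j) p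

theorem tendsto_eLpNorm_of_le_add {f g h : ℕ → α → F} {p : ℝ≥0∞} (hp : 1 ≤ p)
    (hgm : ∀ j, AEStronglyMeasurable (g j) μ) (hhm : ∀ j, AEStronglyMeasurable (h j) μ)
    (he : ∀ j, ∀ᵐ x ∂μ, f j x = g j x + h j x)
    (hg : Tendsto (fun j => eLpNorm (g j) p μ) atTop (𝓝 0))
    (hh : Tendsto (fun j => eLpNorm (h j) p μ) atTop (𝓝 0)) :
    Tendsto (fun j => eLpNorm (f j) p μ) atTop (𝓝 0) := by
  have h1 := hg.add hh
  rw [add_zero] at h1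
  refine tendsto_of_tendsto_of_tendsto_of_le_of_le tendsto_const_nhds h1 (fun _ => zero_le)
    fun j => ?_
  rw [eLpNorm_congr_ae (he j)]
  exact eLpNorm_add_le (hgm j) (hhm j) hp

theorem eLpNorm_sub_le_add_sub {f g h : α → F} {p : ℝ≥0∞} (hp : 1 ≤ p)
    (hf : AEStronglyMeasurable f μ) (hg : AEStronglyMeasurable g μ)
    (hh : AEStronglyMeasurable h μ) :
    eLpNorm (fun x => f x - h x) p μ
      ≤ eLpNorm (fun x => f x - g x) p μ + eLpNorm (fun x => g x - h x) p μ := by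
  refine le_trans (le_of_eq ?_) (eLpNorm_add_le (hf.sub hg) (hg.sub hh) hp)
  congr 1
  ext x
  simp

variable [InnerProductSpace ℝ F]

theorem integrable_inner_of_memLp {f g : α → F} {p q : ℝ≥0∞} [ENNReal.HolderConjugate p q]
    (hf : MemLp f p μ) (hg : MemLp g q μ) : Integrable (fun x => inner ℝ (f x) (g x)) μ :=
  (integrable_norm_mul_norm hf hg).mono' (hf.1.inner hg.1)
    (Eventually.of_forall fun _ => norm_inner_le_norm _ _)

theorem integrable_mul_of_memLp {f g : α → ℝ} {p q : ℝ≥0∞} [ENNReal.HolderConjugate p q]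
    (hf : MemLp f p μ) (hg : MemLp g q μ) : Integrable (fun x => f x * g x) μ :=
  memLp_one_iff_integrable.1 (MemLp.mul' (p := p) (q := q) hg hf)

/-- Continuity of the functional `(v, V) ↦ ∫ P · V + p v` on `L^s × L²`. -/
theorem tendsto_integral_inner_add_mul {P V : α → F} {p v : α → ℝ} {s s' : ℝ≥0∞}
    [ENNReal.HolderConjugate s' s] (hP : MemLp P 2 μ) (hp : MemLp p s' μ)
    (hV : MemLp V 2 μ) (hv : MemLp v s μ) {vs : ℕ → α → ℝ} {Vs : ℕ → α → F}
    (hVs : ∀ j, MemLp (Vs j) 2 μ) (hvs : ∀ j, MemLp (vs j) s μ)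
    (h1 : Tendsto (fun j => eLpNorm (fun x => v x - vs j x) s μ) atTop (𝓝 0))
    (h2 : Tendsto (fun j => eLpNorm (fun x => V x - Vs j x) 2 μ) atTop (𝓝 0)) :
    Tendsto (fun j => ∫ x, (inner ℝ (P x) (Vs j x) + p x * vs j x) ∂μ) atTop
      (𝓝 (∫ x, (inner ℝ (P x) (V x) + p x * v x) ∂μ)) := by
  have e1 : ∀ j, Integrable (fun x => inner ℝ (P x) (Vs j x) + p x * vs j x) μ := fun j =>
    (integrable_inner_of_memLp hP (hVs j)).add (integrable_mul_of_memLp hp (hvs j))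
  have e2 : Integrable (fun x => inner ℝ (P x) (V x) + p x * v x) μ :=
    (integrable_inner_of_memLp hP hV).add (integrable_mul_of_memLp hp hv)
  rw [tendsto_iff_norm_sub_tendsto_zero]
  have hlim : Tendsto (fun j => (eLpNorm P 2 μ).toReal * (eLpNorm (fun x => V x - Vs j x) 2 μ).toReal
      + (eLpNorm p s' μ).toReal * (eLpNorm (fun x => v x - vs j x) s μ).toReal) atTop (𝓝 0) := by
    have h1' := (ENNReal.tendsto_toReal ENNReal.zero_ne_top).comp h1
    have h2' := (ENNReal.tendsto_toReal ENNReal.zero_ne_top).comp h2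
    simpa using (h2'.const_mul _).add (h1'.const_mul _)
  refine squeeze_zero (fun _ => norm_nonneg _) (fun j => ?_) hlim
  have m1 := hV.sub (hVs j)
  have m2 := hv.sub (hvs j)
  rw [← integral_sub (e1 j) e2]
  refine (norm_integral_le_integral_norm _).trans ?_
  have i1 := integral_norm_mul_norm_le hP m1
  have i2 := integral_norm_mul_norm_le hp m2
  refine le_trans ?_ (add_le_add i1 i2)
  rw [← integral_add (integrable_norm_mul_norm hP m1) (integrable_norm_mul_norm hp m2)]
  refine integral_mono ((e1 j).sub e2).norm
    ((integrable_norm_mul_norm hP m1).add (integrable_norm_mul_norm hp m2)) fun x => ?_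
  have : inner ℝ (P x) (Vs j x) + p x * vs j x - (inner ℝ (P x) (V x) + p x * v x)
    = - (inner ℝ (P x) (V x - Vs j x) + p x * (v x - vs j x)) := by
    rw [inner_sub_right]; ring
  simp only [this, norm_neg]
  refine (norm_add_le _ _).trans (add_le_add (norm_inner_le_norm _ _) ?_)
  rw [norm_mul]; rfl

end Holder

/-! ### The space `W_0^{1,2}(Ω)` as a class of pairs (function, gradient) -/

/-- `v ∈ W_0^{1,2}(Ω)` with gradient `V`: the pair is a limit of test functions. -/
structure IsW12Zero {n : ℕ} (Ω : Set (Eu n)) (v : Eu n → ℝ) (V : Eu n → Eu n) : Prop where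
  aesm : AEStronglyMeasurable v (volume.restrict Ω)
  aesm_grad : AEStronglyMeasurable V (volume.restrict Ω)
  approx : ∀ ε : ℝ≥0∞, 0 < ε → ∃ φ, IsTestFunction Ω φ ∧
    eLpNorm (fun x => v x - φ x) 2 (volume.restrict Ω) +
      eLpNorm (fun x => V x - gradient φ x) 2 (volume.restrict Ω) < ε

theorem MemW12Zero.exists_isW12Zero {n : ℕ} {Ω : Set (Eu n)} {u : Eu n → ℝ} (h : MemW12Zero Ω u) :
    ∃ D, IsW12With Ω u D ∧ IsW12Zero Ω u D := by
  obtain ⟨D, h1, h2⟩ := h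
  exact ⟨D, h1, h1.memLp.1, h1.memLp_grad.1, h2⟩

namespace IsW12Zero

variable {n : ℕ} {Ω : Set (Eu n)} {v w : Eu n → ℝ} {V W : Eu n → Eu n}

theorem of_test {φ : Eu n → ℝ} (hφ : IsTestFunction Ω φ) : IsW12Zero Ω φ (gradient φ) :=
  ⟨hφ.continuous.aestronglyMeasurable, hφ.continuous_gradient.aestronglyMeasurable,
    fun ε hε => ⟨φ, hφ, by simpa using hε⟩⟩

/-- The predicate `Q` carries a side condition on the approximants; it is used with nonnegativity.
-/
theorem exists_seq_of_approx {Q : (Eu n → ℝ) → Prop} (h : ∀ ε : ℝ≥0∞, 0 < ε →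
    ∃ φ, IsTestFunction Ω φ ∧ Q φ ∧ eLpNorm (fun x => v x - φ x) 2 (volume.restrict Ω) +
      eLpNorm (fun x => V x - gradient φ x) 2 (volume.restrict Ω) < ε) :
    ∃ φ : ℕ → Eu n → ℝ, (∀ j, IsTestFunction Ω (φ j)) ∧ (∀ j, Q (φ j)) ∧
    Tendsto (fun j => eLpNorm (fun x => v x - φ j x) 2 (volume.restrict Ω)) atTop (𝓝 0) ∧
    Tendsto (fun j => eLpNorm (fun x => V x - gradient (φ j) x) 2 (volume.restrict Ω))
      atTop (𝓝 0) := by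
  have hpos : ∀ j : ℕ, (0 : ℝ≥0∞) < ((j : ℝ≥0∞) + 1)⁻¹ := fun j => by simp
  choose φ h1 hQ h2 using fun j : ℕ => h _ (hpos j)
  have hl : Tendsto (fun j : ℕ => ((j : ℝ≥0∞) + 1)⁻¹) atTop (𝓝 0) := by
    have := (tendsto_add_atTop_iff_nat 1).2 ENNReal.tendsto_inv_nat_nhds_zero
    simpa using this
  refine ⟨φ, h1, hQ, ?_, ?_⟩
  · exact tendsto_of_tendsto_of_tendsto_of_le_of_le tendsto_const_nhds hl (fun _ => zero_le)
      fun j => le_self_add.trans (h2 j).le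
  · exact tendsto_of_tendsto_of_tendsto_of_le_of_le tendsto_const_nhds hl (fun _ => zero_le)
      fun j => le_add_self.trans (h2 j).le

theorem exists_seq (h : IsW12Zero Ω v V) : ∃ φ : ℕ → Eu n → ℝ, (∀ j, IsTestFunction Ω (φ j)) ∧
    Tendsto (fun j => eLpNorm (fun x => v x - φ j x) 2 (volume.restrict Ω)) atTop (𝓝 0) ∧
    Tendsto (fun j => eLpNorm (fun x => V x - gradient (φ j) x) 2 (volume.restrict Ω))
      atTop (𝓝 0) := by
  obtain ⟨φ, h1, -, h2⟩ := exists_seq_of_approx (Q := fun _ => True)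
    (by simpa using h.approx)
  exact ⟨φ, h1, h2⟩

theorem memLp (h : IsW12Zero Ω v V) : MemLp v 2 (volume.restrict Ω) := by
  obtain ⟨φ, hφ, h1⟩ := h.approx 1 one_pos
  have : MemLp (fun x => v x - φ x) 2 (volume.restrict Ω) :=
    ⟨h.aesm.sub hφ.continuous.aestronglyMeasurable,
      (le_self_add.trans h1.le).trans_lt ENNReal.one_lt_top⟩
  refine MemLp.ae_eq (ae_of_all _ fun x => ?_) (this.add (hφ.memLp 2 Ω))
  simp

theorem memLp_grad (h : IsW12Zero Ω v V) : MemLp V 2 (volume.restrict Ω) := by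
  obtain ⟨φ, hφ, h1⟩ := h.approx 1 one_pos
  have : MemLp (fun x => V x - gradient φ x) 2 (volume.restrict Ω) :=
    ⟨h.aesm_grad.sub hφ.continuous_gradient.aestronglyMeasurable,
      (le_add_self.trans h1.le).trans_lt ENNReal.one_lt_top⟩
  refine MemLp.ae_eq (ae_of_all _ fun x => ?_) (this.add (hφ.memLp_gradient 2 Ω))
  simp

theorem congr_ae (h : IsW12Zero Ω v V) (h1 : v =ᵐ[volume.restrict Ω] w)
    (h2 : V =ᵐ[volume.restrict Ω] W) : IsW12Zero Ω w W := by
  refine ⟨h.aesm.congr h1, h.aesm_grad.congr h2, fun ε hε => ?_⟩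
  obtain ⟨φ, hφ, h3⟩ := h.approx ε hε
  refine ⟨φ, hφ, ?_⟩
  have e1 := eLpNorm_congr_ae (p := 2) (h1.sub (EventuallyEq.refl _ φ))
  have e2 := eLpNorm_congr_ae (p := 2) (h2.sub (EventuallyEq.refl _ (gradient φ)))
  calc _ = _ := congrArg₂ (· + ·) e1.symm e2.symm
    _ < ε := h3

theorem approx_of_tendsto {Q : (Eu n → ℝ) → Prop} {vs : ℕ → Eu n → ℝ} {Vs : ℕ → Eu n → Eu n}
    (hvs : ∀ j, AEStronglyMeasurable (vs j) (volume.restrict Ω))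
    (hVs : ∀ j, AEStronglyMeasurable (Vs j) (volume.restrict Ω))
    (h : ∀ j, ∀ ε : ℝ≥0∞, 0 < ε →
      ∃ φ, IsTestFunction Ω φ ∧ Q φ ∧ eLpNorm (fun x => vs j x - φ x) 2 (volume.restrict Ω) +
        eLpNorm (fun x => Vs j x - gradient φ x) 2 (volume.restrict Ω) < ε)
    (hv : AEStronglyMeasurable v (volume.restrict Ω))
    (hV : AEStronglyMeasurable V (volume.restrict Ω))
    (h1 : Tendsto (fun j => eLpNorm (fun x => v x - vs j x) 2 (volume.restrict Ω)) atTop (𝓝 0))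
    (h2 : Tendsto (fun j => eLpNorm (fun x => V x - Vs j x) 2 (volume.restrict Ω)) atTop (𝓝 0))
    (ε : ℝ≥0∞) (hε : 0 < ε) :
    ∃ φ, IsTestFunction Ω φ ∧ Q φ ∧ eLpNorm (fun x => v x - φ x) 2 (volume.restrict Ω) +
        eLpNorm (fun x => V x - gradient φ x) 2 (volume.restrict Ω) < ε := by
  have h12 := h1.add h2
  rw [add_zero] at h12
  obtain ⟨j, hj⟩ := (h12.eventually_lt_const (ENNReal.half_pos hε.ne')).exists
  obtain ⟨φ, hφ, hQ, h3⟩ := h j _ (ENNReal.half_pos hε.ne')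
  refine ⟨φ, hφ, hQ, ?_⟩
  have hm := hφ.continuous.aestronglyMeasurable (μ := volume.restrict Ω)
  have hm' := hφ.continuous_gradient.aestronglyMeasurable (μ := volume.restrict Ω)
  calc _ ≤ _ := add_le_add (eLpNorm_sub_le_add_sub (by norm_num) hv (hvs j) hm)
        (eLpNorm_sub_le_add_sub (by norm_num) hV (hVs j) hm')
    _ = _ := add_add_add_comm _ _ _ _
    _ < ε / 2 + ε / 2 := ENNReal.add_lt_add hj h3
    _ = ε := ENNReal.add_halves ε

/-- `W_0^{1,2}(Ω)` is closed. -/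
theorem of_tendsto {vs : ℕ → Eu n → ℝ} {Vs : ℕ → Eu n → Eu n}
    (h : ∀ j, IsW12Zero Ω (vs j) (Vs j))
    (hv : AEStronglyMeasurable v (volume.restrict Ω))
    (hV : AEStronglyMeasurable V (volume.restrict Ω))
    (h1 : Tendsto (fun j => eLpNorm (fun x => v x - vs j x) 2 (volume.restrict Ω)) atTop (𝓝 0))
    (h2 : Tendsto (fun j => eLpNorm (fun x => V x - Vs j x) 2 (volume.restrict Ω)) atTop (𝓝 0)) :
    IsW12Zero Ω v V := by
  refine ⟨hv, hV, fun ε hε => ?_⟩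
  obtain ⟨φ, hφ, -, h3⟩ := approx_of_tendsto (Q := fun _ => True) (fun j => (h j).aesm)
    (fun j => (h j).aesm_grad) (fun j => by simpa using (h j).approx) hv hV h1 h2 ε hε
  exact ⟨φ, hφ, h3⟩

theorem add (h : IsW12Zero Ω v V) (h' : IsW12Zero Ω w W) :
    IsW12Zero Ω (fun x => v x + w x) (fun x => V x + W x) := by
  obtain ⟨φ, hφ, h1, h2⟩ := h.exists_seq
  obtain ⟨ψ, hψ, h3, h4⟩ := h'.exists_seq
  refine of_tendsto (fun j => of_test ((hφ j).add (hψ j))) (h.aesm.add h'.aesm)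
    (h.aesm_grad.add h'.aesm_grad) ?_ ?_
  · refine tendsto_eLpNorm_of_le_add (by norm_num)
      (fun j => h.aesm.sub (hφ j).continuous.aestronglyMeasurable)
      (fun j => h'.aesm.sub (hψ j).continuous.aestronglyMeasurable)
      (fun j => ae_of_all _ fun x => ?_) h1 h3
    simp only [Pi.sub_apply]
    ring
  · refine tendsto_eLpNorm_of_le_add (by norm_num)
      (fun j => h.aesm_grad.sub (hφ j).continuous_gradient.aestronglyMeasurable)
      (fun j => h'.aesm_grad.sub (hψ j).continuous_gradient.aestronglyMeasurable)
      (fun j => ae_of_all _ fun x => ?_) h2 h4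
    simp only [Pi.sub_apply]
    rw [gradient_add_apply ((hφ j).differentiable x) ((hψ j).differentiable x)]
    abel

theorem const_mul (h : IsW12Zero Ω v V) (a : ℝ) :
    IsW12Zero Ω (fun x => a * v x) (fun x => a • V x) := by
  obtain ⟨φ, hφ, h1, h2⟩ := h.exists_seq
  refine of_tendsto (fun j => of_test ((hφ j).const_mul a)) (h.aesm.const_mul a)
    (h.aesm_grad.const_smul a) ?_ ?_
  · refine tendsto_eLpNorm_of_le_mul |a| (fun j => ae_of_all _ fun x => ?_) h1
    rw [← mul_sub, norm_mul, Real.norm_eq_abs]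
  · refine tendsto_eLpNorm_of_le_mul |a| (fun j => ae_of_all _ fun x => ?_) h2
    have := gradient_mul_apply (φ := fun _ => a) (differentiableAt_const _)
      ((hφ j).differentiable x)
    rw [this, gradient_fun_const, smul_zero, add_zero, ← smul_sub, norm_smul, Real.norm_eq_abs]

theorem sub (h : IsW12Zero Ω v V) (h' : IsW12Zero Ω w W) :
    IsW12Zero Ω (fun x => v x - w x) (fun x => V x - W x) := by
  simpa [sub_eq_add_neg] using h.add (h'.const_mul (-1))

end IsW12Zero

/-! ### Weak gradients and their uniqueness. -/

section Weak

variable {n : ℕ} {Ω : Set (Eu n)} {v : Eu n → ℝ} {V W : Eu n → Eu n}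

theorem IsTestFunction.integral_mul_gradient {φ θ : Eu n → ℝ} (hφ : IsTestFunction Ω φ)
    (hθ : IsTestFunction Ω θ) (i : Fin n) :
    ∫ x in Ω, φ x * gradient θ x i = -∫ x in Ω, gradient φ x i * θ x := by
  rw [setIntegral_eq_integral_of_forall_compl_eq_zero
      (fun x hx => by rw [hφ.eq_zero_of_notMem hx, zero_mul]),
    setIntegral_eq_integral_of_forall_compl_eq_zero
      (fun x hx => by rw [hθ.eq_zero_of_notMem hx, mul_zero])]
  simp_rw [gradient_apply_eq]
  have c1 := (hφ.contDiff.continuous_fderiv (by simp)).clm_apply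
    (continuous_const (y := EuclideanSpace.single i (1:ℝ)))
  have c2 := (hθ.contDiff.continuous_fderiv (by simp)).clm_apply
    (continuous_const (y := EuclideanSpace.single i (1:ℝ)))
  apply integral_mul_fderiv_eq_neg_fderiv_mul_of_integrable
  · exact (c1.mul hθ.continuous).integrable_of_hasCompactSupport hθ.hasCompactSupport.mul_left
  · exact (hφ.continuous.mul c2).integrable_of_hasCompactSupport hφ.hasCompactSupport.mul_right
  · exact (hφ.continuous.mul hθ.continuous).integrable_of_hasCompactSupport
      hθ.hasCompactSupport.mul_left
  · exact fun x _ => hφ.differentiable x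
  · exact fun x _ => hθ.differentiable x

theorem memLp_apply {p : ℝ≥0∞} {μ : Measure (Eu n)} (hV : MemLp V p μ) (i : Fin n) :
    MemLp (fun x => V x i) p μ := by
  refine hV.mono ?_ (ae_of_all _ fun x => PiLp.norm_apply_le (V x) i)
  exact (EuclideanSpace.proj (𝕜 := ℝ) i).continuous.comp_aestronglyMeasurable hV.1

/-- The functional `∫ θ eᵢ·V + ∂ᵢθ v` is continuous for the `L²` norms of the pair and vanishes on
test functions by integration by parts. -/
theorem IsW12Zero.weak_grad (h : IsW12Zero Ω v V) {θ : Eu n → ℝ} (hθ : IsTestFunction Ω θ)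
    (i : Fin n) : ∫ x in Ω, v x * gradient θ x i = -∫ x in Ω, V x i * θ x := by
  obtain ⟨φ, hφ, h1, h2⟩ := h.exists_seq
  have hP : MemLp (fun x => θ x • EuclideanSpace.single i (1:ℝ)) 2 (volume.restrict Ω) :=
    ((hθ.continuous.smul continuous_const).memLp_of_hasCompactSupport
      hθ.hasCompactSupport.smul_right).restrict Ω
  have hp : MemLp (fun x => gradient θ x i) 2 (volume.restrict Ω) :=
    memLp_apply (hθ.memLp_gradient 2 Ω) i
  have key := tendsto_integral_inner_add_mul hP hp h.memLp_grad h.memLp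
    (fun j => (hφ j).memLp_gradient 2 Ω) (fun j => (hφ j).memLp 2 Ω) h1 h2
  have e : ∀ (v : Eu n → ℝ) (V : Eu n → Eu n), MemLp v 2 (volume.restrict Ω) →
      MemLp V 2 (volume.restrict Ω) →
      ∫ x in Ω, (inner ℝ (θ x • EuclideanSpace.single i (1:ℝ)) (V x) + gradient θ x i * v x)
        = (∫ x in Ω, V x i * θ x) + ∫ x in Ω, v x * gradient θ x i := by
    intro v V hv hV
    rw [← integral_add (integrable_mul_of_memLp (memLp_apply hV i) (hθ.memLp 2 Ω))
      (integrable_mul_of_memLp hv hp)]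
    refine integral_congr_ae (ae_of_all _ fun x => ?_)
    simp only [inner_smul_left, EuclideanSpace.inner_single_left]
    simp
    ring
  rw [e v V h.memLp h.memLp_grad] at key
  have hz : ∀ j, ∫ x in Ω, (inner ℝ (θ x • EuclideanSpace.single i (1:ℝ)) (gradient (φ j) x)
      + gradient θ x i * φ j x) = 0 := fun j => by
    rw [e _ _ ((hφ j).memLp 2 Ω) ((hφ j).memLp_gradient 2 Ω),
      (hφ j).integral_mul_gradient hθ i]
    ring
  simp_rw [hz] at key
  have := tendsto_nhds_unique key tendsto_const_nhds
  linarith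

theorem ae_eq_of_forall_integral_mul_test (hΩ : IsOpen Ω) (hV : MemLp V 2 (volume.restrict Ω))
    (hW : MemLp W 2 (volume.restrict Ω))
    (h : ∀ θ, IsTestFunction Ω θ → ∀ i, ∫ x in Ω, V x i * θ x = ∫ x in Ω, W x i * θ x) :
    V =ᵐ[volume.restrict Ω] W := by
  have key : ∀ i, ∀ᵐ x, x ∈ Ω → (V x i - W x i) = 0 := fun i => by
    have hi := (memLp_apply hV i).sub (memLp_apply hW i)
    refine hΩ.ae_eq_zero_of_integral_contDiff_smul_eq_zero ?_ fun θ h1 h2 h3 => ?_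
    · have := hi.locallyIntegrable (by norm_num)
      exact locallyIntegrableOn_of_locallyIntegrable_restrict this
    · have hθ : IsTestFunction Ω θ := ⟨h1, h2, h3⟩
      rw [← setIntegral_eq_integral_of_forall_compl_eq_zero (s := Ω)
        (fun x hx => by rw [hθ.eq_zero_of_notMem hx, zero_smul])]
      have h4 := h θ hθ i
      rw [← sub_eq_zero, ← integral_sub (integrable_mul_of_memLp (memLp_apply hV i) (hθ.memLp 2 Ω))
        (integrable_mul_of_memLp (memLp_apply hW i) (hθ.memLp 2 Ω))] at h4
      rw [← h4]
      refine integral_congr_ae (ae_of_all _ fun x => ?_)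
      simp only [smul_eq_mul]
      ring
  rw [Filter.EventuallyEq, ae_restrict_iff' hΩ.measurableSet]
  filter_upwards [ae_all_iff.2 key] with x hx hxΩ
  ext i
  exact sub_eq_zero.1 (hx i hxΩ)

theorem IsW12Zero.grad_unique (hΩ : IsOpen Ω) (h : IsW12Zero Ω v V) (h' : IsW12Zero Ω v W) :
    V =ᵐ[volume.restrict Ω] W :=
  ae_eq_of_forall_integral_mul_test hΩ h.memLp_grad h'.memLp_grad fun _ hθ i =>
    neg_injective ((h.weak_grad hθ i).symm.trans (h'.weak_grad hθ i))

end Weak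

/-! ### The chain rule in `W_0^{1,2}(Ω)` -/

/-- The primitive of `G` that vanishes at `0`. -/
def prim (G : ℝ → ℝ) (s : ℝ) : ℝ := ∫ t in (0 : ℝ)..s, G t

/-- A bounded measurable function on the line. -/
structure IsBddMeas (G : ℝ → ℝ) (K : ℝ) : Prop where
  meas : Measurable G
  bdd : ∀ s, |G s| ≤ K

namespace IsBddMeas

variable {G : ℝ → ℝ} {K : ℝ}

theorem intervalIntegrable (h : IsBddMeas G K) (a b : ℝ) : IntervalIntegrable G volume a b := by
  refine (intervalIntegrable_const (c := K)).mono_fun h.meas.aestronglyMeasurable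
    (ae_of_all _ fun s => ?_)
  exact (h.bdd s).trans (le_abs_self K)

theorem abs_prim_sub_le (h : IsBddMeas G K) (a b : ℝ) : |prim G a - prim G b| ≤ K * |a - b| := by
  rw [prim, prim, intervalIntegral.integral_interval_sub_left (h.intervalIntegrable _ _)
    (h.intervalIntegrable _ _)]
  exact intervalIntegral.norm_integral_le_of_norm_le_const
    fun s _ => (Real.norm_eq_abs _).trans_le (h.bdd s)

theorem abs_prim_le (h : IsBddMeas G K) (a : ℝ) : |prim G a| ≤ K * |a| := by
  simpa [prim] using h.abs_prim_sub_le a 0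

theorem continuous_prim (h : IsBddMeas G K) : Continuous (prim G) :=
  intervalIntegral.continuous_primitive (fun _ _ => h.intervalIntegrable _ _) 0

end IsBddMeas

theorem contDiff_prim {G : ℝ → ℝ} (hG : ContDiff ℝ ∞ G) :
    ContDiff ℝ ∞ (prim G) ∧ deriv (prim G) = G := by
  have hd : ∀ s, HasDerivAt (prim G) (G s) s := fun s =>
    intervalIntegral.integral_hasDerivAt_right (hG.continuous.intervalIntegrable _ _)
      (hG.continuous.stronglyMeasurableAtFilter _ _) hG.continuous.continuousAt
  have he : deriv (prim G) = G := funext fun s => (hd s).deriv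
  exact ⟨contDiff_infty_iff_deriv.2 ⟨fun s => (hd s).differentiableAt, by rwa [he]⟩, he⟩

namespace IsW12Zero

variable {n : ℕ} {Ω : Set (Eu n)} {v w : Eu n → ℝ} {V W : Eu n → Eu n} {K : ℝ}

/-- The gradient error splits as `(G(v) - G(φ))∇v + G(φ)(∇v - ∇φ)`. The first term tends to zero by
dominated convergence along an almost everywhere convergent subsequence, the second because `G` is
bounded. The sequence itself is exposed because nonnegativity of the primitive of `G` is later
inherited by the approximants. -/
theorem chain_smooth_seq (h : IsW12Zero Ω v V) {G : ℝ → ℝ} (hG : ContDiff ℝ ∞ G)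
    (hb : IsBddMeas G K) :
    ∃ φ : ℕ → Eu n → ℝ, (∀ j, IsTestFunction Ω (φ j)) ∧
      Tendsto (fun j => eLpNorm (fun x => prim G (v x) - prim G (φ j x)) 2 (volume.restrict Ω))
        atTop (𝓝 0) ∧
      Tendsto (fun j => eLpNorm (fun x => G (v x) • V x - gradient (fun y => prim G (φ j y)) x) 2
        (volume.restrict Ω)) atTop (𝓝 0) := by
  obtain ⟨φ, hφ, h1, h2⟩ := h.exists_seq
  obtain ⟨ns, hns, hae⟩ := exists_subseq_tendsto_ae
    (fun j => (hφ j).continuous.aestronglyMeasurable) h.aesm h1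
  obtain ⟨hF, hF'⟩ := contDiff_prim hG
  have h1' := h1.comp hns.tendsto_atTop
  have h2' := h2.comp hns.tendsto_atTop
  have hGv : AEStronglyMeasurable (fun x => G (v x)) (volume.restrict Ω) :=
    hG.continuous.comp_aestronglyMeasurable h.aesm
  have hGφ : ∀ j, Continuous (fun x => G (φ (ns j) x)) := fun j =>
    hG.continuous.comp (hφ _).continuous
  refine ⟨fun j => φ (ns j), fun j => hφ _, ?_, ?_⟩
  · exact tendsto_eLpNorm_of_le_mul K (fun j => ae_of_all _ fun x => hb.abs_prim_sub_le _ _) h1'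
  · have e : ∀ j, ∀ᵐ x ∂(volume.restrict Ω),
        G (v x) • V x - gradient (fun y => prim G (φ (ns j) y)) x
        = (G (v x) - G (φ (ns j) x)) • V x + G (φ (ns j) x) • (V x - gradient (φ (ns j)) x) :=
      fun j => ae_of_all _ fun x => by
        rw [gradient_comp_apply (hF.differentiable (by simp) _) ((hφ _).differentiable x), hF',
          smul_sub, sub_smul]
        abel
    refine tendsto_eLpNorm_of_le_add (by norm_num)
      (fun j => (hGv.sub (hGφ j).aestronglyMeasurable).smul h.aesm_grad)
      (fun j => (hGφ j).aestronglyMeasurable.smul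
        (h.aesm_grad.sub (hφ _).continuous_gradient.aestronglyMeasurable)) e ?_ ?_
    · refine tendsto_eLpNorm_two_of_dominated (h.memLp_grad.norm.const_mul (2 * K))
        (fun j => (hGv.sub (hGφ j).aestronglyMeasurable).smul h.aesm_grad)
        (fun j => ae_of_all _ fun x => ?_) ?_
      · simp only [Pi.smul_apply', Pi.sub_apply, norm_smul, Real.norm_eq_abs]
        gcongr
        linarith [abs_sub (G (v x)) (G (φ (ns j) x)), hb.bdd (v x), hb.bdd (φ (ns j) x)]
      · filter_upwards [hae] with x hx
        have := ((hG.continuous.tendsto _).comp hx).const_sub (G (v x))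
        simpa using this.smul_const (V x)
    · refine tendsto_eLpNorm_of_le_mul K (fun j => ae_of_all _ fun x => ?_) h2'
      simp only [Pi.smul_apply', norm_smul, Real.norm_eq_abs]
      exact mul_le_mul_of_nonneg_right (hb.bdd _) (norm_nonneg _)

theorem chain_smooth (h : IsW12Zero Ω v V) {G : ℝ → ℝ} (hG : ContDiff ℝ ∞ G)
    (hb : IsBddMeas G K) : IsW12Zero Ω (fun x => prim G (v x)) (fun x => G (v x) • V x) := by
  obtain ⟨φ, hφ, h1, h2⟩ := h.chain_smooth_seq hG hb
  exact of_tendsto (fun j => of_test ((hφ j).comp (contDiff_prim hG).1 (by simp [prim])))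
    (hb.continuous_prim.comp_aestronglyMeasurable h.aesm)
    ((hG.continuous.comp_aestronglyMeasurable h.aesm).smul h.aesm_grad) h1 h2

theorem tendsto_chain (h : IsW12Zero Ω v V) {Gs : ℕ → ℝ → ℝ} {G : ℝ → ℝ}
    (hb : ∀ m, IsBddMeas (Gs m) K) (hb' : IsBddMeas G K)
    (hlim : ∀ s, Tendsto (fun m => Gs m s) atTop (𝓝 (G s))) :
    Tendsto (fun m => eLpNorm (fun x => prim G (v x) - prim (Gs m) (v x)) 2 (volume.restrict Ω))
        atTop (𝓝 0) ∧
      Tendsto (fun m => eLpNorm (fun x => G (v x) • V x - Gs m (v x) • V x) 2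
        (volume.restrict Ω)) atTop (𝓝 0) := by
  have hmG : ∀ {G : ℝ → ℝ}, IsBddMeas G K →
      AEStronglyMeasurable (fun x => G (v x)) (volume.restrict Ω) := fun hb =>
    (hb.meas.comp_aemeasurable h.aesm.aemeasurable).aestronglyMeasurable
  constructor
  · refine tendsto_eLpNorm_two_of_dominated (h.memLp.norm.const_mul (2 * K))
      (fun j => (hb'.continuous_prim.comp_aestronglyMeasurable h.aesm).sub
        ((hb j).continuous_prim.comp_aestronglyMeasurable h.aesm))
      (fun j => ae_of_all _ fun x => ?_) (ae_of_all _ fun x => ?_)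
    · refine (norm_sub_le _ _).trans ?_
      simp only [Real.norm_eq_abs]
      linarith [hb'.abs_prim_le (v x), (hb j).abs_prim_le (v x)]
    · have : Tendsto (fun m => prim (Gs m) (v x)) atTop (𝓝 (prim G (v x))) :=
        intervalIntegral.tendsto_integral_filter_of_dominated_convergence (fun _ => K)
          (Eventually.of_forall fun m => (hb m).meas.aestronglyMeasurable)
          (Eventually.of_forall fun m => ae_of_all _ fun s _ => (hb m).bdd s)
          intervalIntegrable_const (ae_of_all _ fun s _ => hlim s)
      simpa using this.const_sub (prim G (v x))
  · refine tendsto_eLpNorm_two_of_dominated (h.memLp_grad.norm.const_mul (2 * K))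
      (fun j => ((hmG hb').smul h.aesm_grad).sub ((hmG (hb j)).smul h.aesm_grad))
      (fun j => ae_of_all _ fun x => ?_) (ae_of_all _ fun x => ?_)
    · simp only [← sub_smul, norm_smul, Real.norm_eq_abs]
      gcongr
      linarith [abs_sub (G (v x)) (Gs j (v x)), hb'.bdd (v x), (hb j).bdd (v x)]
    · have := ((hlim (v x)).smul_const (V x)).const_sub (G (v x) • V x)
      simpa using this

/-- The chain rule is phrased through the derivative `G`, since it is then stable under bounded
pointwise limits of `G`: smooth functions lead to continuous ones, and these to the jump
`1_{(l,∞)}`. Convergence at every point, not almost every point, avoids any discussion of the level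
sets of `v`. -/
theorem chain_limit (h : IsW12Zero Ω v V) {Gs : ℕ → ℝ → ℝ} {G : ℝ → ℝ}
    (hc : ∀ m, IsW12Zero Ω (fun x => prim (Gs m) (v x)) (fun x => Gs m (v x) • V x))
    (hb : ∀ m, IsBddMeas (Gs m) K) (hlim : ∀ s, Tendsto (fun m => Gs m s) atTop (𝓝 (G s))) :
    IsBddMeas G K ∧ IsW12Zero Ω (fun x => prim G (v x)) (fun x => G (v x) • V x) := by
  have hb' : IsBddMeas G K := ⟨measurable_of_tendsto_metrizable (fun m => (hb m).meas)
      (tendsto_pi_nhds.2 hlim), fun s => le_of_tendsto' (hlim s).abs fun m => (hb m).bdd s⟩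
  obtain ⟨h1, h2⟩ := h.tendsto_chain hb hb' hlim
  exact ⟨hb', of_tendsto hc (hb'.continuous_prim.comp_aestronglyMeasurable h.aesm)
    (((hb'.meas.comp_aemeasurable h.aesm.aemeasurable).aestronglyMeasurable).smul h.aesm_grad)
    h1 h2⟩

/-- Convolution with normalized bumps is an average, so it preserves the bound `K`. -/
theorem exists_smooth_approx {G : ℝ → ℝ} (hG : Continuous G) (hb : ∀ s, |G s| ≤ K) :
    ∃ Gs : ℕ → ℝ → ℝ, (∀ m, ContDiff ℝ ∞ (Gs m)) ∧ (∀ m, IsBddMeas (Gs m) K) ∧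
      ∀ s, Tendsto (fun m => Gs m s) atTop (𝓝 (G s)) := by
  let ρ : ℕ → ContDiffBump (0 : ℝ) := fun m =>
    ⟨((m : ℝ) + 1)⁻¹, 2 * ((m : ℝ) + 1)⁻¹, by positivity, by
      have : (0:ℝ) < ((m : ℝ) + 1)⁻¹ := by positivity
      linarith⟩
  have hρ : Tendsto (fun m => (ρ m).rOut) atTop (𝓝 0) := by
    have := tendsto_one_div_add_atTop_nhds_zero_nat (𝕜 := ℝ)
    simpa [ρ] using this.const_mul 2
  have hsm : ∀ m, ContDiff ℝ ∞
      (convolution ((ρ m).normed volume) G (ContinuousLinearMap.lsmul ℝ ℝ) volume) := fun m =>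
    (ρ m).hasCompactSupport_normed.contDiff_convolution_left _ (ρ m).contDiff_normed
      hG.locallyIntegrable
  refine ⟨fun m => convolution ((ρ m).normed volume) G (ContinuousLinearMap.lsmul ℝ ℝ) volume,
    hsm, fun m => ⟨(hsm m).continuous.measurable, fun s => ?_⟩,
    fun s => ContDiffBump.convolution_tendsto_right_of_continuous hρ hG s⟩
  rw [← Real.norm_eq_abs]
  simp only [convolution_def]
  have hi := ((ρ m).integrable_normed (μ := (volume : Measure ℝ))).mul_const K
  refine (norm_integral_le_of_norm_le hi (ae_of_all _ fun t => ?_)).trans (le_of_eq ?_)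
  · simp only [ContinuousLinearMap.lsmul_apply, smul_eq_mul, norm_mul, Real.norm_eq_abs]
    rw [abs_of_nonneg ((ρ m).nonneg_normed t)]
    exact mul_le_mul_of_nonneg_left (hb _) ((ρ m).nonneg_normed t)
  · rw [integral_mul_const, (ρ m).integral_normed, one_mul]

theorem chain_continuous (h : IsW12Zero Ω v V) {G : ℝ → ℝ} (hG : Continuous G)
    (hb : ∀ s, |G s| ≤ K) : IsW12Zero Ω (fun x => prim G (v x)) (fun x => G (v x) • V x) := by
  obtain ⟨Gs, h1, h2, h3⟩ := exists_smooth_approx hG hb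
  exact (h.chain_limit (fun m => h.chain_smooth (h1 m) (h2 m)) h2 h3).2

theorem prim_indicator_Ioi {l : ℝ} (hl : 0 ≤ l) (s : ℝ) :
    prim (Set.indicator (Set.Ioi l) fun _ => 1) s = max (s - l) 0 := by
  rcases le_total s l with hs | hs
  · rw [max_eq_right (by linarith), prim, intervalIntegral.integral_congr (g := fun _ => 0)]
    · simp
    · intro t ht
      have : t ≤ l := (Set.mem_uIcc.1 ht).elim (fun h => h.2.trans hs) fun h => h.2.trans hl
      simp [this]
  · have hb : IsBddMeas (Set.indicator (Set.Ioi l) fun _ => (1:ℝ)) 1 :=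
      ⟨measurable_const.indicator measurableSet_Ioi, fun s => by
        by_cases h : l < s <;> simp [h]⟩
    rw [max_eq_left (by linarith), prim, ← intervalIntegral.integral_add_adjacent_intervals
      (hb.intervalIntegrable 0 l) (hb.intervalIntegrable l s),
      intervalIntegral.integral_congr_ae (g := fun _ => 0),
      intervalIntegral.integral_congr_ae (a := l) (g := fun _ => 1)]
    · simp
    · refine ae_of_all _ fun t ht => ?_
      rw [Set.uIoc_of_le hs] at ht
      simp [ht.1]
    · refine ae_of_all _ fun t ht => ?_
      rw [Set.uIoc_of_le hl] at ht
      simp [ht.2]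

/-- The truncation `(v - l)⁺`, `l ≥ 0`, of `v ∈ W_0^{1,2}(Ω)`. -/
theorem max_sub (h : IsW12Zero Ω v V) {l : ℝ} (hl : 0 ≤ l) :
    IsW12Zero Ω (fun x => max (v x - l) 0) (Set.indicator {x | l < v x} V) := by
  -- These ramps increase to `1_{(l,∞)}` and vanish at `l`, which selects the strict inequality in
  -- the gradient formula.
  have hc : ∀ m : ℕ, Continuous fun s : ℝ => min (max ((m : ℝ) * (s - l)) 0) 1 := fun m => by
    fun_prop
  have hb : ∀ (m : ℕ) (s : ℝ), |min (max ((m : ℝ) * (s - l)) 0) 1| ≤ 1 := fun m s => by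
    rw [abs_of_nonneg (le_min (le_max_right _ _) zero_le_one)]
    exact min_le_right _ _
  have := (h.chain_limit (G := Set.indicator (Set.Ioi l) fun _ => 1)
    (fun m => h.chain_continuous (hc m) (hb m)) (fun m => ⟨(hc m).measurable, hb m⟩)
    fun s => ?_).2
  · simp_rw [prim_indicator_Ioi hl] at this
    refine this.congr_ae (EventuallyEq.refl _ _) (ae_of_all _ fun x => ?_)
    by_cases hx : l < v x <;> simp [hx]
  · rcases le_or_gt s l with hs | hs
    · have : ∀ m : ℕ, min (max ((m : ℝ) * (s - l)) 0) 1 = 0 := fun m => by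
        rw [max_eq_right (mul_nonpos_of_nonneg_of_nonpos (by positivity) (by linarith))]
        simp
      simp [this, hs]
    · rw [Set.indicator_of_mem (by exact hs)]
      refine tendsto_const_nhds.congr' ?_
      obtain ⟨N, hN⟩ := exists_nat_gt (1 / (s - l))
      filter_upwards [eventually_ge_atTop N] with m hm
      have hm' : (N : ℝ) ≤ m := by exact_mod_cast hm
      have h0 : 0 < s - l := by linarith
      rw [div_lt_iff₀ h0] at hN
      rw [min_eq_right]
      refine le_max_of_le_left ?_
      nlinarith

/-- For `v ≥ 0` the truncation at level `0` is `v` again, so `V` and `1_{v > 0} V` are two gradients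
of the same function. -/
theorem ae_grad_eq_zero (hΩ : IsOpen Ω) (h : IsW12Zero Ω v V)
    (hv : ∀ᵐ x ∂(volume.restrict Ω), 0 ≤ v x) :
    ∀ᵐ x ∂(volume.restrict Ω), v x = 0 → V x = 0 := by
  have h1 := (h.max_sub le_rfl).congr_ae (w := v) (W := Set.indicator {x | 0 < v x} V)
    (by filter_upwards [hv] with x hx; simpa using hx) (EventuallyEq.refl _ _)
  filter_upwards [h.grad_unique hΩ h1] with x hx hvx
  rw [hx]
  simp [hvx]

/-- Nonnegative elements of `W_0^{1,2}(Ω)` are limits of nonnegative test functions. -/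
theorem exists_seq_nonneg (hΩ : IsOpen Ω) (h : IsW12Zero Ω v V)
    (hv : ∀ᵐ x ∂(volume.restrict Ω), 0 ≤ v x) :
    ∃ φ : ℕ → Eu n → ℝ, (∀ j, IsTestFunction Ω (φ j)) ∧ (∀ j x, 0 ≤ φ j x) ∧
    Tendsto (fun j => eLpNorm (fun x => v x - φ j x) 2 (volume.restrict Ω)) atTop (𝓝 0) ∧
    Tendsto (fun j => eLpNorm (fun x => V x - gradient (φ j) x) 2 (volume.restrict Ω))
      atTop (𝓝 0) := by
  -- The primitives are smooth, nonnegative, zero on the negative half-line, and tend to `s⁺`.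
  -- Composed with test functions they remain test functions, now nonnegative.
  let Gs : ℕ → ℝ → ℝ := fun m s => Real.smoothTransition (m * s)
  have hGs : ∀ m, ContDiff ℝ ∞ (Gs m) := fun m =>
    Real.smoothTransition.contDiff.comp (contDiff_const.mul contDiff_id)
  have hb : ∀ m, IsBddMeas (Gs m) 1 := fun m => ⟨(hGs m).continuous.measurable, fun s => by
    rw [abs_of_nonneg (Real.smoothTransition.nonneg _)]
    exact Real.smoothTransition.le_one _⟩
  have hlim : ∀ s, Tendsto (fun m => Gs m s) atTop
      (𝓝 (Set.indicator (Set.Ioi 0) (fun _ => (1:ℝ)) s)) := fun s => by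
    rcases le_or_gt s 0 with hs | hs
    · have : ∀ m, Gs m s = 0 := fun m => Real.smoothTransition.zero_of_nonpos
        (mul_nonpos_of_nonneg_of_nonpos (by positivity) hs)
      simp [this, hs]
    · rw [Set.indicator_of_mem (by exact hs)]
      refine tendsto_const_nhds.congr' ?_
      obtain ⟨N, hN⟩ := exists_nat_gt (1 / s)
      filter_upwards [eventually_ge_atTop N] with m hm
      have hm' : (N : ℝ) ≤ m := by exact_mod_cast hm
      rw [div_lt_iff₀ hs] at hN
      exact (Real.smoothTransition.one_of_one_le (by nlinarith)).symm
  have hnn : ∀ m s, 0 ≤ prim (Gs m) s := fun m s => by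
    rcases le_total 0 s with hs | hs
    · exact intervalIntegral.integral_nonneg hs fun t _ => Real.smoothTransition.nonneg _
    · rw [prim, intervalIntegral.integral_congr (g := fun _ => 0)]
      · simp
      · intro t ht
        rw [Set.uIcc_of_ge hs] at ht
        exact Real.smoothTransition.zero_of_nonpos
          (mul_nonpos_of_nonneg_of_nonpos (by positivity) ht.2)
  obtain ⟨hb', -⟩ := h.chain_limit (fun m => h.chain_smooth (hGs m) (hb m)) hb hlim
  obtain ⟨h1, h2⟩ := h.tendsto_chain hb hb' hlim
  refine exists_seq_of_approx (Q := fun φ => ∀ x, 0 ≤ φ x)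
    (approx_of_tendsto (fun m => (h.chain_smooth (hGs m) (hb m)).aesm)
      (fun m => (h.chain_smooth (hGs m) (hb m)).aesm_grad) (fun m ε hε => ?_) h.aesm h.aesm_grad
      (h1.congr fun m => eLpNorm_congr_ae ?_) (h2.congr fun m => eLpNorm_congr_ae ?_))
  · obtain ⟨φ, hφ, c1, c2⟩ := h.chain_smooth_seq (hGs m) (hb m)
    have c12 := c1.add c2
    rw [add_zero] at c12
    obtain ⟨j, hj⟩ := (c12.eventually_lt_const hε).exists
    exact ⟨_, (hφ j).comp (contDiff_prim (hGs m)).1 (by simp [prim]), fun x => hnn m _, hj⟩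
  · filter_upwards [hv] with x hx
    rw [prim_indicator_Ioi le_rfl, sub_zero, max_eq_left hx]
  · filter_upwards [hv, h.ae_grad_eq_zero hΩ hv] with x hx hx'
    rcases hx.eq_or_lt with h0 | h0
    · simp [hx' h0.symm]
    · simp [h0]

end IsW12Zero

/-! ### The Sobolev inequality -/

/-- The Sobolev exponent `2* = 2n/(n-2)`. -/
def sobExp (n : ℕ) : ℝ≥0∞ := ENNReal.ofReal (2 * n / (n - 2))

section Sobolev

variable {n : ℕ} {Ω : Set (Eu n)} {v : Eu n → ℝ} {V : Eu n → Eu n} {K : ℝ}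

theorem IsSobolevConstant.eLpNorm_test_le (hK : IsSobolevConstant n K)
    {φ : Eu n → ℝ} (hφ : IsTestFunction Ω φ) :
    eLpNorm φ (sobExp n) (volume.restrict Ω)
      ≤ ENNReal.ofReal K * eLpNorm (gradient φ) 2 (volume.restrict Ω) := by
  rw [eLpNorm_restrict_eq_of_support_subset (f := gradient φ) (s := Ω) fun x hx => by
    by_contra h; exact hx (hφ.gradient_eq_zero_of_notMem h)]
  exact (eLpNorm_mono_measure _ Measure.restrict_le_self).trans
    (hK.2 φ (hφ.mono (Set.subset_univ _)))

/-- Fatou's lemma along an almost everywhere convergent subsequence of test functions; the constant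
is unchanged. -/
theorem IsW12Zero.eLpNorm_le (hK : IsSobolevConstant n K)
    (h : IsW12Zero Ω v V) : eLpNorm v (sobExp n) (volume.restrict Ω)
      ≤ ENNReal.ofReal K * eLpNorm V 2 (volume.restrict Ω) := by
  obtain ⟨φ, hφ, h1, h2⟩ := h.exists_seq
  obtain ⟨ns, hns, hae⟩ := exists_subseq_tendsto_ae
    (fun j => (hφ j).continuous.aestronglyMeasurable) h.aesm h1
  have h2' := h2.comp hns.tendsto_atTop
  refine (Lp.eLpNorm_lim_le_liminf_eLpNorm
    (fun j => (hφ (ns j)).continuous.aestronglyMeasurable) v hae).trans ?_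
  have hlim : Tendsto (fun j => ENNReal.ofReal K * (eLpNorm V 2 (volume.restrict Ω) +
      eLpNorm (fun x => V x - gradient (φ (ns j)) x) 2 (volume.restrict Ω))) atTop
      (𝓝 (ENNReal.ofReal K * eLpNorm V 2 (volume.restrict Ω))) := by
    have := ENNReal.Tendsto.const_mul (a := ENNReal.ofReal K)
      (h2'.const_add (eLpNorm V 2 (volume.restrict Ω))) (Or.inr ENNReal.ofReal_ne_top)
    simpa [Function.comp_def] using this
  rw [← hlim.liminf_eq]
  refine liminf_le_liminf (Eventually.of_forall fun j => ?_)
  refine (hK.eLpNorm_test_le (hφ _)).trans ?_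
  gcongr
  have := eLpNorm_sub_le (p := 2) h.aesm_grad
    (h.aesm_grad.sub (hφ (ns j)).continuous_gradient.aestronglyMeasurable) (by norm_num)
  refine le_trans (le_of_eq ?_) this
  congr 1
  ext x
  simp

theorem IsW12Zero.memLp_sobExp (hK : IsSobolevConstant n K)
    (h : IsW12Zero Ω v V) : MemLp v (sobExp n) (volume.restrict Ω) :=
  ⟨h.aesm, (h.eLpNorm_le hK).trans_lt (ENNReal.mul_lt_top ENNReal.ofReal_lt_top h.memLp_grad.2)⟩

/-- Hence only gradients need to be followed when passing to the limit in the equation. -/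
theorem IsW12Zero.tendsto_eLpNorm_sobExp (hK : IsSobolevConstant n K)
    (h : IsW12Zero Ω v V) {vs : ℕ → Eu n → ℝ} {Vs : ℕ → Eu n → Eu n}
    (hs : ∀ j, IsW12Zero Ω (vs j) (Vs j))
    (h2 : Tendsto (fun j => eLpNorm (fun x => V x - Vs j x) 2 (volume.restrict Ω)) atTop (𝓝 0)) :
    Tendsto (fun j => eLpNorm (fun x => v x - vs j x) (sobExp n) (volume.restrict Ω))
      atTop (𝓝 0) := by
  have h1 : Tendsto (fun j => ENNReal.ofReal K *
      eLpNorm (fun x => V x - Vs j x) 2 (volume.restrict Ω)) atTop (𝓝 0) := by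
    simpa using ENNReal.Tendsto.const_mul h2 (Or.inr ENNReal.ofReal_ne_top)
  exact tendsto_of_tendsto_of_tendsto_of_le_of_le tendsto_const_nhds h1 (fun _ => zero_le)
    fun j => (h.sub (hs j)).eLpNorm_le hK

end Sobolev

/-! ### Mollification -/

section Mollify

variable {n : ℕ}

/-- Translations are measure preserving and depend continuously on `t` as maps, so composition with
them is continuous in `L²`. -/
theorem tendsto_eLpNorm_sub_translate {f : Eu n → ℝ} (hf : MemLp f 2 volume) :
    Tendsto (fun t => eLpNorm (fun x => f x - f (x - t)) 2 volume) (𝓝 0) (𝓝 0) := by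
  let g : Eu n → C(Eu n, Eu n) := fun t => ⟨fun x => x - t, by fun_prop⟩
  have hg : Continuous g :=
    ContinuousMap.continuous_of_continuous_uncurry _
      (continuous_snd.sub continuous_fst)
  have hm : ∀ t, MeasurePreserving (g t) volume volume := fun t =>
    measurePreserving_sub_right volume t
  have h1 := (tendsto_const_nhds (x := hf.toLp f) (f := 𝓝 (0 : Eu n))).compMeasurePreservingLp
    (hg.tendsto 0) hm (hm 0) (by norm_num)
  have h2 := (tendsto_const_nhds (x := hf.toLp f)).edist h1
  have h0 : Lp.compMeasurePreserving (g 0) (hm 0) (hf.toLp f) = hf.toLp f := by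
    rw [Lp.toLp_compMeasurePreserving hf (hm 0)]
    congr 1
    ext x
    simp [g]
  rw [h0, edist_self] at h2
  refine h2.congr fun t => ?_
  rw [Lp.toLp_compMeasurePreserving hf (hm t), Lp.edist_toLp_toLp]
  rfl

/-- Jensen's inequality for the square, obtained from Cauchy–Schwarz by writing `|ρ| = |ρ|^{1/2}
|ρ|^{1/2}`. -/
theorem enorm_integral_mul_sq_le {α : Type*} [MeasurableSpace α] {μ : Measure α} {ρ F : α → ℝ}
    (hρ : AEStronglyMeasurable ρ μ) (h1 : ∫⁻ t, ‖ρ t‖ₑ ∂μ ≤ 1) (hF : AEStronglyMeasurable F μ) :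
    ‖∫ t, ρ t * F t ∂μ‖ₑ ^ (2 : ℝ) ≤ ∫⁻ t, ‖ρ t‖ₑ * ‖F t‖ₑ ^ (2 : ℝ) ∂μ := by
  have hs : ∀ a : ℝ≥0∞, (a ^ (1 / 2 : ℝ)) ^ (2 : ℝ) = a := fun a => by
    rw [← ENNReal.rpow_mul]; norm_num
  have h2 : ‖∫ t, ρ t * F t ∂μ‖ₑ ≤ (∫⁻ t, ‖ρ t‖ₑ * ‖F t‖ₑ ^ (2 : ℝ) ∂μ) ^ (1 / 2 : ℝ) := by
    calc ‖∫ t, ρ t * F t ∂μ‖ₑ ≤ ∫⁻ t, ‖ρ t * F t‖ₑ ∂μ := enorm_integral_le_lintegral_enorm _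
      _ = ∫⁻ t, ((fun t => ‖ρ t‖ₑ ^ (1 / 2 : ℝ)) * fun t => ‖ρ t‖ₑ ^ (1 / 2 : ℝ) * ‖F t‖ₑ) t ∂μ := by
          refine lintegral_congr fun t => ?_
          rw [Pi.mul_apply, ← mul_assoc, ← ENNReal.rpow_add_of_nonneg _ _ (by norm_num) (by norm_num),
            enorm_mul]
          norm_num
      _ ≤ (∫⁻ t, (‖ρ t‖ₑ ^ (1 / 2 : ℝ)) ^ (2 : ℝ) ∂μ) ^ (1 / 2 : ℝ) *
          (∫⁻ t, (‖ρ t‖ₑ ^ (1 / 2 : ℝ) * ‖F t‖ₑ) ^ (2 : ℝ) ∂μ) ^ (1 / 2 : ℝ) :=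
          ENNReal.lintegral_mul_le_Lp_mul_Lq μ Real.HolderConjugate.two_two
            (hρ.enorm.pow_const _) ((hρ.enorm.pow_const _).mul hF.enorm)
      _ ≤ 1 * (∫⁻ t, ‖ρ t‖ₑ * ‖F t‖ₑ ^ (2 : ℝ) ∂μ) ^ (1 / 2 : ℝ) := by
          simp_rw [ENNReal.mul_rpow_of_nonneg _ _ zero_le_two, hs]
          gcongr
          exact ENNReal.rpow_le_one h1 (by norm_num)
      _ = _ := one_mul _
  calc _ ≤ _ := ENNReal.rpow_le_rpow h2 zero_le_two
    _ = _ := hs _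

theorem eLpNorm_two_eq {α F : Type*} [MeasurableSpace α] {μ : Measure α} [NormedAddCommGroup F]
    (f : α → F) : eLpNorm f 2 μ = (∫⁻ x, ‖f x‖ₑ ^ (2 : ℝ) ∂μ) ^ (1 / 2 : ℝ) := by
  rw [eLpNorm_eq_lintegral_rpow_enorm_toReal (by simp) (by simp)]; simp

/-- Convolution of a function with a normalized bump function. -/
def mollify (ρ : ContDiffBump (0 : Eu n)) (f : Eu n → ℝ) : Eu n → ℝ :=
  convolution (ρ.normed volume) f (ContinuousLinearMap.lsmul ℝ ℝ) volume

/-- The difference is the `ρ`-average of `f - f(· - t)`; Jensen and Tonelli bound its norm by the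
worst translation in the support of `ρ`. -/
theorem eLpNorm_sub_mollify_le {f : Eu n → ℝ} (hf : MemLp f 2 volume)
    (ρ : ContDiffBump (0 : Eu n)) {ε : ℝ≥0∞}
    (hε : ∀ t ∈ Metric.ball (0 : Eu n) ρ.rOut,
      eLpNorm (fun x => f x - f (x - t)) 2 volume ≤ ε) :
    eLpNorm (fun x => f x - mollify ρ f x) 2 volume ≤ ε := by
  set r := ρ.normed (volume : Measure (Eu n)) with hr
  have hrc : Continuous r := ρ.continuous_normed
  have hr1 : ∫⁻ t, ‖r t‖ₑ = 1 := by
    have h : ∀ t, ‖r t‖ₑ = ENNReal.ofReal (r t) := fun t => by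
      rw [← ofReal_norm, Real.norm_of_nonneg (ρ.nonneg_normed t)]
    simp_rw [h]
    rw [← ofReal_integral_eq_lintegral_ofReal ρ.integrable_normed
      (ae_of_all _ fun t => ρ.nonneg_normed t), ρ.integral_normed, ENNReal.ofReal_one]
  have hloc : LocallyIntegrable f volume := hf.locallyIntegrable (by norm_num)
  have hprod : AEStronglyMeasurable (fun z : Eu n × Eu n => f z.1 - f (z.1 - z.2))
      (volume.prod volume) :=
    hf.1.comp_fst.sub (hf.1.comp_quasiMeasurePreserving (quasiMeasurePreserving_sub volume volume))
  have hpt : ∀ x, f x - mollify ρ f x = ∫ t, r t * (f x - f (x - t)) := fun x => by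
    have i1 : Integrable (fun t => r t * f x) := ρ.integrable_normed.mul_const _
    have i2 : Integrable (fun t => r t * f (x - t)) :=
      ρ.hasCompactSupport_normed.convolutionExists_left (ContinuousLinearMap.lsmul ℝ ℝ) hrc hloc x
    simp_rw [mul_sub]
    rw [integral_sub i1 i2, integral_mul_const, ρ.integral_normed, one_mul]
    rfl
  have key : ∫⁻ x, ‖f x - mollify ρ f x‖ₑ ^ (2 : ℝ) ≤ ε ^ (2 : ℝ) := by
    calc _ ≤ ∫⁻ x, ∫⁻ t, ‖r t‖ₑ * ‖f x - f (x - t)‖ₑ ^ (2 : ℝ) := by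
          refine lintegral_mono fun x => ?_
          rw [hpt]
          refine enorm_integral_mul_sq_le hrc.aestronglyMeasurable hr1.le ?_
          exact aestronglyMeasurable_const.sub (hf.1.comp_quasiMeasurePreserving
            (quasiMeasurePreserving_sub_left volume x))
      _ = ∫⁻ t, ∫⁻ x, ‖r t‖ₑ * ‖f x - f (x - t)‖ₑ ^ (2 : ℝ) :=
          lintegral_lintegral_swap
            ((hrc.aestronglyMeasurable.comp_snd).enorm.mul (hprod.enorm.pow_const _))
      _ ≤ ∫⁻ t, ‖r t‖ₑ * ε ^ (2 : ℝ) := by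
          refine lintegral_mono fun t => ?_
          simp only
          rw [lintegral_const_mul' _ _ enorm_ne_top]
          by_cases ht : t ∈ Metric.ball (0 : Eu n) ρ.rOut
          · gcongr
            have := ENNReal.rpow_le_rpow (hε t ht) zero_le_two
            rw [eLpNorm_two_eq, ← ENNReal.rpow_mul] at this
            simpa using this
          · rw [← ρ.support_normed_eq (μ := volume), Function.notMem_support] at ht
            simp [hr, ht]
      _ = ε ^ (2 : ℝ) := by
          rw [lintegral_mul_const'' _ hrc.aestronglyMeasurable.enorm, hr1, one_mul]
  rw [eLpNorm_two_eq]
  calc _ ≤ _ := ENNReal.rpow_le_rpow key (by norm_num)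
    _ = ε := by rw [← ENNReal.rpow_mul]; norm_num

theorem tendsto_eLpNorm_sub_mollify {f : Eu n → ℝ} (hf : MemLp f 2 volume)
    {ρ : ℕ → ContDiffBump (0 : Eu n)} (hρ : Tendsto (fun m => (ρ m).rOut) atTop (𝓝 0)) :
    Tendsto (fun m => eLpNorm (fun x => f x - mollify (ρ m) f x) 2 volume) atTop (𝓝 0) := by
  rw [ENNReal.tendsto_nhds_zero]
  intro ε hε
  obtain ⟨δ, hδ, hball⟩ := Metric.eventually_nhds_iff_ball.1
    (ENNReal.tendsto_nhds_zero.1 (tendsto_eLpNorm_sub_translate hf) ε hε)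
  filter_upwards [hρ.eventually_lt_const hδ] with m hm
  exact eLpNorm_sub_mollify_le hf _ fun t ht => hball t (Metric.ball_subset_ball hm.le ht)

theorem contDiff_mollify {f : Eu n → ℝ} (hf : LocallyIntegrable f volume)
    (ρ : ContDiffBump (0 : Eu n)) : ContDiff ℝ ∞ (mollify ρ f) :=
  ρ.hasCompactSupport_normed.contDiff_convolution_left _ ρ.contDiff_normed hf

theorem mollify_eq (f : Eu n → ℝ) (ρ : ContDiffBump (0 : Eu n)) (x : Eu n) :
    mollify ρ f x = ∫ y, ρ.normed volume (x - y) * f y :=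
  convolution_lsmul_swap

/-- The derivative is moved to the variable `y` of the kernel, at the cost of a sign, so that the
integral has the form in which a weak gradient is tested. -/
theorem gradient_mollify_apply {f : Eu n → ℝ} (hf : LocallyIntegrable f volume)
    (ρ : ContDiffBump (0 : Eu n)) (x : Eu n) (i : Fin n) :
    gradient (mollify ρ f) x i
      = -∫ y, f y * gradient (fun y => ρ.normed volume (x - y)) y i := by
  have hcs := ρ.hasCompactSupport_normed (μ := (volume : Measure (Eu n)))
  have hd := hcs.hasFDerivAt_convolution_left
    (ContinuousLinearMap.lsmul ℝ ℝ) (μ := volume) ρ.contDiff_normed hf x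
  have hc : ConvolutionExistsAt (fderiv ℝ (ρ.normed volume)) f x
      ((ContinuousLinearMap.lsmul ℝ ℝ).precompL (Eu n)) volume :=
    (hcs.fderiv ℝ).convolutionExists_left _
      ((ρ.contDiff_normed (n := 1)).continuous_fderiv (by simp)) hf x
  rw [gradient_apply_eq, mollify, hd.fderiv, convolution_eq_swap,
    ContinuousLinearMap.integral_apply, ← integral_neg]
  · refine integral_congr_ae (ae_of_all _ fun y => ?_)
    have hρ : HasFDerivAt (fun y => ρ.normed volume (x - y))
        ((fderiv ℝ (ρ.normed volume) (x - y)).comp (-ContinuousLinearMap.id ℝ (Eu n))) y :=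
      ((ρ.contDiff_normed (n := 1)).differentiable (by simp) _).hasFDerivAt.comp y
        ((hasFDerivAt_id y).const_sub x)
    simp only [gradient_apply_eq, hρ.fderiv]
    simp [mul_comm]
  · have := hc.integrable_swap
    exact this

end Mollify

/-! ### Localization of `W^{1,2}(Ω)` by cutoffs. -/

section LocalApprox

variable {n : ℕ} {Ω : Set (Eu n)} {u v : Eu n → ℝ} {Du V : Eu n → Eu n}

theorem norm_le_sum_norm_apply (y : Eu n) : ‖y‖ ≤ ∑ i, ‖y i‖ := by
  conv_lhs => rw [← (EuclideanSpace.basisFun (Fin n) ℝ).sum_repr y]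
  refine (norm_sum_le _ _).trans (Finset.sum_le_sum fun i _ => ?_)
  simp [norm_smul]

theorem tendsto_eLpNorm_of_apply {μ : Measure (Eu n)} {Y : ℕ → Eu n → Eu n}
    (hm : ∀ j i, AEStronglyMeasurable (fun x => Y j x i) μ)
    (h : ∀ i, Tendsto (fun j => eLpNorm (fun x => Y j x i) 2 μ) atTop (𝓝 0)) :
    Tendsto (fun j => eLpNorm (Y j) 2 μ) atTop (𝓝 0) := by
  have h1 : Tendsto (fun j => ∑ i, eLpNorm (fun x => Y j x i) 2 μ) atTop (𝓝 0) := by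
    simpa using tendsto_finsetSum Finset.univ fun i _ => h i
  refine tendsto_of_tendsto_of_tendsto_of_le_of_le tendsto_const_nhds h1 (fun _ => zero_le)
    fun j => ?_
  calc eLpNorm (Y j) 2 μ ≤ eLpNorm (∑ i, fun x => ‖Y j x i‖) 2 μ := by
        refine eLpNorm_mono_real fun x => ?_
        simpa using norm_le_sum_norm_apply (Y j x)
    _ ≤ ∑ i, eLpNorm (fun x => ‖Y j x i‖) 2 μ :=
        eLpNorm_sum_le (fun i _ => (hm j i).norm) (by norm_num)
    _ = _ := by simp only [eLpNorm_norm]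

/-- The product of a function in `W^{1,2}(Ω)` and a test function lies in `W_0^{1,2}(Ω)`. -/
theorem IsW12With.isW12Zero_mul (hΩ : IsOpen Ω) (h : IsW12With Ω u Du) {χ : Eu n → ℝ}
    (hχ : IsTestFunction Ω χ) :
    IsW12Zero Ω (fun x => χ x * u x) (fun x => χ x • Du x + u x • gradient χ x) := by
  set v : Eu n → ℝ := fun x => χ x * u x with hv
  set V : Eu n → Eu n := fun x => χ x • Du x + u x • gradient χ x with hV
  obtain ⟨K, hK0, hK⟩ := hχ.exists_bound
  obtain ⟨K', hK0', hK'⟩ := hχ.exists_bound_gradient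
  have v0 : ∀ x, x ∉ tsupport χ → v x = 0 := fun x hx => by
    simp [hv, image_eq_zero_of_notMem_tsupport hx]
  have V0 : ∀ x, x ∉ tsupport χ → V x = 0 := fun x hx => by
    have h1 : gradient χ x = 0 := image_eq_zero_of_notMem_tsupport
      fun h => hx (IsTestFunction.tsupport_gradient_subset χ h)
    simp [hV, image_eq_zero_of_notMem_tsupport hx, h1]
  have hvr : MemLp v 2 (volume.restrict Ω) :=
    h.memLp.of_le_mul (c := K) (hχ.continuous.aestronglyMeasurable.mul h.memLp.1)
      (ae_of_all _ fun x => by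
        rw [norm_mul]; exact mul_le_mul_of_nonneg_right (hK x) (norm_nonneg _))
  have hVr : MemLp V 2 (volume.restrict Ω) := by
    refine MemLp.add (f := fun x => χ x • Du x) (g := fun x => u x • gradient χ x) ?_ ?_
    · exact h.memLp_grad.of_le_mul (c := K)
        (hχ.continuous.aestronglyMeasurable.smul h.memLp_grad.1)
        (ae_of_all _ fun x => by
          rw [norm_smul]; exact mul_le_mul_of_nonneg_right (hK x) (norm_nonneg _))
    · exact h.memLp.of_le_mul (c := K')
        (h.memLp.1.smul hχ.continuous_gradient.aestronglyMeasurable)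
        (ae_of_all _ fun x => by
          rw [norm_smul, mul_comm]; exact mul_le_mul_of_nonneg_right (hK' x) (norm_nonneg _))
  have hvL : MemLp v 2 volume := by
    rw [← memLp_indicator_iff_restrict hΩ.measurableSet] at hvr
    rwa [Set.indicator_eq_self.2 fun x hx => by_contra fun h' => hx (v0 x fun h2 => h' (hχ.3 h2))]
      at hvr
  have hVL : MemLp V 2 volume := by
    rw [← memLp_indicator_iff_restrict hΩ.measurableSet] at hVr
    rwa [Set.indicator_eq_self.2 fun x hx => by_contra fun h' => hx (V0 x fun h2 => h' (hχ.3 h2))]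
      at hVr
  have hloc : LocallyIntegrable v volume := hvL.locallyIntegrable (by norm_num)
  -- Mollification at scale at most `δ` keeps the support compact inside `Ω`.
  obtain ⟨δ, hδ, hδΩ⟩ := hχ.hasCompactSupport.isCompact.exists_cthickening_subset_open hΩ hχ.3
  let ρ : ℕ → ContDiffBump (0 : Eu n) := fun m =>
    ⟨δ / 2 * ((m : ℝ) + 1)⁻¹, δ * ((m : ℝ) + 1)⁻¹, by positivity, by
      have : (0:ℝ) < δ * ((m : ℝ) + 1)⁻¹ := by positivity
      linarith⟩
  have hρ : Tendsto (fun m => (ρ m).rOut) atTop (𝓝 0) := by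
    have := tendsto_one_div_add_atTop_nhds_zero_nat (𝕜 := ℝ)
    simpa [ρ] using this.const_mul δ
  have hρδ : ∀ m, (ρ m).rOut ≤ δ := fun m =>
    mul_le_of_le_one_right hδ.le (inv_le_one_of_one_le₀ (by linarith [m.cast_nonneg (α := ℝ)]))
  have htest : ∀ m, IsTestFunction Ω (mollify (ρ m) v) := fun m => by
    have hsub : Function.support (mollify (ρ m) v) ⊆ Metric.cthickening δ (tsupport χ) := by
      refine (support_convolution_subset _).trans ?_
      rintro _ ⟨y, hy, z, hz, rfl⟩
      rw [(ρ m).support_normed_eq] at hy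
      have hz' : z ∈ tsupport χ := by_contra fun h' => hz (v0 z h')
      refine Metric.mem_cthickening_of_dist_le _ z _ _ hz' ?_
      have := (mem_ball_zero_iff.1 hy).le.trans (hρδ m)
      simpa [dist_eq_norm] using this
    have hts := closure_minimal hsub Metric.isClosed_cthickening
    exact ⟨contDiff_mollify hloc _, hχ.hasCompactSupport.isCompact.cthickening.of_isClosed_subset
      (isClosed_tsupport _) hts, hts.trans hδΩ⟩
  -- The kernel `θ(y) = ρ(x - y)` need not be supported in `Ω`, but `χθ` is. Testing the weak
  -- gradient of `u` with `χθ` and expanding by the product rule gives the commutation.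
  have hgrad : ∀ m x i, gradient (mollify (ρ m) v) x i = mollify (ρ m) (fun y => V y i) x := by
    intro m x i
    rw [gradient_mollify_apply hloc, mollify_eq]
    set θ : Eu n → ℝ := fun y => (ρ m).normed volume (x - y) with hθ
    have hθs : ContDiff ℝ ∞ θ := (ρ m).contDiff_normed.comp (contDiff_const.sub contDiff_id)
    have hθd : Differentiable ℝ θ := hθs.differentiable (by simp)
    have hχθ := hχ.mul_smooth hθs
    have r1 : ∫ y, v y * gradient θ y i = ∫ y in Ω, v y * gradient θ y i :=
      (setIntegral_eq_integral_of_forall_compl_eq_zero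
        fun y hy => by rw [v0 y fun h' => hy (hχ.3 h'), zero_mul]).symm
    have r2 : ∫ y, θ y * V y i = ∫ y in Ω, θ y * V y i :=
      (setIntegral_eq_integral_of_forall_compl_eq_zero
        fun y hy => by rw [V0 y fun h' => hy (hχ.3 h')]; simp).symm
    rw [r1]
    refine Eq.trans ?_ r2.symm
    have hw := h.weak_grad _ hχθ i
    have m1 : MemLp (fun y => θ y * gradient χ y i) 2 (volume.restrict Ω) := by
      refine (Continuous.memLp_of_hasCompactSupport ?_ ?_).restrict Ω
      · exact hθs.continuous.mul
          ((EuclideanSpace.proj (𝕜 := ℝ) i).continuous.comp hχ.continuous_gradient)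
      · exact (hχ.hasCompactSupport_gradient.comp_left (g := fun y : Eu n => y i) rfl).mul_left
    have m2 : MemLp (fun y => gradient (fun x => χ x * θ x) y i) 2 (volume.restrict Ω) :=
      memLp_apply (hχθ.memLp_gradient 2 Ω) i
    have e1 : ∫ y in Ω, v y * gradient θ y i
        = (∫ y in Ω, u y * gradient (fun x => χ x * θ x) y i)
          - ∫ y in Ω, u y * (θ y * gradient χ y i) := by
      rw [← integral_sub (integrable_mul_of_memLp h.memLp m2) (integrable_mul_of_memLp h.memLp m1)]
      refine integral_congr_ae (ae_of_all _ fun y => ?_)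
      simp only
      rw [gradient_mul_apply (hχ.differentiable y) (hθd y)]
      simp [hv]
      ring
    have e2 : ∫ y in Ω, θ y * V y i
        = (∫ y in Ω, Du y i * (χ y * θ y)) + ∫ y in Ω, u y * (θ y * gradient χ y i) := by
      rw [← integral_add (integrable_mul_of_memLp (memLp_apply h.memLp_grad i) (hχθ.memLp 2 Ω))
        (integrable_mul_of_memLp h.memLp m1)]
      refine integral_congr_ae (ae_of_all _ fun y => ?_)
      simp [hV]
      ring
    rw [e1, e2, hw]
    ring
  refine IsW12Zero.of_tendsto (fun m => IsW12Zero.of_test (htest m)) hvr.1 hVr.1 ?_ ?_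
  · have := tendsto_eLpNorm_sub_mollify hvL hρ
    exact tendsto_of_tendsto_of_tendsto_of_le_of_le tendsto_const_nhds this (fun _ => zero_le)
      fun m => eLpNorm_mono_measure _ Measure.restrict_le_self
  · refine tendsto_eLpNorm_of_apply (fun m i => ?_) fun i => ?_
    · exact (EuclideanSpace.proj (𝕜 := ℝ) i).continuous.comp_aestronglyMeasurable
        (hVr.1.sub (htest m).continuous_gradient.aestronglyMeasurable)
    · have := tendsto_eLpNorm_sub_mollify (memLp_apply hVL i) hρ
      refine tendsto_of_tendsto_of_tendsto_of_le_of_le tendsto_const_nhds this (fun _ => zero_le)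
        fun m => ?_
      simp only [PiLp.sub_apply, hgrad]
      exact eLpNorm_mono_measure _ Measure.restrict_le_self

/-- The gradient of `(u - k)⁺`, `k ≥ 0`, is `1_{u > k} ∇u`. -/
theorem IsW12With.grad_max_sub (hΩ : IsOpen Ω) (h : IsW12With Ω u Du) {k : ℝ} (hk : 0 ≤ k)
    {D : Eu n → Eu n} (hD : IsW12With Ω (fun x => max (u x - k) 0) D) :
    D =ᵐ[volume.restrict Ω] Set.indicator {x | k < u x} Du := by
  have hnull : NullMeasurableSet {x | k < u x} (volume.restrict Ω) :=
    nullMeasurableSet_lt aemeasurable_const h.memLp.1.aemeasurable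
  have hI : MemLp (Set.indicator {x | k < u x} Du) 2 (volume.restrict Ω) := by
    refine h.memLp_grad.mono (h.memLp_grad.1.indicator₀ hnull) (ae_of_all _ fun x => ?_)
    exact norm_indicator_le_norm_self _ _
  refine ae_eq_of_forall_integral_mul_test hΩ hD.memLp_grad hI fun θ hθ i => ?_
  -- The claim is local: with `χ = 1` near the support of `θ`, the function `χu` lies in
  -- `W_0^{1,2}(Ω)`, where the truncation formula is known, and has the same truncation and gradient
  -- as `u` on that support.
  obtain ⟨χ, hχ, -, U, hU, hKU, hχ1⟩ :=
    IsTestFunction.exists_cutoff hΩ hθ.hasCompactSupport.isCompact hθ.3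
  have h1 := ((h.isW12Zero_mul hΩ hχ).max_sub hk).weak_grad hθ i
  have h2 := hD.weak_grad θ hθ i
  have hgθ : ∀ x, x ∉ tsupport θ → gradient θ x = 0 := fun x hx =>
    image_eq_zero_of_notMem_tsupport fun h => hx (IsTestFunction.tsupport_gradient_subset θ h)
  have hgχ : ∀ x ∈ U, gradient χ x = 0 := fun x hx => by
    have : χ =ᶠ[𝓝 x] fun _ => 1 := by
      filter_upwards [hU.mem_nhds hx] with y hy using hχ1 y hy
    rw [this.gradient_eq, gradient_fun_const]
  have e1 : ∀ x, max (χ x * u x - k) 0 * gradient θ x i = max (u x - k) 0 * gradient θ x i :=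
    fun x => by
      by_cases hx : x ∈ tsupport θ
      · rw [hχ1 x (hKU hx), one_mul]
      · simp [hgθ x hx]
  have e2 : ∀ x, (Set.indicator {x | k < χ x * u x}
      (fun x => χ x • Du x + u x • gradient χ x) x) i * θ x
      = (Set.indicator {x | k < u x} Du x) i * θ x := fun x => by
    by_cases hx : x ∈ tsupport θ
    · have hxU := hKU hx
      simp only [Set.indicator, Set.mem_ofPred_eq, hχ1 x hxU, hgχ x hxU, one_mul, one_smul,
        smul_zero, add_zero]
    · simp [image_eq_zero_of_notMem_tsupport hx]
  simp_rw [e1, e2] at h1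
  linarith

end LocalApprox

/-! ### Exponents -/

/-- The exponent `2n/(n+2)` conjugate to the Sobolev exponent. -/
def dualExp (n : ℕ) : ℝ≥0∞ := ENNReal.ofReal (2 * n / (n + 2))

section Exponents

variable {n : ℕ}

theorem holderTriple_ofReal {a b c : ℝ} (ha : 0 < a) (hb : 0 < b) (hc : 0 < c)
    (h : a⁻¹ + b⁻¹ = c⁻¹) :
    ENNReal.HolderTriple (ENNReal.ofReal a) (ENNReal.ofReal b) (ENNReal.ofReal c) := by
  refine ⟨?_⟩
  rw [← ENNReal.ofReal_inv_of_pos ha, ← ENNReal.ofReal_inv_of_pos hb,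
    ← ENNReal.ofReal_inv_of_pos hc, ← ENNReal.ofReal_add (by positivity) (by positivity), h]

theorem holderConjugate_dualExp_sobExp (hn : 3 ≤ n) :
    ENNReal.HolderConjugate (dualExp n) (sobExp n) := by
  have h3 : (3 : ℝ) ≤ n := by exact_mod_cast hn
  have h2 : (0 : ℝ) < n - 2 := by linarith
  have := holderTriple_ofReal (a := 2 * n / (n + 2)) (b := 2 * n / (n - 2)) (c := 1)
    (by positivity) (by positivity) one_pos (by field_simp; ring)
  rwa [ENNReal.ofReal_one] at this

theorem holderTriple_dim_two (hn : 3 ≤ n) : ENNReal.HolderTriple (n : ℝ≥0∞) 2 (dualExp n) := by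
  have h3 : (3 : ℝ) ≤ n := by exact_mod_cast hn
  have := holderTriple_ofReal (a := n) (b := 2) (c := 2 * n / (n + 2))
    (by positivity) (by positivity) (by positivity) (by field_simp; ring)
  rwa [ENNReal.ofReal_natCast, ENNReal.ofReal_ofNat] at this

theorem holderTriple_dim_sobExp (hn : 3 ≤ n) :
    ENNReal.HolderTriple (n : ℝ≥0∞) (sobExp n) 2 := by
  have h3 : (3 : ℝ) ≤ n := by exact_mod_cast hn
  have h2 : (0 : ℝ) < n - 2 := by linarith
  have := holderTriple_ofReal (a := n) (b := 2 * n / (n - 2)) (c := 2)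
    (by positivity) (by positivity) (by positivity) (by field_simp; ring)
  rwa [ENNReal.ofReal_natCast, ENNReal.ofReal_ofNat] at this

theorem holderTriple_half_dim_sobExp (hn : 3 ≤ n) :
    ENNReal.HolderTriple ((n : ℝ≥0∞) / 2) (sobExp n) (dualExp n) := by
  have h3 : (3 : ℝ) ≤ n := by exact_mod_cast hn
  have h2 : (0 : ℝ) < n - 2 := by linarith
  have := holderTriple_ofReal (a := n / 2) (b := 2 * n / (n - 2)) (c := 2 * n / (n + 2))
    (by positivity) (by positivity) (by positivity) (by field_simp; ring)
  rwa [ENNReal.ofReal_div_of_pos two_pos, ENNReal.ofReal_natCast, ENNReal.ofReal_ofNat] at this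

end Exponents

/-! ### Testing the equation with elements of `W_0^{1,2}(Ω)` -/

section Testing

variable {n : ℕ} {Ω : Set (Eu n)} {K : ℝ}

/-- The functional `∫ P · V + p v` is continuous on `W_0^{1,2}(Ω)` if `P ∈ L²`, `p ∈ L^{2n/(n+2)}`. -/
theorem IsW12Zero.tendsto_functional (hn : 3 ≤ n) (hK : IsSobolevConstant n K)
    {P : Eu n → Eu n} {p : Eu n → ℝ}
    (hP : MemLp P 2 (volume.restrict Ω)) (hp : MemLp p (dualExp n) (volume.restrict Ω))
    {v : Eu n → ℝ} {V : Eu n → Eu n} (h : IsW12Zero Ω v V) {vs : ℕ → Eu n → ℝ}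
    {Vs : ℕ → Eu n → Eu n} (hs : ∀ j, IsW12Zero Ω (vs j) (Vs j))
    (h2 : Tendsto (fun j => eLpNorm (fun x => V x - Vs j x) 2 (volume.restrict Ω)) atTop (𝓝 0)) :
    Tendsto (fun j => ∫ x in Ω, (inner ℝ (P x) (Vs j x) + p x * vs j x)) atTop
      (𝓝 (∫ x in Ω, (inner ℝ (P x) (V x) + p x * v x))) :=
  haveI := holderConjugate_dualExp_sobExp hn
  tendsto_integral_inner_add_mul hP hp h.memLp_grad (h.memLp_sobExp hK)
    (fun j => (hs j).memLp_grad) (fun j => (hs j).memLp_sobExp hK)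
    (h.tendsto_eLpNorm_sobExp hK hs h2) h2

theorem IsW12Zero.integrable_functional (hn : 3 ≤ n) (hK : IsSobolevConstant n K)
    {P : Eu n → Eu n} {p : Eu n → ℝ}
    (hP : MemLp P 2 (volume.restrict Ω)) (hp : MemLp p (dualExp n) (volume.restrict Ω))
    {v : Eu n → ℝ} {V : Eu n → Eu n} (h : IsW12Zero Ω v V) :
    Integrable (fun x => inner ℝ (P x) (V x) + p x * v x) (volume.restrict Ω) :=
  haveI := holderConjugate_dualExp_sobExp hn
  (integrable_inner_of_memLp hP h.memLp_grad).add (integrable_mul_of_memLp hp (h.memLp_sobExp hK))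

theorem memLp_inner {α : Type*} [MeasurableSpace α] {μ : Measure α} {p q r : ℝ≥0∞}
    [ENNReal.HolderTriple p q r] {b D : α → Eu n}
    (hb : MemLp b p μ) (hD : MemLp D q μ) : MemLp (fun x => inner ℝ (b x) (D x)) r μ :=
  (hD.norm.mul' hb.norm (p := p) (q := q)).mono' (hb.1.inner hD.1)
    (ae_of_all _ fun _ => norm_inner_le_norm _ _)

variable {b : Eu n → Eu n} {d : Eu n → ℝ}

theorem IsW12Zero.memLp_smul_drift (hn : 3 ≤ n) (hK : IsSobolevConstant n K)
    (hb : MemLp b n (volume.restrict Ω)) {U : Eu n → ℝ} {DU : Eu n → Eu n}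
    (hU : IsW12Zero Ω U DU) : MemLp (fun x => U x • b x) 2 (volume.restrict Ω) :=
  haveI := holderTriple_dim_sobExp hn
  MemLp.smul (p := sobExp n) (q := n) hb (hU.memLp_sobExp hK)

theorem IsW12Zero.memLp_potential (hn : 3 ≤ n) (hK : IsSobolevConstant n K)
    (hd : MemLp d ((n : ℝ≥0∞) / 2) (volume.restrict Ω)) {U : Eu n → ℝ} {DU : Eu n → Eu n}
    (hU : IsW12Zero Ω U DU) : MemLp (fun x => d x * U x) (dualExp n) (volume.restrict Ω) :=
  haveI := holderTriple_half_dim_sobExp hn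
  (hU.memLp_sobExp hK).mul' hd (p := (n : ℝ≥0∞) / 2) (q := sobExp n)

theorem memLp_inner_drift (hn : 3 ≤ n) (hb : MemLp b n (volume.restrict Ω)) {D : Eu n → Eu n}
    (hD : MemLp D 2 (volume.restrict Ω)) :
    MemLp (fun x => inner ℝ (b x) (D x)) (dualExp n) (volume.restrict Ω) :=
  haveI := holderTriple_dim_two hn
  memLp_inner hb hD

/-- If `d ≥ div b`, then `∫ d U φ + b · ∇(U φ) ≥ 0` for nonnegative `U, φ ∈ W_0^{1,2}(Ω)`. -/
theorem GEDiv.integral_nonneg (hn : 3 ≤ n) (hK : IsSobolevConstant n K) (hΩ : IsOpen Ω)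
    (hb : MemLp b n (volume.restrict Ω)) (hd : MemLp d ((n : ℝ≥0∞) / 2) (volume.restrict Ω))
    (h : GEDiv Ω d b) {U φ : Eu n → ℝ} {DU Dφ : Eu n → Eu n}
    (hU : IsW12Zero Ω U DU) (hφ : IsW12Zero Ω φ Dφ)
    (hU0 : ∀ᵐ x ∂(volume.restrict Ω), 0 ≤ U x) (hφ0 : ∀ᵐ x ∂(volume.restrict Ω), 0 ≤ φ x) :
    0 ≤ ∫ x in Ω, (inner ℝ (U x • b x) (Dφ x) + (d x * U x + inner ℝ (b x) (DU x)) * φ x) := by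
  have memP : ∀ {v V}, IsW12Zero Ω v V → MemLp (fun x => d x * v x + inner ℝ (b x) (V x))
      (dualExp n) (volume.restrict Ω) := fun hv =>
    (hv.memLp_potential hn hK hd).add (memLp_inner_drift hn hb hv.memLp_grad)
  have symm : ∀ (v w : Eu n → ℝ) (V W : Eu n → Eu n),
      ∫ x in Ω, (inner ℝ (v x • b x) (W x) + (d x * v x + inner ℝ (b x) (V x)) * w x)
      = ∫ x in Ω, (inner ℝ (w x • b x) (V x) + (d x * w x + inner ℝ (b x) (W x)) * v x) := by
    intro v w V W
    refine integral_congr_ae (ae_of_all _ fun x => ?_)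
    simp only [real_inner_smul_left]
    ring
  -- Two limits are taken one after the other. With one factor a test function, the form is
  -- continuous in the other factor; for two test functions their product is admissible in `d ≥ div
  -- b`.
  have key : ∀ {ψ : Eu n → ℝ}, IsTestFunction Ω ψ → (∀ x, 0 ≤ ψ x) →
      0 ≤ ∫ x in Ω, (inner ℝ (U x • b x) (gradient ψ x)
        + (d x * U x + inner ℝ (b x) (DU x)) * ψ x) := by
    intro ψ hψ hψ0
    rw [symm]
    have hψZ := IsW12Zero.of_test hψ
    obtain ⟨us, h1, h2, -, h4⟩ := hU.exists_seq_nonneg hΩ hU0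
    refine ge_of_tendsto' (hU.tendsto_functional hn hK (hψZ.memLp_smul_drift hn hK hb) (memP hψZ)
      (fun j => IsW12Zero.of_test (h1 j)) h4) fun j => ?_
    have := h _ (hψ.mul_smooth (h1 j).contDiff) fun x => mul_nonneg (hψ0 x) (h2 j x)
    refine this.trans_eq (integral_congr_ae (ae_of_all _ fun x => ?_))
    simp only
    rw [gradient_mul_apply (hψ.differentiable x) ((h1 j).differentiable x), inner_add_right,
      real_inner_smul_left, real_inner_smul_right, real_inner_smul_right]
    ring
  obtain ⟨φs, h1, h2, -, h4⟩ := hφ.exists_seq_nonneg hΩ hφ0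
  exact ge_of_tendsto' (hφ.tendsto_functional hn hK (hU.memLp_smul_drift hn hK hb) (memP hU)
      (fun j => IsW12Zero.of_test (h1 j)) h4) fun j => key (h1 j) (h2 j)

/-- A subsolution can be tested with the localized nonnegative elements of `W_0^{1,2}(Ω)`. -/
theorem integral_le_zero_of_local {a c f : Eu n → Eu n} {u g : Eu n → ℝ} {Du : Eu n → Eu n}
    (hn : 3 ≤ n) (hK : IsSobolevConstant n K)
    (hΩ : IsOpen Ω) (ha : MemLp a 2 (volume.restrict Ω)) (hb : MemLp b n (volume.restrict Ω))
    (hc : MemLp c n (volume.restrict Ω)) (hd : MemLp d ((n : ℝ≥0∞) / 2) (volume.restrict Ω))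
    (hf : MemLp f 2 (volume.restrict Ω)) (hg : MemLp g (dualExp n) (volume.restrict Ω))
    (hu : IsW12With Ω u Du)
    (hsub : ∀ φ, IsTestFunction Ω φ → (∀ x, 0 ≤ φ x) →
      ∫ x in Ω, (inner ℝ (a x) (gradient φ x) + inner ℝ (b x) (gradient φ x) * u x
          + inner ℝ (c x) (Du x) * φ x + d x * u x * φ x)
        ≤ ∫ x in Ω, (g x * φ x - inner ℝ (f x) (gradient φ x)))
    {φ χ κ : Eu n → ℝ} {Φ : Eu n → Eu n} (hφ : IsW12Zero Ω φ Φ)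
    (hφ0 : ∀ᵐ x ∂(volume.restrict Ω), 0 ≤ φ x) (hχ : IsTestFunction Ω χ) (hχ0 : ∀ x, 0 ≤ χ x)
    (hκ : IsTestFunction Ω κ) (hχκ : ∀ x ∈ tsupport χ, κ x = 1)
    (hφχ : ∀ᵐ x ∂(volume.restrict Ω), φ x ≠ 0 → χ x = 1 ∧ gradient χ x = 0) :
    ∫ x in Ω, (inner ℝ (a x + (κ x * u x) • b x + f x) (Φ x)
      + (inner ℝ (c x) (Du x) + d x * (κ x * u x) - g x) * φ x) ≤ 0 := by
  -- Replacing `u` by `κu` gains Sobolev integrability, so that `κu b ∈ L²` and `dκu ∈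
  -- L^{2n/(n+2)}`.
  have hW := hu.isW12Zero_mul hΩ hκ
  have hP : MemLp (fun x => a x + (κ x * u x) • b x) 2 (volume.restrict Ω) :=
    ha.add (hW.memLp_smul_drift hn hK hb)
  have hp : MemLp (fun x => inner ℝ (c x) (Du x) + d x * (κ x * u x)) (dualExp n)
      (volume.restrict Ω) :=
    (memLp_inner_drift hn hc hu.memLp_grad).add (hW.memLp_potential hn hK hd)
  obtain ⟨φs, h1, h2, h3, h4⟩ := hφ.exists_seq_nonneg hΩ hφ0
  -- The factor `χ` confines the test functions to a set where `κ = 1`. It does not change the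
  -- limit, because `χ = 1` and `∇χ = 0` where `φ ≠ 0`, while `∇φ = 0` almost everywhere else.
  have ht : ∀ j, IsTestFunction Ω (fun x => χ x * φs j x) := fun j =>
    hχ.mul_smooth (h1 j).contDiff
  have hgr : ∀ j x, gradient (fun x => χ x * φs j x) x
      = χ x • gradient (φs j) x + φs j x • gradient χ x := fun j x =>
    gradient_mul_apply (hχ.differentiable x) ((h1 j).differentiable x)
  obtain ⟨M, hM0, hM⟩ := hχ.exists_bound
  obtain ⟨M', hM0', hM'⟩ := hχ.exists_bound_gradient
  have hlim : Tendsto (fun j => eLpNorm (fun x => Φ x - gradient (fun x => χ x * φs j x) x) 2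
      (volume.restrict Ω)) atTop (𝓝 0) := by
    refine tendsto_eLpNorm_of_le_add (by norm_num)
      (g := fun j x => χ x • (Φ x - gradient (φs j) x))
      (h := fun j x => (φ x - φs j x) • gradient χ x)
      (fun j => hχ.continuous.aestronglyMeasurable.smul
        (hφ.aesm_grad.sub (h1 j).continuous_gradient.aestronglyMeasurable))
      (fun j => (hφ.aesm.sub (h1 j).continuous.aestronglyMeasurable).smul
        hχ.continuous_gradient.aestronglyMeasurable) (fun j => ?_) ?_ ?_
    · filter_upwards [hφ.ae_grad_eq_zero hΩ hφ0, hφχ] with x hx hx'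
      rw [hgr]
      by_cases h0 : φ x = 0
      · simp [h0, hx h0]
        abel
      · simp [hx' h0]
    · refine tendsto_eLpNorm_of_le_mul M (fun j => ae_of_all _ fun x => ?_) h4
      rw [norm_smul]
      exact mul_le_mul_of_nonneg_right (hM x) (norm_nonneg _)
    · refine tendsto_eLpNorm_of_le_mul M' (fun j => ae_of_all _ fun x => ?_) h3
      rw [norm_smul, mul_comm]
      exact mul_le_mul_of_nonneg_right (hM' x) (norm_nonneg _)
  refine le_of_tendsto' (hφ.tendsto_functional hn hK (hP.add hf) (hp.sub hg)
    (fun j => IsW12Zero.of_test (ht j)) hlim) fun j => ?_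
  have hs := hsub _ (ht j) fun x => mul_nonneg (hχ0 x) (h2 j x)
  have htj := IsW12Zero.of_test (ht j)
  have i1 := htj.integrable_functional hn hK hP hp
  have i2 := htj.integrable_functional hn hK hf hg.neg
  have e1 : ∫ x in Ω, (inner ℝ (a x) (gradient (fun x => χ x * φs j x) x)
        + inner ℝ (b x) (gradient (fun x => χ x * φs j x) x) * u x
        + inner ℝ (c x) (Du x) * (χ x * φs j x) + d x * u x * (χ x * φs j x))
      = ∫ x in Ω, (inner ℝ (a x + (κ x * u x) • b x) (gradient (fun x => χ x * φs j x) x)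
        + (inner ℝ (c x) (Du x) + d x * (κ x * u x)) * (χ x * φs j x)) := by
    refine integral_congr_ae (ae_of_all _ fun x => ?_)
    simp only
    by_cases hx : x ∈ tsupport χ
    · rw [hχκ x hx, one_mul, inner_add_left, real_inner_smul_left]
      ring
    · have z1 : χ x = 0 := image_eq_zero_of_notMem_tsupport hx
      have z2 : gradient χ x = 0 := image_eq_zero_of_notMem_tsupport
        fun h => hx (IsTestFunction.tsupport_gradient_subset χ h)
      simp [hgr, z1, z2]
  have e2 : ∫ x in Ω, (g x * (χ x * φs j x) - inner ℝ (f x) (gradient (fun x => χ x * φs j x) x))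
      = -∫ x in Ω, (inner ℝ (f x) (gradient (fun x => χ x * φs j x) x)
        + (-g) x * (χ x * φs j x)) := by
    rw [← integral_neg]
    refine integral_congr_ae (ae_of_all _ fun x => ?_)
    simp only [Pi.neg_apply]
    ring
  rw [e1, e2, ← sub_nonpos, sub_neg_eq_add, ← integral_add i1 i2] at hs
  refine le_trans (le_of_eq (integral_congr_ae (ae_of_all _ fun x => ?_))) hs
  simp only [Pi.neg_apply, Pi.add_apply, Pi.sub_apply, inner_add_left]
  ring

/-- For compactly supported test functions, the sign condition on `d - div b` is subtracted from the
equation and cancels every term containing `u` undifferentiated. What remains involves only `Du`,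
which is globally in `L²`, so the functional is continuous on `W_0^{1,2}(Ω)` and the compact support
can be removed in the limit. -/
theorem integral_le_zero_of_test {a c f : Eu n → Eu n} {u g : Eu n → ℝ} {Du : Eu n → Eu n}
    (hn : 3 ≤ n) (hK : IsSobolevConstant n K)
    (hΩ : IsOpen Ω) (ha : MemLp a 2 (volume.restrict Ω)) (hb : MemLp b n (volume.restrict Ω))
    (hc : MemLp c n (volume.restrict Ω)) (hd : MemLp d ((n : ℝ≥0∞) / 2) (volume.restrict Ω))
    (hdiv : GEDiv Ω d b)
    (hf : MemLp f 2 (volume.restrict Ω)) (hg : MemLp g (dualExp n) (volume.restrict Ω))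
    (hu : IsW12With Ω u Du)
    (hsub : ∀ φ, IsTestFunction Ω φ → (∀ x, 0 ≤ φ x) →
      ∫ x in Ω, (inner ℝ (a x) (gradient φ x) + inner ℝ (b x) (gradient φ x) * u x
          + inner ℝ (c x) (Du x) * φ x + d x * u x * φ x)
        ≤ ∫ x in Ω, (g x * φ x - inner ℝ (f x) (gradient φ x)))
    {k : ℝ} (hk : 0 ≤ k) {D : Eu n → Eu n} (hw : IsW12Zero Ω (fun x => max (u x - k) 0) D)
    (hD : ∀ᵐ x ∂(volume.restrict Ω), k < u x → D x = Du x)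
    {Z : Eu n → ℝ} {DZ : Eu n → Eu n} (hZ : IsW12Zero Ω Z DZ)
    (hZ0 : ∀ᵐ x ∂(volume.restrict Ω), 0 ≤ Z x)
    (hZk : ∀ x, u x ≤ k → Z x = 0) :
    ∫ x in Ω, (inner ℝ (a x + f x) (DZ x)
      + (-inner ℝ (b x - c x) (Du x) - g x) * Z x) ≤ 0 := by
  have hp : MemLp (fun x => -inner ℝ (b x - c x) (Du x) - g x) (dualExp n) (volume.restrict Ω) :=
    (memLp_inner_drift hn (hb.sub hc) hu.memLp_grad).neg.sub hg
  obtain ⟨η, h1, h2, -, h4⟩ := hZ.exists_seq_nonneg hΩ hZ0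
  -- This is `min(Z, ηⱼ)`: supported in the compact support of `ηⱼ`, zero wherever `Z` is, and with
  -- gradient error `1_{Z > ηⱼ}(∇Z - ∇ηⱼ)`.
  have hφ : ∀ j, IsW12Zero Ω (fun x => Z x - max (Z x - η j x - 0) 0)
      (fun x => DZ x - Set.indicator {x | 0 < Z x - η j x}
        (fun x => DZ x - gradient (η j) x) x) := fun j =>
    hZ.sub ((hZ.sub (IsW12Zero.of_test (h1 j))).max_sub le_rfl)
  have hmin : ∀ j x, Z x - max (Z x - η j x - 0) 0 = min (Z x) (η j x) := fun j x => by
    rcases le_total (Z x) (η j x) with h | h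
    · rw [max_eq_right (by linarith), min_eq_left h, sub_zero]
    · rw [max_eq_left (by linarith), min_eq_right h]; ring
  simp_rw [hmin] at hφ
  have hlim : Tendsto (fun j => eLpNorm (fun x => DZ x - (DZ x - Set.indicator
      {x | 0 < Z x - η j x} (fun x => DZ x - gradient (η j) x) x)) 2 (volume.restrict Ω))
      atTop (𝓝 0) := by
    refine tendsto_eLpNorm_of_le_mul 1 (fun j => ae_of_all _ fun x => ?_) h4
    rw [sub_sub_cancel, one_mul]
    exact norm_indicator_le_norm_self _ _
  refine le_of_tendsto' (hZ.tendsto_functional hn hK (ha.add hf) hp hφ hlim) fun j => ?_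
  set φ : Eu n → ℝ := fun x => min (Z x) (η j x) with hφdef
  set Φ : Eu n → Eu n := fun x => DZ x - Set.indicator {x | 0 < Z x - η j x}
        (fun x => DZ x - gradient (η j) x) x
  have hφj : IsW12Zero Ω φ Φ := hφ j
  have hφ0 : ∀ᵐ x ∂(volume.restrict Ω), 0 ≤ φ x := by
    filter_upwards [hZ0] with x hx using le_min hx (h2 j x)
  obtain ⟨χ, hχ, hχ0, O, hO, hηO, hO1⟩ :=
    IsTestFunction.exists_cutoff hΩ (h1 j).hasCompactSupport.isCompact (h1 j).3
  obtain ⟨κ, hκ, -, O', hO', hχO', hO1'⟩ :=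
    IsTestFunction.exists_cutoff hΩ hχ.hasCompactSupport.isCompact hχ.3
  have hgχ : ∀ x ∈ O, gradient χ x = 0 := fun x hx => by
    have : χ =ᶠ[𝓝 x] fun _ => 1 := by
      filter_upwards [hO.mem_nhds hx] with y hy using hO1 y hy
    rw [this.gradient_eq, gradient_fun_const]
  have hpos : ∀ᵐ x ∂(volume.restrict Ω), φ x ≠ 0 → x ∈ O ∧ k < u x := by
    filter_upwards [hZ0] with x hx hne
    constructor
    · by_contra h
      have : η j x = 0 := image_eq_zero_of_notMem_tsupport fun h' => h (hηO h')
      exact hne (by simp [hφdef, this, hx])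
    · by_contra h
      exact hne (by simp [hφdef, hZk x (not_lt.1 h), h2 j x])
  have hloc := integral_le_zero_of_local hn hK hΩ ha hb hc hd hf hg hu hsub hφj hφ0 hχ hχ0 hκ
    (fun x hx => hO1' x (hχO' hx))
    (hpos.mono fun x hx h0 => ⟨hO1 x (hx h0).1, hgχ x (hx h0).1⟩)
  -- The function `(u - k)⁺ + kχ` is a nonnegative element of `W_0^{1,2}(Ω)` that equals `u`, with
  -- gradient `Du`, where `φ ≠ 0`. It plays the role of `u` in the condition `d ≥ div b`; here `k ≥
  -- 0` is needed.
  have hV := hw.add ((IsW12Zero.of_test hχ).const_mul k)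
  have hdivV := hdiv.integral_nonneg hn hK hΩ hb hd hV hφj
    (ae_of_all _ fun x => add_nonneg (le_max_right _ _) (mul_nonneg hk (hχ0 x))) hφ0
  have hW := hu.isW12Zero_mul hΩ hκ
  have i1 := hφj.integrable_functional hn hK
    (P := fun x => a x + (κ x * u x) • b x + f x)
    (p := fun x => inner ℝ (c x) (Du x) + d x * (κ x * u x) - g x)
    ((ha.add (hW.memLp_smul_drift hn hK hb)).add hf)
    (((memLp_inner_drift hn hc hu.memLp_grad).add (hW.memLp_potential hn hK hd)).sub hg)
  have i2 := hφj.integrable_functional hn hK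
    (p := fun x => d x * (max (u x - k) 0 + k * χ x) + inner ℝ (b x) (D x + k • gradient χ x))
    (hV.memLp_smul_drift hn hK hb)
    ((hV.memLp_potential hn hK hd).add (memLp_inner_drift hn hb hV.memLp_grad))
  refine le_trans (le_of_eq ?_) (sub_nonpos.2 (hloc.trans hdivV))
  rw [← integral_sub i1 i2]
  refine integral_congr_ae ?_
  filter_upwards [hpos, hD, hφj.ae_grad_eq_zero hΩ hφ0] with x hx hDx hΦ
  simp only [Pi.add_apply]
  change inner ℝ (a x + f x) (Φ x) + (-inner ℝ (b x - c x) (Du x) - g x) * φ x = _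
  by_cases h0 : φ x = 0
  · simp [h0, hΦ h0]
  · obtain ⟨hxO, hux⟩ := hx h0
    have hχx := hO1 x hxO
    have hκx : κ x = 1 := hO1' x (hχO' (subset_tsupport _ (by simp [hχx])))
    rw [hDx hux, hgχ x hxO, hχx, hκx, max_eq_left (by linarith)]
    simp only [inner_add_left, inner_sub_left, real_inner_smul_left, smul_zero, add_zero]
    ring

end Testing

/-! ### Integral inequalities for functions supported on a small set -/

section Support

variable {α : Type*} [MeasurableSpace α] {μ : Measure α} {F : Type*} [NormedAddCommGroup F]

theorem toReal_eLpNorm_le_of_support [IsFiniteMeasure μ] {Z : α → F} {p q : ℝ≥0∞} {S : Set α}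
    (hpq : p ≤ q) (hZ : MemLp Z q μ) (hS : Function.support Z ⊆ S) :
    (eLpNorm Z p μ).toReal
      ≤ (eLpNorm Z q μ).toReal * μ.real S ^ (1 / p.toReal - 1 / q.toReal) := by
  rcases eq_or_ne p 0 with rfl | hp
  · simp only [eLpNorm_exponent_zero, ENNReal.toReal_zero]
    positivity
  have h := eLpNorm_le_eLpNorm_mul_rpow_measure_univ (μ := μ.restrict S) hpq hZ.1.restrict
  rw [eLpNorm_restrict_eq_of_support_subset hS, eLpNorm_restrict_eq_of_support_subset hS,
    Measure.restrict_apply_univ] at h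
  have he : 0 ≤ 1 / p.toReal - 1 / q.toReal := by
    rcases eq_or_ne q ∞ with rfl | hq
    · simp
    · exact sub_nonneg.2 (one_div_le_one_div_of_le
        (ENNReal.toReal_pos hp (ne_top_of_le_ne_top hq hpq)) (ENNReal.toReal_mono hq hpq))
  have := ENNReal.toReal_mono (ENNReal.mul_ne_top hZ.2.ne
    (ENNReal.rpow_ne_top_of_nonneg he (measure_ne_top μ S))) h
  rwa [ENNReal.toReal_mul, ← ENNReal.toReal_rpow] at this

theorem toReal_eLpNorm_le_of_le [IsFiniteMeasure μ] (hμ : μ Set.univ ≤ 1) {Z : α → F}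
    {p q : ℝ≥0∞} (hpq : p ≤ q) (hZ : MemLp Z q μ) :
    (eLpNorm Z p μ).toReal ≤ (eLpNorm Z q μ).toReal := by
  rcases eq_or_ne p 0 with rfl | hp
  · simp
  have h := eLpNorm_le_eLpNorm_mul_rpow_measure_univ hpq hZ.1
  have he : 0 ≤ 1 / p.toReal - 1 / q.toReal := by
    rcases eq_or_ne q ∞ with rfl | hq
    · simp
    · exact sub_nonneg.2 (one_div_le_one_div_of_le
        (ENNReal.toReal_pos hp (ne_top_of_le_ne_top hq hpq)) (ENNReal.toReal_mono hq hpq))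
  refine ENNReal.toReal_mono hZ.2.ne (h.trans ?_)
  exact mul_le_of_le_one_right' (ENNReal.rpow_le_one hμ he)

theorem toReal_eLpNorm_mono {G : Type*} [NormedAddCommGroup G] {p : ℝ≥0∞} {f : α → F} {g : α → G}
    (hg : MemLp g p μ) (h : ∀ᵐ x ∂μ, ‖f x‖ ≤ ‖g x‖) :
    (eLpNorm f p μ).toReal ≤ (eLpNorm g p μ).toReal :=
  ENNReal.toReal_mono hg.2.ne (eLpNorm_mono_ae h)

theorem toReal_eLpNorm_mul_le {p q r : ℝ≥0∞} [ENNReal.HolderTriple p q r] {f g : α → ℝ}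
    (hf : MemLp f p μ) (hg : MemLp g q μ) :
    (eLpNorm (fun x => f x * g x) r μ).toReal ≤ (eLpNorm f p μ).toReal * (eLpNorm g q μ).toReal := by
  rw [← ENNReal.toReal_mul]
  have h : eLpNorm (f • g) r μ ≤ eLpNorm f p μ * eLpNorm g q μ :=
    eLpNorm_smul_le_mul_eLpNorm hg.1 hf.1
  exact ENNReal.toReal_mono (ENNReal.mul_ne_top hf.2.ne hg.2.ne) h

theorem integral_norm_sq_eq {f : α → F} (hf : MemLp f 2 μ) :
    ∫ x, ‖f x‖ ^ 2 ∂μ = (eLpNorm f 2 μ).toReal ^ 2 := by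
  have h := hf.eLpNorm_eq_integral_rpow_norm (by norm_num) (by norm_num)
  have h0 : 0 ≤ ∫ x, ‖f x‖ ^ 2 ∂μ := integral_nonneg fun x => by positivity
  simp only [ENNReal.toReal_ofNat, Real.rpow_ofNat] at h
  rw [h, ENNReal.toReal_ofReal (by positivity), ← Real.rpow_natCast, ← Real.rpow_mul h0]
  norm_num

end Support

/-! ### Stampacchia's lemma -/

/-- Along the levels `l + T(1 - 2^{-i})` the values of `m` decay like `ρ^i`. With `ρ = 2^{-1/α}` the
surplus power `ρ^{iα} = 2^{-i}` exactly compensates the shrinking gaps, and `T` is fixed by `Tρ =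
2B` so that the induction closes. -/
theorem stampacchia {m : ℝ → ℝ} {l B α : ℝ} (hα : 0 < α) (hB : 0 < B) (hm0 : ∀ s, 0 ≤ m s)
    (hm1 : ∀ s, m s ≤ 1) (hanti : Antitone m)
    (h : ∀ s s', l ≤ s → s < s' → (s' - s) * m s' ≤ B * m s ^ (1 + α)) :
    m (l + B * 2 ^ (1 + 1 / α)) = 0 := by
  set T : ℝ := B * 2 ^ (1 + 1 / α) with hT
  have hTpos : 0 < T := by positivity
  let s : ℕ → ℝ := fun i => l + T * (1 - (1 / 2) ^ i)
  have hpow : ∀ i : ℕ, (1 / 2 : ℝ) ^ i ≤ 1 := fun i => pow_le_one₀ (by norm_num) (by norm_num)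
  set ρ : ℝ := (1 / 2 : ℝ) ^ (1 / α) with hρ
  have hρ0 : 0 < ρ := by positivity
  have hρ1 : ρ < 1 := Real.rpow_lt_one (by norm_num) (by norm_num) (by positivity)
  have hρα : ρ ^ α = 1 / 2 := by
    rw [hρ, ← Real.rpow_mul (by norm_num)]
    field_simp
    norm_num
  have hTB : T * ρ = 2 * B := by
    have : (2 : ℝ) ^ (1 / α) * ρ = 1 := by
      rw [hρ, ← Real.mul_rpow (by norm_num) (by norm_num)]
      norm_num
    rw [hT, Real.rpow_add two_pos, Real.rpow_one]
    linear_combination 2 * B * this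
  have hind : ∀ i, m (s i) ≤ ρ ^ i := by
    intro i
    induction i with
    | zero => simpa using hm1 _
    | succ i ih =>
      have hp : (0 : ℝ) < (1 / 2) ^ i := by positivity
      have hd : s (i + 1) - s i = T * (1 / 2) ^ i / 2 := by
        simp only [s, pow_succ]
        ring
      have h1 := h (s i) (s (i + 1)) (by
        have := mul_nonneg hTpos.le (sub_nonneg.2 (hpow i))
        simp only [s]; linarith) (by
        have : 0 < T * (1 / 2) ^ i / 2 := by positivity
        linarith)
      have h2 : m (s i) ^ (1 + α) ≤ ρ ^ i * (1 / 2) ^ i := by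
        calc m (s i) ^ (1 + α) ≤ (ρ ^ i) ^ (1 + α) :=
              Real.rpow_le_rpow (hm0 _) ih (by positivity)
          _ = ρ ^ i * (ρ ^ α) ^ i := by
              rw [Real.rpow_add (by positivity), Real.rpow_one]
              congr 1
              rw [← Real.rpow_natCast, ← Real.rpow_natCast, ← Real.rpow_mul hρ0.le,
                ← Real.rpow_mul hρ0.le, mul_comm]
          _ = _ := by rw [hρα]
      rw [hd] at h1
      have h3 : T * (1 / 2) ^ i / 2 * m (s (i + 1)) ≤ B * (ρ ^ i * (1 / 2) ^ i) :=
        h1.trans (mul_le_mul_of_nonneg_left h2 hB.le)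
      have h4 : T * (1 / 2) ^ i / 2 * m (s (i + 1)) ≤ T * (1 / 2) ^ i / 2 * ρ ^ (i + 1) := by
        refine h3.trans (le_of_eq ?_)
        rw [pow_succ]
        linear_combination (-(1 / 2 : ℝ)) * (ρ ^ i * (1 / 2) ^ i) * hTB
      exact le_of_mul_le_mul_left h4 (by positivity)
  refine le_antisymm ?_ (hm0 _)
  refine ge_of_tendsto' (tendsto_pow_atTop_nhds_zero_of_lt_one hρ0.le hρ1) fun i => ?_
  refine (hanti ?_).trans (hind i)
  have : 0 < T * (1 / 2) ^ i := by positivity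
  simp only [s]
  linarith

/-! ### The energy inequality -/

/-- The vector `A ξ`. -/
def matVec {n : ℕ} (A : Matrix (Fin n) (Fin n) ℝ) (ξ : Eu n) : Eu n :=
  WithLp.toLp 2 fun i => ∑ j, A i j * ξ j

section Energy

variable {n : ℕ} {Ω : Set (Eu n)} {lam : ℝ} {A : Eu n → Matrix (Fin n) (Fin n) ℝ}

theorem inner_matVec (A : Matrix (Fin n) (Fin n) ℝ) (ξ η : Eu n) :
    inner ℝ (matVec A ξ) η = matrixForm A ξ η := by
  simp [matVec, matrixForm, PiLp.inner_apply, Finset.mul_sum, mul_comm]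

theorem matrixForm_smul_right (A : Matrix (Fin n) (Fin n) ℝ) (ξ η : Eu n) (r : ℝ) :
    matrixForm A ξ (r • η) = r * matrixForm A ξ η := by
  rw [← inner_matVec, real_inner_smul_right, inner_matVec]

theorem IsBoundedElliptic.memLp_matVec (hA : IsBoundedElliptic Ω lam A) {D : Eu n → Eu n}
    (hD : MemLp D 2 (volume.restrict Ω)) :
    MemLp (fun x => matVec (A x) (D x)) 2 (volume.restrict Ω) := by
  obtain ⟨M, hM⟩ := hA.bounded
  have hmeas : AEStronglyMeasurable (fun x => matVec (A x) (D x)) (volume.restrict Ω) := by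
    refine (PiLp.continuous_toLp 2 _).comp_aestronglyMeasurable ?_
    refine (aemeasurable_pi_iff.2 fun i => ?_).aestronglyMeasurable
    exact Finset.aemeasurable_fun_sum _ fun j _ =>
      ((hA.measurable i j).mul (memLp_apply hD j).1).aemeasurable
  refine hD.of_le_mul (c := n * n * M) hmeas ?_
  filter_upwards [hM] with x hx
  refine (norm_le_sum_norm_apply _).trans ?_
  have h1 : ∀ i, ‖matVec (A x) (D x) i‖ ≤ n * M * ‖D x‖ := fun i => by
    have : ‖∑ j, A x i j * D x j‖ ≤ ∑ _j : Fin n, M * ‖D x‖ :=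
      (norm_sum_le _ _).trans (Finset.sum_le_sum fun j _ => by
        rw [norm_mul]
        exact mul_le_mul (hx i j) (PiLp.norm_apply_le _ _) (norm_nonneg _)
          ((abs_nonneg _).trans (hx i j)))
    refine this.trans (le_of_eq ?_)
    simp
    ring
  refine (Finset.sum_le_sum fun i _ => h1 i).trans (le_of_eq ?_)
  simp
  ring

/-- `w ≥ 0` is an element of `W_0^{1,2}(Ω)` with gradient `D` that satisfies the energy inequality
of a subsolution with drift `h` and data `f`, `g`. -/
structure HasEnergyIneq (Ω : Set (Eu n)) (lam : ℝ) (h f : Eu n → Eu n) (g w : Eu n → ℝ)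
    (D : Eu n → Eu n) : Prop where
  isW12Zero : IsW12Zero Ω w D
  nonneg : ∀ x, 0 ≤ w x
  ineq : ∀ (Z γ : Eu n → ℝ), IsW12Zero Ω Z (fun x => γ x • D x) →
    (∀ᵐ x ∂(volume.restrict Ω), 0 ≤ Z x) → (∀ x, w x = 0 → Z x = 0) → (∀ x, 0 ≤ γ x) →
    lam * ∫ x in Ω, γ x * ‖D x‖ ^ 2
      ≤ (∫ x in Ω, ‖h x‖ * ‖D x‖ * |Z x|) + (∫ x in Ω, |g x| * |Z x|)
        + ∫ x in Ω, ‖f x‖ * ‖γ x • D x‖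

theorem IsW12Zero.integrable_drift {K : ℝ} (hn : 3 ≤ n) (hK : IsSobolevConstant n K)
    {h : Eu n → Eu n} (hh : MemLp h n (volume.restrict Ω)) {D : Eu n → Eu n}
    (hD : MemLp D 2 (volume.restrict Ω)) {Z : Eu n → ℝ} {DZ : Eu n → Eu n}
    (hZ : IsW12Zero Ω Z DZ) :
    Integrable (fun x => ‖h x‖ * ‖D x‖ * |Z x|) (volume.restrict Ω) := by
  have := holderTriple_dim_two hn
  have := holderConjugate_dualExp_sobExp hn
  have h1 : MemLp (fun x => ‖h x‖ * ‖D x‖) (dualExp n) (volume.restrict Ω) :=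
    hD.norm.mul' hh.norm (p := (n : ℝ≥0∞)) (q := 2)
  exact integrable_mul_of_memLp h1 (hZ.memLp_sobExp hK).norm

/-- From here on the equation is used only through this inequality. Wherever `Z` is nonzero, `u >
k`, so `Du` may be replaced by the gradient of `w`. -/
theorem IsSubsolution.hasEnergyIneq {K : ℝ} {b c f : Eu n → Eu n} {d g u : Eu n → ℝ}
    (hn : 3 ≤ n) (hK : IsSobolevConstant n K) (hΩ : IsOpen Ω) (hA : IsBoundedElliptic Ω lam A)
    (hb : MemLp b n (volume.restrict Ω)) (hc : MemLp c n (volume.restrict Ω))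
    (hd : MemLp d ((n : ℝ≥0∞) / 2) (volume.restrict Ω)) (hdiv : GEDiv Ω d b)
    (hf : MemLp f 2 (volume.restrict Ω)) (hg : MemLp g (dualExp n) (volume.restrict Ω))
    (hu : IsSubsolution Ω A b c d g f u) {k : ℝ} (hk : 0 ≤ k)
    (hbd : BoundaryLE Ω (fun x => max (u x) 0) k) :
    ∃ D, HasEnergyIneq Ω lam (fun x => b x - c x) f g (fun x => max (u x - k) 0) D := by
  obtain ⟨Du, hDu, hsub⟩ := hu
  have hmax : (fun x => max (max (u x) 0 - k) 0) = fun x => max (u x - k) 0 := by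
    ext x
    rcases le_total (u x) 0 with h | h
    · rw [max_eq_right h, max_eq_right (by linarith), max_eq_right (by linarith)]
    · rw [max_eq_left h]
  obtain ⟨D, hD1, hw⟩ := MemW12Zero.exists_isW12Zero hbd
  rw [hmax] at hD1 hw
  have hDe := hDu.grad_max_sub hΩ hk hD1
  refine ⟨D, hw, fun x => le_max_right _ _, fun Z γ hZ hZ0 hZw hγ => ?_⟩
  have hDD : ∀ᵐ x ∂(volume.restrict Ω), k < u x → D x = Du x := by
    filter_upwards [hDe] with x hx hux
    rw [hx, Set.indicator_of_mem (by exact hux)]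
  have hT := integral_le_zero_of_test hn hK hΩ (hA.memLp_matVec hDu.memLp_grad) hb hc hd hdiv hf hg
    hDu (by simpa only [inner_matVec] using hsub) hk hw hDD hZ hZ0
    (fun x hx => hZw x (max_eq_right (by linarith)))
  have := holderConjugate_dualExp_sobExp hn
  have hbc : MemLp (fun x => b x - c x) n (volume.restrict Ω) := hb.sub hc
  have i1 := integrable_inner_of_memLp (hA.memLp_matVec hDu.memLp_grad) hZ.memLp_grad
  have i2 := integrable_inner_of_memLp hf hZ.memLp_grad
  have i3 := integrable_mul_of_memLp (memLp_inner_drift hn hbc hDu.memLp_grad)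
    (hZ.memLp_sobExp hK)
  have i4 := integrable_mul_of_memLp hg (hZ.memLp_sobExp hK)
  have j1 := hZ.integrable_drift hn hK hbc hw.memLp_grad
  have j2 := integrable_norm_mul_norm hg (hZ.memLp_sobExp hK)
  have j3 := integrable_norm_mul_norm hf hZ.memLp_grad
  -- Ellipticity applies where `u > k`, since there `D = Du`; elsewhere `D = 0` and both integrands
  -- vanish.
  have hlow : lam * ∫ x in Ω, γ x * ‖D x‖ ^ 2
      ≤ ∫ x in Ω, inner ℝ (matVec (A x) (Du x)) (γ x • D x) := by
    rw [← integral_const_mul]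
    refine integral_mono_of_nonneg (ae_of_all _ fun x =>
      mul_nonneg hA.pos.le (mul_nonneg (hγ x) (sq_nonneg _))) i1 ?_
    filter_upwards [hA.elliptic, hDe] with x hx hDx
    rw [inner_matVec, matrixForm_smul_right]
    by_cases hux : k < u x
    · rw [hDx, Set.indicator_of_mem (by exact hux)]
      have := mul_le_mul_of_nonneg_left (hx (Du x)) (hγ x)
      linarith
    · rw [hDx, Set.indicator_of_notMem (by exact hux), ← inner_matVec]
      simp
  refine hlow.trans ?_
  have hsplit : ∫ x in Ω, (inner ℝ (matVec (A x) (Du x) + f x) (γ x • D x)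
      + (-inner ℝ (b x - c x) (Du x) - g x) * Z x)
      = (∫ x in Ω, inner ℝ (matVec (A x) (Du x)) (γ x • D x))
        + (∫ x in Ω, inner ℝ (f x) (γ x • D x))
        - (∫ x in Ω, inner ℝ (b x - c x) (Du x) * Z x) - ∫ x in Ω, g x * Z x := by
    have i5 := i1.add i2
    have i6 := i5.sub i3
    rw [← integral_add' i1 i2, ← integral_sub' i5 i3, ← integral_sub' i6 i4]
    refine integral_congr_ae (ae_of_all _ fun x => ?_)
    simp only [Pi.add_apply, Pi.sub_apply, inner_add_left]
    ring
  rw [hsplit] at hT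
  have b1 : ∫ x in Ω, inner ℝ (b x - c x) (Du x) * Z x
      ≤ ∫ x in Ω, ‖b x - c x‖ * ‖D x‖ * |Z x| := by
    refine integral_mono_ae i3 j1 ?_
    filter_upwards [hDD] with x hx
    by_cases hux : k < u x
    · rw [hx hux]
      refine (le_abs_self _).trans ?_
      rw [abs_mul]
      exact mul_le_mul_of_nonneg_right (abs_real_inner_le_norm _ _) (abs_nonneg _)
    · simp [hZw x (max_eq_right (by linarith))]
  have b2 : ∫ x in Ω, g x * Z x ≤ ∫ x in Ω, |g x| * |Z x| :=
    integral_mono i4 j2 fun x => by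
      simp only [← abs_mul]
      exact le_abs_self _
  have b3 : -∫ x in Ω, inner ℝ (f x) (γ x • D x) ≤ ∫ x in Ω, ‖f x‖ * ‖γ x • D x‖ := by
    rw [← integral_neg]
    exact integral_mono i2.neg j3 fun x =>
      (neg_le_abs _).trans (abs_real_inner_le_norm _ _)
  linarith

end Energy

/-! ### Estimates on small superlevel sets -/

section SmallLevels

variable {n : ℕ} {Ω : Set (Eu n)}

theorem MeasureTheory.MemLp.indicator_nullMeasurableSet {α F : Type*} [MeasurableSpace α]
    {μ : Measure α} [NormedAddCommGroup F] {f : α → F} {p : ℝ≥0∞} (hf : MemLp f p μ) {S : Set α}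
    (hS : NullMeasurableSet S μ) : MemLp (S.indicator f) p μ :=
  hf.mono (hf.1.indicator₀ hS) (ae_of_all _ fun _ => norm_indicator_le_norm_self _ _)

theorem isFiniteMeasure_restrict (hμ : volume Ω ≤ 1) : IsFiniteMeasure (volume.restrict Ω) :=
  ⟨by rw [Measure.restrict_apply_univ]; exact hμ.trans_lt ENNReal.one_lt_top⟩

theorem measureReal_restrict_le_one (hμ : volume Ω ≤ 1) (S : Set (Eu n)) :
    (volume.restrict Ω).real S ≤ 1 := by
  have h : (volume.restrict Ω) S ≤ 1 :=
    ((measure_mono (Set.subset_univ S)).trans_eq (Measure.restrict_apply_univ Ω)).trans hμ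
  exact ENNReal.toReal_mono ENNReal.one_ne_top h

theorem toReal_sobExp (hn : 3 ≤ n) : 1 / (sobExp n).toReal = 1 / 2 - 1 / n := by
  have h3 : (3 : ℝ) ≤ n := by exact_mod_cast hn
  have h2 : (0 : ℝ) < n - 2 := by linarith
  rw [sobExp, ENNReal.toReal_ofReal (by positivity)]
  field_simp

theorem toReal_dualExp (hn : 3 ≤ n) : 1 / (dualExp n).toReal = 1 / 2 + 1 / n := by
  have h3 : (3 : ℝ) ≤ n := by exact_mod_cast hn
  rw [dualExp, ENNReal.toReal_ofReal (by positivity)]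
  field_simp

theorem two_le_sobExp (hn : 3 ≤ n) : 2 ≤ sobExp n := by
  have h3 : (3 : ℝ) ≤ n := by exact_mod_cast hn
  have h2 : (0 : ℝ) < n - 2 := by linarith
  rw [sobExp, ← ENNReal.ofReal_ofNat]
  refine ENNReal.ofReal_le_ofReal ?_
  rw [le_div_iff₀ h2]
  linarith

theorem IsW12Zero.toReal_eLpNorm_le {K : ℝ} (hK : IsSobolevConstant n K) {v : Eu n → ℝ}
    {V : Eu n → Eu n} (h : IsW12Zero Ω v V) :
    (eLpNorm v (sobExp n) (volume.restrict Ω)).toReal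
      ≤ K * (eLpNorm V 2 (volume.restrict Ω)).toReal := by
  have := ENNReal.toReal_mono (ENNReal.mul_ne_top ENNReal.ofReal_ne_top h.memLp_grad.2.ne)
    (h.eLpNorm_le hK)
  rwa [ENNReal.toReal_mul, ENNReal.toReal_ofReal hK.1.le] at this

theorem dualExp_le_half {q : ℝ} (hn : 3 ≤ n) (hq : n < q) : dualExp n ≤ ENNReal.ofReal (q / 2) := by
  have h3 : (3 : ℝ) ≤ n := by exact_mod_cast hn
  refine ENNReal.ofReal_le_ofReal ?_
  rw [div_le_iff₀ (by positivity)]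
  nlinarith

/-- The drift splits into a part that is small in `L^n` and a part bounded by `t`. -/
structure IsSmallAbove (Ω : Set (Eu n)) (h : Eu n → Eu n) (t ε : ℝ) : Prop where
  memLp : MemLp h n (volume.restrict Ω)
  nonneg : 0 ≤ t
  small : (bigR Ω h t).toReal ≤ ε

theorem IsSmallAbove.memLp_indicator {h : Eu n → Eu n} {t ε : ℝ} (H : IsSmallAbove Ω h t ε) :
    MemLp (Set.indicator {x | t ≤ ‖h x‖} fun x => ‖h x‖) n (volume.restrict Ω) :=
  H.memLp.norm.indicator_nullMeasurableSet
    (nullMeasurableSet_le aemeasurable_const H.memLp.1.norm.aemeasurable)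

theorem norm_le_indicator_add {h : Eu n → Eu n} {t : ℝ} (ht : 0 ≤ t) (x : Eu n) :
    ‖h x‖ ≤ Set.indicator {x | t ≤ ‖h x‖} (fun x => ‖h x‖) x + t := by
  by_cases hx : t ≤ ‖h x‖
  · rw [Set.indicator_of_mem (by exact hx)]; linarith
  · rw [Set.indicator_of_notMem (by exact hx)]; linarith [not_le.1 hx]

theorem integral_abs_eq_toReal_eLpNorm_one {α : Type*} [MeasurableSpace α] {μ : Measure α}
    {Z : α → ℝ} (hZ : AEStronglyMeasurable Z μ) : ∫ x, |Z x| ∂μ = (eLpNorm Z 1 μ).toReal := by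
  rw [eLpNorm_one_eq_lintegral_enorm, ← integral_norm_eq_lintegral_enorm hZ]
  rfl

variable {K lam t q F : ℝ} {h f : Eu n → Eu n} {g w : Eu n → ℝ} {D : Eu n → Eu n}

theorem HasEnergyIneq.nullMeasurableSet_lt (hE : HasEnergyIneq Ω lam h f g w D) (l : ℝ) :
    NullMeasurableSet {x | l < w x} (volume.restrict Ω) :=
  _root_.nullMeasurableSet_lt aemeasurable_const hE.isW12Zero.aesm.aemeasurable

/-- The drift term in the energy inequality of a truncation. -/
theorem IsW12Zero.integral_drift_le (hn : 3 ≤ n) (hK : IsSobolevConstant n K)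
    (hμ : volume Ω ≤ 1) {ε : ℝ} (H : IsSmallAbove Ω h t ε) {Z : Eu n → ℝ} {DZ : Eu n → Eu n}
    (hZ : IsW12Zero Ω Z DZ) {S : Set (Eu n)} (hS : Function.support Z ⊆ S) :
    ∫ x in Ω, ‖h x‖ * ‖DZ x‖ * |Z x|
      ≤ (ε + t * (volume.restrict Ω).real S ^ (1 / (n : ℝ))) * K
          * (eLpNorm DZ 2 (volume.restrict Ω)).toReal ^ 2 := by
  have := isFiniteMeasure_restrict hμ
  have := holderTriple_dim_sobExp hn
  set E := (eLpNorm DZ 2 (volume.restrict Ω)).toReal with hE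
  have hE0 : 0 ≤ E := ENNReal.toReal_nonneg
  set h1 : Eu n → ℝ := Set.indicator {x | t ≤ ‖h x‖} fun x => ‖h x‖
  have m1 : MemLp (fun x => h1 x * Z x) 2 (volume.restrict Ω) :=
    (hZ.memLp_sobExp hK).mul' H.memLp_indicator (p := (n : ℝ≥0∞)) (q := sobExp n)
  have hSob := hZ.toReal_eLpNorm_le hK
  have hn1 : (eLpNorm (fun x => h1 x * Z x) 2 (volume.restrict Ω)).toReal ≤ ε * (K * E) :=
    (toReal_eLpNorm_mul_le H.memLp_indicator (hZ.memLp_sobExp hK)).trans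
      (mul_le_mul H.small hSob ENNReal.toReal_nonneg (ENNReal.toReal_nonneg.trans H.small))
  have hn2 : (eLpNorm Z 2 (volume.restrict Ω)).toReal
      ≤ K * E * (volume.restrict Ω).real S ^ (1 / (n : ℝ)) := by
    have h2 := toReal_eLpNorm_le_of_support (two_le_sobExp hn) (hZ.memLp_sobExp hK) hS
    rw [toReal_sobExp hn, ENNReal.toReal_ofNat] at h2
    rw [sub_sub_cancel] at h2
    exact h2.trans (mul_le_mul_of_nonneg_right hSob (Real.rpow_nonneg measureReal_nonneg _))
  have i1 := integrable_norm_mul_norm m1 hZ.memLp_grad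
  have i2 := (integrable_norm_mul_norm hZ.memLp hZ.memLp_grad).const_mul t
  calc ∫ x in Ω, ‖h x‖ * ‖DZ x‖ * |Z x|
      ≤ ∫ x in Ω, (‖h1 x * Z x‖ * ‖DZ x‖ + t * (‖Z x‖ * ‖DZ x‖)) := by
        refine integral_mono (hZ.integrable_drift hn hK H.memLp hZ.memLp_grad) (i1.add i2)
          fun x => ?_
        have hx := norm_le_indicator_add (h := h) H.nonneg x
        have h1x : |h1 x| = h1 x :=
          abs_of_nonneg (Set.indicator_nonneg (fun _ _ => norm_nonneg _) x)
        rw [norm_mul, Real.norm_eq_abs, Real.norm_eq_abs, h1x]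
        calc ‖h x‖ * ‖DZ x‖ * |Z x| ≤ (h1 x + t) * ‖DZ x‖ * |Z x| := by gcongr
          _ = _ := by ring
    _ = (∫ x in Ω, ‖h1 x * Z x‖ * ‖DZ x‖) + t * ∫ x in Ω, ‖Z x‖ * ‖DZ x‖ := by
        rw [integral_add i1 i2, integral_const_mul]
    _ ≤ ε * (K * E) * E + t * (K * E * (volume.restrict Ω).real S ^ (1 / (n : ℝ)) * E) := by
        have b1 := integral_norm_mul_norm_le m1 hZ.memLp_grad
        have b2 := integral_norm_mul_norm_le hZ.memLp hZ.memLp_grad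
        have ht := H.nonneg
        gcongr
        · exact b1.trans (mul_le_mul_of_nonneg_right hn1 hE0)
        · exact b2.trans (mul_le_mul_of_nonneg_right hn2 hE0)
    _ = _ := by ring

theorem toReal_eLpNorm_indicator_le {G : Type*} [NormedAddCommGroup G] (hμ : volume Ω ≤ 1)
    {p r : ℝ≥0∞} (hpr : p ≤ r) {φ : Eu n → G} (hφ : MemLp φ r (volume.restrict Ω))
    {S : Set (Eu n)} (hS : NullMeasurableSet S (volume.restrict Ω)) {β : ℝ} (hβ : 0 ≤ β)
    (hβ' : β ≤ 1 / p.toReal - 1 / r.toReal) :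
    (eLpNorm (S.indicator φ) p (volume.restrict Ω)).toReal
      ≤ (eLpNorm φ r (volume.restrict Ω)).toReal * (volume.restrict Ω).real S ^ β := by
  have := isFiniteMeasure_restrict hμ
  refine (toReal_eLpNorm_le_of_support hpr (hφ.indicator_nullMeasurableSet hS)
    Set.support_indicator_subset).trans ?_
  refine mul_le_mul (toReal_eLpNorm_mono hφ (ae_of_all _ fun x => norm_indicator_le_norm_self _ _))
    ?_ (by positivity) ENNReal.toReal_nonneg
  -- The exponent may be lowered to `β` because the measure is at most one.
  exact Real.rpow_le_rpow_of_exponent_ge_of_imp measureReal_nonneg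
    (measureReal_restrict_le_one hμ S) hβ' fun _ h0 => le_antisymm (by linarith) hβ
  
/-- Let `E` be the gradient norm of `(w - l)⁺` and `m` the measure of its support set. The drift
takes two thirds of `λE²` and the data contribute at most `(K+1)F m^{1/2-1/q} E`, so `E` is at most
a constant times `F m^{1/2-1/q}`. Sobolev and Hölder add the factor `m^{1/2+1/n}`; the total
exponent exceeds one because `q > n`. -/
theorem HasEnergyIneq.integral_max_sub_le (hn : 3 ≤ n) (hK : IsSobolevConstant n K)
    (hμ : volume Ω ≤ 1) (hlam : 0 < lam) (H : IsSmallAbove Ω h t (lam / (3 * K)))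
    (hq : n < q) (hf : MemLp f (ENNReal.ofReal q) (volume.restrict Ω))
    (hg : MemLp g (ENNReal.ofReal (q / 2)) (volume.restrict Ω))
    (hF : (eLpNorm f (ENNReal.ofReal q) (volume.restrict Ω)).toReal
      + (eLpNorm g (ENNReal.ofReal (q / 2)) (volume.restrict Ω)).toReal ≤ F)
    (hE : HasEnergyIneq Ω lam h f g w D) {l : ℝ} (hl : 0 ≤ l)
    (hm : t * K * (volume.restrict Ω).real {x | l < w x} ^ (1 / (n : ℝ)) ≤ lam / 3) :
    ∫ x in Ω, max (w x - l) 0 ≤ 3 * K * (K + 1) / lam * F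
      * (volume.restrict Ω).real {x | l < w x} ^ (1 + (1 / (n : ℝ) - 1 / q)) := by
  have := isFiniteMeasure_restrict hμ
  have := holderConjugate_dualExp_sobExp hn
  have h3 : (3 : ℝ) ≤ n := by exact_mod_cast hn
  have hn0 : (0 : ℝ) < n := by linarith
  have hq0 : 0 < q := by linarith
  have hnq : 1 / q ≤ 1 / (n : ℝ) := one_div_le_one_div_of_le hn0 hq.le
  have hn3 : 1 / (n : ℝ) ≤ 1 / 3 := one_div_le_one_div_of_le (by norm_num) h3
  have hK0 := hK.1
  have hSm := hE.nullMeasurableSet_lt l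
  set S : Set (Eu n) := {x | l < w x} with hSdef
  set m := (volume.restrict Ω).real S with hmdef
  have hm0 : 0 ≤ m := measureReal_nonneg
  set Z : Eu n → ℝ := fun x => max (w x - l) 0 with hZdef
  set DZ : Eu n → Eu n := S.indicator D with hDZ
  have hZ : IsW12Zero Ω Z DZ := hE.isW12Zero.max_sub hl
  have hZs : ∀ x, x ∉ S → Z x = 0 := fun x hx => max_eq_right (sub_nonpos.2 (not_lt.1 hx))
  have hZsupp : Function.support Z ⊆ S := fun x hx => by_contra fun h' => hx (hZs x h')
  set E := (eLpNorm DZ 2 (volume.restrict Ω)).toReal with hEdef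
  have hE0 : 0 ≤ E := ENNReal.toReal_nonneg
  set β : ℝ := 1 / 2 - 1 / q with hβ
  have hβ0 : 0 ≤ β := by linarith
  -- The truncation is tested with weight `γ = 1_S`.
  have hγ : (fun x => S.indicator (fun _ => (1:ℝ)) x • D x) = DZ := by
    ext1 x
    by_cases hx : x ∈ S <;> simp [hDZ, hx]
  have hen := hE.ineq Z (S.indicator fun _ => 1) (by rwa [hγ])
    (ae_of_all _ fun x => le_max_right _ _)
    (fun x hx => hZs x fun h' => by
      have : l < w x := h'
      linarith) fun x => Set.indicator_nonneg (fun _ _ => zero_le_one) x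
  have e0 : ∫ x in Ω, S.indicator (fun _ => (1:ℝ)) x * ‖D x‖ ^ 2 = E ^ 2 := by
    rw [hEdef, ← integral_norm_sq_eq hZ.memLp_grad]
    refine integral_congr_ae (ae_of_all _ fun x => ?_)
    by_cases hx : x ∈ S <;> simp [hDZ, hx]
  have e1 : ∫ x in Ω, ‖h x‖ * ‖D x‖ * |Z x| = ∫ x in Ω, ‖h x‖ * ‖DZ x‖ * |Z x| := by
    refine integral_congr_ae (ae_of_all _ fun x => ?_)
    by_cases hx : x ∈ S
    · simp [hDZ, hx]
    · simp [hZs x hx]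
  have b1 : ∫ x in Ω, ‖h x‖ * ‖D x‖ * |Z x| ≤ 2 * lam / 3 * E ^ 2 := by
    rw [e1]
    refine (hZ.integral_drift_le hn hK hμ H hZsupp).trans ?_
    refine mul_le_mul_of_nonneg_right ?_ (sq_nonneg E)
    have : lam / (3 * K) * K = lam / 3 := by field_simp
    linarith
  have b2 : ∫ x in Ω, |g x| * |Z x|
      ≤ (eLpNorm g (ENNReal.ofReal (q / 2)) (volume.restrict Ω)).toReal * m ^ β * (K * E) := by
    have hgS := (hg.mono_exponent (dualExp_le_half hn hq)).indicator_nullMeasurableSet hSm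
    have e2 : ∫ x in Ω, |g x| * |Z x| = ∫ x in Ω, ‖S.indicator g x‖ * ‖Z x‖ := by
      refine integral_congr_ae (ae_of_all _ fun x => ?_)
      by_cases hx : x ∈ S
      · simp [hx]
      · simp [hZs x hx]
    rw [e2]
    refine (integral_norm_mul_norm_le hgS (hZ.memLp_sobExp hK)).trans ?_
    -- Hölder for `g` gives the exponent `1/2 + 1/n - 2/q`, which is at least `β` because `q > n`;
    -- it is lowered to `β` to match the term with `f`.
    refine mul_le_mul (toReal_eLpNorm_indicator_le hμ (dualExp_le_half hn hq) hg hSm hβ0 ?_)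
      (hZ.toReal_eLpNorm_le hK) ENNReal.toReal_nonneg (by positivity)
    rw [toReal_dualExp hn, ENNReal.toReal_ofReal (by positivity)]
    have : 1 / (q / 2) = 2 * (1 / q) := by field_simp
    rw [this, hβ]
    linarith
  have h2q : (2 : ℝ≥0∞) ≤ ENNReal.ofReal q := by
    rw [← ENNReal.ofReal_ofNat]
    exact ENNReal.ofReal_le_ofReal (by linarith)
  have b3 : ∫ x in Ω, ‖f x‖ * ‖S.indicator (fun _ => (1:ℝ)) x • D x‖
      ≤ (eLpNorm f (ENNReal.ofReal q) (volume.restrict Ω)).toReal * m ^ β * E := by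
    have hfS := (hf.mono_exponent h2q).indicator_nullMeasurableSet hSm
    have e3 : ∫ x in Ω, ‖f x‖ * ‖S.indicator (fun _ => (1:ℝ)) x • D x‖
        = ∫ x in Ω, ‖S.indicator f x‖ * ‖DZ x‖ := by
      refine integral_congr_ae (ae_of_all _ fun x => ?_)
      by_cases hx : x ∈ S <;> simp [hx, hDZ]
    rw [e3]
    refine (integral_norm_mul_norm_le hfS hZ.memLp_grad).trans ?_
    refine mul_le_mul_of_nonneg_right (toReal_eLpNorm_indicator_le hμ h2q hf hSm hβ0 ?_) hE0
    rw [ENNReal.toReal_ofNat, ENNReal.toReal_ofReal hq0.le]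
  rw [e0] at hen
  set Nf := (eLpNorm f (ENNReal.ofReal q) (volume.restrict Ω)).toReal
  set Ng := (eLpNorm g (ENNReal.ofReal (q / 2)) (volume.restrict Ω)).toReal
  have hNf : 0 ≤ Nf := ENNReal.toReal_nonneg
  have hNg : 0 ≤ Ng := ENNReal.toReal_nonneg
  have hmβ : 0 ≤ m ^ β := Real.rpow_nonneg hm0 _
  have hEF : lam * E ≤ 3 * (K + 1) * F * m ^ β := by
    rcases hE0.eq_or_lt with h0 | h0
    · rw [← h0, mul_zero]
      have : 0 ≤ F := (add_nonneg hNf hNg).trans hF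
      positivity
    · have hsum : Ng * K + Nf ≤ (K + 1) * F := by nlinarith
      have h4 : lam / 3 * E * E ≤ (K + 1) * F * m ^ β * E := by
        have := mul_le_mul_of_nonneg_right hsum (mul_nonneg hmβ hE0)
        nlinarith
      have := le_of_mul_le_mul_right h4 h0
      linarith
  have hL1 : ∫ x in Ω, Z x ≤ K * E * m ^ (1 / 2 + 1 / (n : ℝ)) := by
    have e4 : ∫ x in Ω, Z x = ∫ x in Ω, |Z x| :=
      integral_congr_ae (ae_of_all _ fun x => (abs_of_nonneg (le_max_right _ _)).symm)
    rw [e4, integral_abs_eq_toReal_eLpNorm_one hZ.aesm]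
    refine (toReal_eLpNorm_le_of_support ((by norm_num : (1 : ℝ≥0∞) ≤ 2).trans (two_le_sobExp hn))
      (hZ.memLp_sobExp hK) hZsupp).trans ?_
    rw [toReal_sobExp hn, ENNReal.toReal_one]
    have : (1 : ℝ) / 1 - (1 / 2 - 1 / n) = 1 / 2 + 1 / n := by ring
    rw [this]
    exact mul_le_mul_of_nonneg_right (hZ.toReal_eLpNorm_le hK) (Real.rpow_nonneg hm0 _)
  refine hL1.trans ?_
  have hexp : m ^ (1 + (1 / (n : ℝ) - 1 / q)) = m ^ β * m ^ (1 / 2 + 1 / (n : ℝ)) := by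
    rw [← Real.rpow_add_of_nonneg hm0 hβ0 (by positivity)]
    congr 1
    rw [hβ]
    ring
  rw [hexp, ← mul_assoc]
  refine mul_le_mul_of_nonneg_right ?_ (Real.rpow_nonneg hm0 _)
  have : K * E = K / lam * (lam * E) := by field_simp
  rw [this]
  refine (mul_le_mul_of_nonneg_left hEF (by positivity)).trans (le_of_eq ?_)
  ring

/-- If `w` exceeds the level `l` only on a small set, then it exceeds `l` by at most `C F`. -/
theorem HasEnergyIneq.measureReal_eq_zero (hn : 3 ≤ n) (hK : IsSobolevConstant n K)
    (hμ : volume Ω ≤ 1) (hlam : 0 < lam) (H : IsSmallAbove Ω h t (lam / (3 * K)))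
    (hq : n < q) (hf : MemLp f (ENNReal.ofReal q) (volume.restrict Ω))
    (hg : MemLp g (ENNReal.ofReal (q / 2)) (volume.restrict Ω)) (hF0 : 0 < F)
    (hF : (eLpNorm f (ENNReal.ofReal q) (volume.restrict Ω)).toReal
      + (eLpNorm g (ENNReal.ofReal (q / 2)) (volume.restrict Ω)).toReal ≤ F)
    (hE : HasEnergyIneq Ω lam h f g w D) {l : ℝ} (hl : 0 ≤ l)
    (hm : t * K * (volume.restrict Ω).real {x | l < w x} ^ (1 / (n : ℝ)) ≤ lam / 3) :
    (volume.restrict Ω).real {x | l + 3 * K * (K + 1) / lam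
      * 2 ^ (1 + 1 / (1 / (n : ℝ) - 1 / q)) * F < w x} = 0 := by
  have := isFiniteMeasure_restrict hμ
  have h3 : (3 : ℝ) ≤ n := by exact_mod_cast hn
  have hK0 := hK.1
  have hα : 0 < 1 / (n : ℝ) - 1 / q :=
    sub_pos.2 (one_div_lt_one_div_of_lt (by linarith) hq)
  have hanti : Antitone fun s => (volume.restrict Ω).real {x | s < w x} := fun s s' hs =>
    measureReal_mono fun x (hx : s' < w x) => hs.trans_lt hx
  -- The decay hypothesis follows from Chebyshev applied to `(w - s)⁺`. The smallness assumed at `l`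
  -- persists at every higher level.
  have key := stampacchia (m := fun s => (volume.restrict Ω).real {x | s < w x}) (l := l)
    (B := 3 * K * (K + 1) / lam * F) hα (by positivity) (fun s => measureReal_nonneg)
    (fun s => measureReal_restrict_le_one hμ _) hanti fun s s' hs hss' => ?_
  · have e : l + 3 * K * (K + 1) / lam * F * 2 ^ (1 + 1 / (1 / (n : ℝ) - 1 / q))
      = l + 3 * K * (K + 1) / lam * 2 ^ (1 + 1 / (1 / (n : ℝ) - 1 / q)) * F := by ring
    simpa only [e] using key
  · have hs0 := hl.trans hs
    refine le_trans ?_ (hE.integral_max_sub_le hn hK hμ hlam H hq hf hg hF hs0 (le_trans ?_ hm))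
    · have hZ := hE.isW12Zero.max_sub hs0
      have hi : Integrable (fun x => max (w x - s) 0) (volume.restrict Ω) :=
        hZ.memLp.integrable (by norm_num)
      refine le_trans ?_ (mul_meas_ge_le_integral_of_nonneg (ae_of_all _ fun x => le_max_right _ _)
        hi (s' - s))
      refine mul_le_mul_of_nonneg_left (measureReal_mono fun x (hx : s' < w x) => ?_) (by linarith)
      exact le_max_of_le_left (sub_le_sub_right hx.le s)
    · exact mul_le_mul_of_nonneg_left (Real.rpow_le_rpow measureReal_nonneg (hanti hs)
        (by positivity)) (mul_nonneg H.nonneg hK0.le)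

end SmallLevels

/-! ### The logarithmic estimate -/

section Log

/-- Cutting `a - s` off below at `F` makes the derivatives of the logarithm and of the reciprocal
bounded and continuous on the whole line, as the chain rule requires. For `s ≤ a - F` the cutoff is
inactive. -/
theorem continuous_one_div_max_pow (a : ℝ) {F : ℝ} (hF : 0 < F) (p : ℕ) :
    Continuous fun s : ℝ => 1 / max (a - s) F ^ p :=
  continuous_const.div (by fun_prop) fun s => by
    have : 0 < max (a - s) F := lt_max_of_lt_right hF
    positivity

theorem abs_one_div_max_pow_le (a : ℝ) {F : ℝ} (hF : 0 < F) (p : ℕ) (s : ℝ) :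
    |1 / max (a - s) F ^ p| ≤ 1 / F ^ p := by
  have : 0 < max (a - s) F := lt_max_of_lt_right hF
  rw [abs_of_nonneg (by positivity)]
  gcongr
  exact le_max_right _ _

theorem prim_one_div_max {a F s : ℝ} (hF : 0 < F) (hs : 0 ≤ s) (hsa : s ≤ a - F) :
    prim (fun s => 1 / max (a - s) F ^ 1) s = Real.log (a / (a - s)) := by
  have hd : ∀ t ∈ Set.uIcc 0 s,
      HasDerivAt (fun t => -Real.log (a - t)) (1 / max (a - t) F ^ 1) t := fun t ht => by
    rw [Set.uIcc_of_le hs] at ht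
    have h1 : F ≤ a - t := by linarith [ht.2]
    have h2 := (((hasDerivAt_id' t).const_sub a).log (by linarith)).neg
    rw [max_eq_left h1]
    refine h2.congr_deriv ?_
    ring
  rw [prim, intervalIntegral.integral_eq_sub_of_hasDerivAt hd
    ((continuous_one_div_max_pow a hF 1).intervalIntegrable _ _),
    Real.log_div (by linarith) (by linarith)]
  simp
  ring

theorem prim_one_div_max_sq_le {a F s : ℝ} (hF : 0 < F) (hs : 0 ≤ s) (hsa : s ≤ a - F) :
    prim (fun s => 1 / max (a - s) F ^ 2) s ≤ 1 / max (a - s) F ^ 1 := by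
  have hd : ∀ t ∈ Set.uIcc 0 s,
      HasDerivAt (fun t => (a - t)⁻¹) (1 / max (a - t) F ^ 2) t := fun t ht => by
    rw [Set.uIcc_of_le hs] at ht
    have h1 : F ≤ a - t := by linarith [ht.2]
    have h2 := ((hasDerivAt_id' t).const_sub a).fun_inv (by linarith)
    rw [max_eq_left h1]
    refine h2.congr_deriv ?_
    ring
  rw [prim, intervalIntegral.integral_eq_sub_of_hasDerivAt hd
    ((continuous_one_div_max_pow a hF 2).intervalIntegrable _ _), max_eq_left (by linarith)]
  have : 0 ≤ (a - 0)⁻¹ := inv_nonneg.2 (by linarith)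
  simp only [pow_one, one_div]
  linarith

theorem prim_mono {G : ℝ → ℝ} (hG : Continuous G) (h0 : ∀ s, 0 ≤ G s) : Monotone (prim G) := by
  intro a b hab
  rw [← sub_nonneg, prim, prim, intervalIntegral.integral_interval_sub_left
    (hG.intervalIntegrable _ _) (hG.intervalIntegrable _ _)]
  exact intervalIntegral.integral_nonneg hab fun s _ => h0 s

variable {n : ℕ} {Ω : Set (Eu n)} {K lam F M l δ Hc : ℝ} {h f : Eu n → Eu n} {g w : Eu n → ℝ}
  {D : Eu n → Eu n}

/-- With `a = M + F`, the test function `Z = 1/(a-w) - 1/a` has gradient `D/(a-w)²`, so the left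
side is `λ` times the squared norm of the gradient of `v = log(a/(a-w))`. Since `Z ≤ 1/(a-w)`, the
drift is linear in that norm, and `a - w ≥ F` makes the data terms scale-invariant. Thus `∫ v` is
bounded, while `v ≥ log(a/(a-l))` on a set of measure at least `δ`. -/
theorem HasEnergyIneq.le_of_measure_level (hn : 3 ≤ n) (hK : IsSobolevConstant n K)
    (hμ : volume Ω ≤ 1) (hlam : 0 < lam) (hE : HasEnergyIneq Ω lam h f g w D)
    (hh : MemLp h n (volume.restrict Ω)) (hHc : (eLpNorm h 2 (volume.restrict Ω)).toReal ≤ Hc)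
    (hf : MemLp f 2 (volume.restrict Ω)) (hg : MemLp g (dualExp n) (volume.restrict Ω))
    (hF0 : 0 < F) (hF : (eLpNorm f 2 (volume.restrict Ω)).toReal
      + (eLpNorm g 1 (volume.restrict Ω)).toReal ≤ F)
    (hwM : ∀ᵐ x ∂(volume.restrict Ω), w x ≤ M) (hl : 0 ≤ l) (hlM : l ≤ M) (hδ : 0 < δ)
    (hδl : δ ≤ (volume.restrict Ω).real {x | l < w x}) :
    M + F ≤ (M + F - l) * Real.exp (K * (1 + (Hc + 2) / lam) / δ) := by
  have := isFiniteMeasure_restrict hμ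
  have hK0 := hK.1
  have hw := hE.isW12Zero
  set a := M + F with ha
  have hc : ∀ p : ℕ, Continuous fun s : ℝ => 1 / max (a - s) F ^ p :=
    continuous_one_div_max_pow a hF0
  have hb : ∀ (p : ℕ) (s : ℝ), |1 / max (a - s) F ^ p| ≤ 1 / F ^ p := abs_one_div_max_pow_le a hF0
  have hpos : ∀ s, 0 < max (a - s) F := fun s => lt_max_of_lt_right hF0
  have hnn : ∀ (p : ℕ) (s : ℝ), 0 ≤ 1 / max (a - s) F ^ p := fun p s => by
    have := hpos s
    positivity
  set v : Eu n → ℝ := fun x => prim (fun s => 1 / max (a - s) F ^ 1) (w x) with hv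
  set Dv : Eu n → Eu n := fun x => (1 / max (a - w x) F ^ 1) • D x with hDv
  set Z : Eu n → ℝ := fun x => prim (fun s => 1 / max (a - s) F ^ 2) (w x) with hZdef
  have hvZ : IsW12Zero Ω v Dv := hw.chain_continuous (hc 1) (hb 1)
  have hZ : IsW12Zero Ω Z fun x => (1 / max (a - w x) F ^ 2) • D x :=
    hw.chain_continuous (hc 2) (hb 2)
  have prim0 : ∀ p, prim (fun s : ℝ => 1 / max (a - s) F ^ p) 0 = 0 := fun p => by simp [prim]
  have hprim : ∀ (p : ℕ) (x : Eu n), 0 ≤ prim (fun s => 1 / max (a - s) F ^ p) (w x) := fun p x =>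
    (prim0 p).symm.le.trans (prim_mono (hc p) (hnn p) (hE.nonneg x))
  have hen := hE.ineq Z (fun x => 1 / max (a - w x) F ^ 2) hZ (ae_of_all _ fun x => hprim 2 x)
    (fun x hx => by rw [hZdef]; simp only [hx, prim0]) fun x => hnn 2 _
  set E := (eLpNorm Dv 2 (volume.restrict Ω)).toReal with hEdef
  have hE0 : 0 ≤ E := ENNReal.toReal_nonneg
  have hDvn : ∀ x, ‖Dv x‖ = 1 / max (a - w x) F ^ 1 * ‖D x‖ := fun x => by
    rw [hDv]
    simp only
    rw [norm_smul, Real.norm_of_nonneg (hnn 1 _)]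
  have e0 : ∫ x in Ω, 1 / max (a - w x) F ^ 2 * ‖D x‖ ^ 2 = E ^ 2 := by
    rw [hEdef, ← integral_norm_sq_eq hvZ.memLp_grad]
    refine integral_congr_ae (ae_of_all _ fun x => ?_)
    simp only [hDvn]
    ring
  have hZle : ∀ᵐ x ∂(volume.restrict Ω), |Z x| ≤ 1 / max (a - w x) F ^ 1 := by
    filter_upwards [hwM] with x hx
    rw [abs_of_nonneg (hprim 2 x)]
    exact prim_one_div_max_sq_le hF0 (hE.nonneg x) (by linarith)
  have h2n : (2 : ℝ≥0∞) ≤ n := by exact_mod_cast (by omega : 2 ≤ n)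
  have hh2 := hh.mono_exponent h2n
  have j1 := integrable_norm_mul_norm hh2 hvZ.memLp_grad
  have b1 : ∫ x in Ω, ‖h x‖ * ‖D x‖ * |Z x| ≤ Hc * E := by
    have i := integral_norm_mul_norm_le hh2 hvZ.memLp_grad
    refine (integral_mono_ae (hZ.integrable_drift hn hK hh hw.memLp_grad) j1 ?_).trans
      (i.trans (mul_le_mul_of_nonneg_right hHc hE0))
    filter_upwards [hZle] with x hx
    rw [hDvn]
    calc ‖h x‖ * ‖D x‖ * |Z x| ≤ ‖h x‖ * ‖D x‖ * (1 / max (a - w x) F ^ 1) := by gcongr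
      _ = _ := by ring
  have hconj := holderConjugate_dualExp_sobExp hn
  set Ng := (eLpNorm g 1 (volume.restrict Ω)).toReal
  set Nf := (eLpNorm f 2 (volume.restrict Ω)).toReal
  have b2 : ∫ x in Ω, |g x| * |Z x| ≤ Ng / F := by
    have hg1 : Integrable g (volume.restrict Ω) := by
      refine memLp_one_iff_integrable.1 (hg.mono_exponent ?_)
      have h3 : (3 : ℝ) ≤ n := by exact_mod_cast hn
      rw [dualExp, ← ENNReal.ofReal_one]
      refine ENNReal.ofReal_le_ofReal ?_
      rw [le_div_iff₀ (by positivity)]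
      linarith
    have i : ∫ x in Ω, |g x| / F = Ng / F := by
      rw [integral_div, integral_abs_eq_toReal_eLpNorm_one hg.1]
    rw [← i]
    refine integral_mono_ae (integrable_norm_mul_norm hg (hZ.memLp_sobExp hK))
      (hg1.abs.div_const F) ?_
    filter_upwards [hZle] with x hx
    have h1 : |Z x| ≤ 1 / F := hx.trans (by simpa using (le_abs_self _).trans (hb 1 (w x)))
    calc ‖g x‖ * ‖Z x‖ ≤ ‖g x‖ * (1 / F) := mul_le_mul_of_nonneg_left h1 (norm_nonneg _)
      _ = |g x| / F := by rw [Real.norm_eq_abs]; ring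
  have b3 : ∫ x in Ω, ‖f x‖ * ‖(1 / max (a - w x) F ^ 2) • D x‖ ≤ Nf / F * E := by
    have i := integral_norm_mul_norm_le hf hvZ.memLp_grad
    have i' := (integrable_norm_mul_norm hf hvZ.memLp_grad).const_mul (1 / F)
    refine (integral_mono (integrable_norm_mul_norm hf hZ.memLp_grad) i' fun x => ?_).trans ?_
    · simp only [hDvn]
      rw [norm_smul, Real.norm_of_nonneg (hnn 2 _)]
      have h1 : 1 / max (a - w x) F ^ 1 ≤ 1 / F := by
        simpa using (le_abs_self _).trans (hb 1 (w x))
      have h2 := mul_le_mul_of_nonneg_right h1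
        (mul_nonneg (norm_nonneg (f x)) (mul_nonneg (hnn 1 (w x)) (norm_nonneg (D x))))
      refine le_trans (le_of_eq ?_) h2
      field_simp
    · rw [integral_const_mul]
      refine (mul_le_mul_of_nonneg_left i (by positivity)).trans (le_of_eq ?_)
      ring
  rw [e0] at hen
  have hHc0 : 0 ≤ Hc := ENNReal.toReal_nonneg.trans hHc
  have hfF : Nf / F ≤ 1 := by
    rw [div_le_one hF0]
    linarith [ENNReal.toReal_nonneg (a := eLpNorm g 1 (volume.restrict Ω))]
  have hgF : Ng / F ≤ 1 := by
    rw [div_le_one hF0]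
    linarith [ENNReal.toReal_nonneg (a := eLpNorm f 2 (volume.restrict Ω))]
  -- The energy inequality now reads `λE² ≤ Hc E + 1 + E`; for `E ≥ 1` the constant `1` is absorbed
  -- into `E`.
  have hEle : E ≤ 1 + (Hc + 2) / lam := by
    rcases le_total E 1 with h1 | h1
    · have : 0 ≤ (Hc + 2) / lam := by positivity
      linarith
    · have h2 : E ≤ (Hc + 2) / lam := by
        rw [le_div_iff₀ hlam]
        have h3 : lam * E * E ≤ (Hc + 2) * E := by nlinarith
        have := le_of_mul_le_mul_right h3 (by linarith)
        linarith
      linarith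
  have hvint : ∫ x in Ω, v x ≤ K * (1 + (Hc + 2) / lam) := by
    have e4 : ∫ x in Ω, v x = ∫ x in Ω, |v x| :=
      integral_congr_ae (ae_of_all _ fun x => (abs_of_nonneg (hprim 1 x)).symm)
    rw [e4, integral_abs_eq_toReal_eLpNorm_one hvZ.aesm]
    refine (toReal_eLpNorm_le_of_le (by rwa [Measure.restrict_apply_univ])
      ((by norm_num : (1 : ℝ≥0∞) ≤ 2).trans (two_le_sobExp hn)) (hvZ.memLp_sobExp hK)).trans ?_
    exact (hvZ.toReal_eLpNorm_le hK).trans (mul_le_mul_of_nonneg_left hEle hK0.le)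
  have hal : 0 < a - l := by linarith
  have hlog : Real.log (a / (a - l)) * δ ≤ K * (1 + (Hc + 2) / lam) := by
    refine le_trans ?_ hvint
    have h0 : 0 ≤ Real.log (a / (a - l)) :=
      Real.log_nonneg (by rw [le_div_iff₀ hal]; linarith)
    refine le_trans ?_ (mul_meas_ge_le_integral_of_nonneg (ae_of_all _ fun x => hprim 1 x)
      (hvZ.memLp.integrable (by norm_num)) (Real.log (a / (a - l))))
    refine mul_le_mul_of_nonneg_left (hδl.trans (measureReal_mono fun x (hx : l < w x) => ?_)) h0
    rw [← prim_one_div_max hF0 hl (by linarith)]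
    exact prim_mono (hc 1) (hnn 1) hx.le
  rw [← le_div_iff₀ hδ, Real.log_le_iff_le_exp (div_pos (by linarith) hal), div_le_iff₀ hal] at hlog
  linarith

end Log

/-! ### The maximum principle -/

section Bound

variable {n : ℕ} {Ω : Set (Eu n)} {K lam t q F : ℝ} {h f : Eu n → Eu n} {g w : Eu n → ℝ}
  {D : Eu n → Eu n}

theorem IsSmallAbove.toReal_eLpNorm_two_le {ε : ℝ} (hn : 3 ≤ n) (hμ : volume Ω ≤ 1)
    (H : IsSmallAbove Ω h t ε) : (eLpNorm h 2 (volume.restrict Ω)).toReal ≤ ε + t := by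
  have := isFiniteMeasure_restrict hμ
  have hμ' : (volume.restrict Ω) Set.univ ≤ 1 := by rwa [Measure.restrict_apply_univ]
  have h2n : (2 : ℝ≥0∞) ≤ n := by exact_mod_cast (by omega : 2 ≤ n)
  have hi := H.memLp_indicator.mono_exponent h2n
  have hc : MemLp (fun _ : Eu n => t) 2 (volume.restrict Ω) := memLp_const t
  have h1 : eLpNorm h 2 (volume.restrict Ω)
      ≤ eLpNorm (Set.indicator {x | t ≤ ‖h x‖} fun x => ‖h x‖) 2 (volume.restrict Ω)
        + eLpNorm (fun _ : Eu n => t) 2 (volume.restrict Ω) :=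
    (eLpNorm_mono_real fun x => norm_le_indicator_add H.nonneg x).trans
      (eLpNorm_add_le hi.1 hc.1 (by norm_num))
  have h2 := ENNReal.toReal_mono (ENNReal.add_ne_top.2 ⟨hi.2.ne, hc.2.ne⟩) h1
  rw [ENNReal.toReal_add hi.2.ne hc.2.ne] at h2
  refine h2.trans (add_le_add ?_ ?_)
  · exact (toReal_eLpNorm_le_of_le hμ' h2n H.memLp_indicator).trans H.small
  · have h3 : eLpNorm (fun _ : Eu n => t) 2 (volume.restrict Ω) ≤ ENNReal.ofReal t := by
      refine (eLpNorm_le_of_ae_bound (C := t) (ae_of_all _ fun x => ?_)).trans ?_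
      · rw [Real.norm_of_nonneg H.nonneg]
      · exact mul_le_of_le_one_left' (ENNReal.rpow_le_one hμ' (by positivity))
    simpa [H.nonneg] using ENNReal.toReal_mono ENNReal.ofReal_ne_top h3

/-- The constant of the De Giorgi iteration. -/
def deGiorgiConst (n : ℕ) (K lam q : ℝ) : ℝ :=
  3 * K * (K + 1) / lam * 2 ^ (1 + 1 / (1 / (n : ℝ) - 1 / q))

/-- The constant of the maximum principle. -/
def maxPrincipleConst (n : ℕ) (K lam q t : ℝ) : ℝ :=
  (deGiorgiConst n K lam q + 2)
    * Real.exp (K * (1 + (lam / (3 * K) + t + 2) / lam) / (lam / (3 * K * t)) ^ n)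

/-- Quantizing the levels in steps of `F` makes the two estimates meet: the first level with a small
superlevel set gives an upper bound, and the level one step below feeds the logarithmic estimate.
Their gap is a fixed multiple of `F`, however high the level is. -/
theorem HasEnergyIneq.ae_le (hn : 3 ≤ n) (hK : IsSobolevConstant n K)
    (hμ : volume Ω ≤ 1) (hlam : 0 < lam) (ht : 0 < t) (H : IsSmallAbove Ω h t (lam / (3 * K)))
    (hq : n < q) (hf : MemLp f (ENNReal.ofReal q) (volume.restrict Ω))
    (hg : MemLp g (ENNReal.ofReal (q / 2)) (volume.restrict Ω)) (hF0 : 0 < F)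
    (hF : (eLpNorm f (ENNReal.ofReal q) (volume.restrict Ω)).toReal
      + (eLpNorm g (ENNReal.ofReal (q / 2)) (volume.restrict Ω)).toReal ≤ F)
    (hE : HasEnergyIneq Ω lam h f g w D) :
    ∀ᵐ x ∂(volume.restrict Ω), w x ≤ maxPrincipleConst n K lam q t * F := by
  have := isFiniteMeasure_restrict hμ
  have hμ' : (volume.restrict Ω) Set.univ ≤ 1 := by rwa [Measure.restrict_apply_univ]
  have h3 : (3 : ℝ) ≤ n := by exact_mod_cast hn
  have hn0 : (n : ℝ) ≠ 0 := by positivity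
  have hK0 := hK.1
  -- The largest measure for which the bounded part of the drift is still absorbed: `tK δ^{1/n} =
  -- λ/3`.
  set δ : ℝ := (lam / (3 * K * t)) ^ n with hδdef
  have hδ : 0 < δ := by positivity
  have hδt : t * K * δ ^ (1 / (n : ℝ)) = lam / 3 := by
    rw [hδdef, ← Real.rpow_natCast, ← Real.rpow_mul (by positivity), mul_one_div_cancel hn0,
      Real.rpow_one]
    field_simp
  set C1 := deGiorgiConst n K lam q with hC1def
  have hC1 : 0 ≤ C1 := by
    rw [hC1def, deGiorgiConst]
    positivity
  set m : ℝ → ℝ := fun s => (volume.restrict Ω).real {x | s < w x} with hm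
  -- Chebyshev gives some such `i`. Its size depends on `w`, but only its existence matters.
  have hex : ∃ i : ℕ, m (i * F) ≤ δ := by
    have hw0 : 0 ≤ ∫ x in Ω, w x := integral_nonneg hE.nonneg
    obtain ⟨i, hi⟩ := exists_nat_gt ((∫ x in Ω, w x) / (F * δ))
    have hi0 : (0 : ℝ) < i := lt_of_le_of_lt (by positivity) hi
    refine ⟨i, ?_⟩
    have h1 := mul_meas_ge_le_integral_of_nonneg (ae_of_all _ hE.nonneg)
      (hE.isW12Zero.memLp.integrable (by norm_num)) ((i : ℝ) * F)
    have h2 : m (i * F) ≤ (volume.restrict Ω).real {x | (i : ℝ) * F ≤ w x} :=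
      measureReal_mono fun x (hx : (i : ℝ) * F < w x) => hx.le
    rw [div_lt_iff₀ (by positivity)] at hi
    have hiF : 0 < (i : ℝ) * F := by positivity
    refine le_of_mul_le_mul_left ?_ hiF
    calc (i : ℝ) * F * m (i * F) ≤ _ := mul_le_mul_of_nonneg_left h2 hiF.le
      _ ≤ _ := h1
      _ ≤ i * (F * δ) := hi.le
      _ = _ := by ring
  classical
  set i := Nat.find hex with hi
  have hspec : m (i * F) ≤ δ := Nat.find_spec hex
  have hiF0 : 0 ≤ (i : ℝ) * F := by positivity
  have hz := hE.measureReal_eq_zero hn hK hμ hlam H hq hf hg hF0 hF hiF0 (by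
    rw [← hδt]
    exact mul_le_mul_of_nonneg_left (Real.rpow_le_rpow measureReal_nonneg hspec (by positivity))
      (by positivity))
  have hM : ∀ᵐ x ∂(volume.restrict Ω), w x ≤ i * F + C1 * F := by
    rw [measureReal_eq_zero_iff] at hz
    change (volume.restrict Ω) {x | i * F + C1 * F < w x} = 0 at hz
    rw [ae_iff]
    simpa only [not_le] using hz
  set e := Real.exp (K * (1 + (lam / (3 * K) + t + 2) / lam) / δ) with he
  have he1 : 1 ≤ e := Real.one_le_exp (by positivity)
  have hCe : maxPrincipleConst n K lam q t = (C1 + 2) * e := rfl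
  rw [hCe]
  rcases Nat.eq_zero_or_pos i with h0 | h0
  · filter_upwards [hM] with x hx
    rw [h0] at hx
    have h1 : C1 * 1 ≤ (C1 + 2) * e := mul_le_mul (by linarith) he1 zero_le_one (by linarith)
    have h2 := mul_le_mul_of_nonneg_right h1 hF0.le
    push_cast at hx
    linarith
  -- By minimality of `i`, the preceding level still has a superlevel set of measure at least `δ`;
  -- the natural subtraction is genuine since `i > 0`.
  · have hi1 : δ ≤ m ((i - 1 : ℕ) * F) :=
      (not_le.1 (Nat.find_min hex (Nat.sub_lt h0 one_pos))).le
    have hcast : ((i - 1 : ℕ) : ℝ) = i - 1 := by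
      rw [Nat.cast_sub h0, Nat.cast_one]
    have hi1' : (1 : ℝ) ≤ i := by exact_mod_cast h0
    have h2q : (2 : ℝ≥0∞) ≤ ENNReal.ofReal q := by
      rw [← ENNReal.ofReal_ofNat]
      exact ENNReal.ofReal_le_ofReal (by linarith)
    have h1q : (1 : ℝ≥0∞) ≤ ENNReal.ofReal (q / 2) := by
      rw [← ENNReal.ofReal_one]
      exact ENNReal.ofReal_le_ofReal (by linarith)
    have key := hE.le_of_measure_level hn hK hμ hlam H.memLp (H.toReal_eLpNorm_two_le hn hμ)
      (hf.mono_exponent h2q) (hg.mono_exponent (dualExp_le_half hn hq)) hF0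
      ((add_le_add (toReal_eLpNorm_le_of_le hμ' h2q hf)
        (toReal_eLpNorm_le_of_le hμ' h1q hg)).trans hF) hM
      (l := (i - 1 : ℕ) * F) (by positivity) (by
        rw [hcast]
        nlinarith [mul_nonneg hC1 hF0.le]) hδ hi1
    have h4 : (i : ℝ) * F + C1 * F + F - (i - 1 : ℕ) * F = (C1 + 2) * F := by
      rw [hcast]
      ring
    rw [h4] at key
    filter_upwards [hM] with x hx
    calc w x ≤ i * F + C1 * F + F := by linarith
      _ ≤ _ := key
      _ = _ := by ring

/-- The infimum need not be attained, so the splitting height is moved strictly above it; the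
absolute value makes positivity immediate. Some height is admissible because the `L^n` tails of `h`
tend to zero, and all larger heights are then admissible by monotonicity. -/
theorem isSmallAbove_of_smallR {ε : ℝ} (hh : MemLp h n (volume.restrict Ω)) (hε : 0 < ε) : IsSmallAbove Ω h (|smallR Ω h ε| + 1) ε := by
  have hanti : ∀ {s s' : ℝ}, s ≤ s' → bigR Ω h s' ≤ bigR Ω h s := fun {s s'} hs => by
    refine eLpNorm_mono_real fun x => ?_
    by_cases hx : s' ≤ ‖h x‖
    · rw [Set.indicator_of_mem (by exact hx), Set.indicator_of_mem (by exact hs.trans hx)]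
      simp
    · rw [Set.indicator_of_notMem (by exact hx), norm_zero]
      exact Set.indicator_nonneg (fun _ _ => norm_nonneg _) x
  have hne : {t : ℝ | 0 < t ∧ bigR Ω h t < ENNReal.ofReal ε}.Nonempty := by
    obtain ⟨M, hM, hle⟩ := (hh.norm.ae_eq hh.1.norm.ae_eq_mk).eLpNorm_indicator_norm_ge_pos_le
      hh.1.norm.stronglyMeasurable_mk (half_pos hε)
    refine ⟨M, hM, lt_of_le_of_lt ?_
      ((ENNReal.ofReal_lt_ofReal_iff hε).2 (half_lt_self hε))⟩
    refine le_trans (le_of_eq (eLpNorm_congr_ae ?_)) hle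
    filter_upwards [hh.1.norm.ae_eq_mk] with x hx
    have hnx : (‖hh.1.norm.mk (fun x => ‖h x‖) x‖₊ : ℝ) = ‖h x‖ := by
      rw [coe_nnnorm, ← hx, norm_norm]
    by_cases hM' : M ≤ ‖h x‖
    · rw [Set.indicator_of_mem (by exact hM'),
        Set.indicator_of_mem (by rw [Set.mem_ofPred_eq, hnx]; exact hM'), hx]
    · rw [Set.indicator_of_notMem (by exact hM'),
        Set.indicator_of_notMem (by rw [Set.mem_ofPred_eq, hnx]; exact hM')]
  refine ⟨hh, by positivity, ?_⟩
  have hlt : smallR Ω h ε < |smallR Ω h ε| + 1 := by linarith [le_abs_self (smallR Ω h ε)]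
  obtain ⟨s, ⟨-, hs⟩, hst⟩ := exists_lt_of_csInf_lt hne hlt
  have := ENNReal.toReal_mono ENNReal.ofReal_ne_top ((hanti hst.le).trans hs.le)
  rwa [ENNReal.toReal_ofReal hε.le] at this

/-- A negative number is never an upper bound on the boundary of a nonnegative function. -/
theorem BoundaryLE.nonneg (hn : 3 ≤ n) (hK : IsSobolevConstant n K) (hΩ : IsOpen Ω)
    (hne : Ω.Nonempty) {v : Eu n → ℝ} (hv : ∀ x, 0 ≤ v x) {k : ℝ} (hk : BoundaryLE Ω v k) :
    0 ≤ k := by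
  by_contra! hk0
  obtain ⟨D, -, hw⟩ := MemW12Zero.exists_isW12Zero hk
  -- For `k < 0` one has `(v - k)⁺ = v - k ≥ -k`. Capping it at `-k/2` puts a nonzero constant with
  -- zero gradient into `W_0^{1,2}(Ω)`, which contradicts the Sobolev inequality.
  have h1 := hw.sub (hw.max_sub (l := -k / 2) (by linarith))
  have h2 : IsW12Zero Ω (fun _ => -k / 2) fun _ => 0 := by
    refine h1.congr_ae (ae_of_all _ fun x => ?_) (ae_of_all _ fun x => ?_)
    · have := hv x
      have e1 : max (v x - k) 0 = v x - k := max_eq_left (by linarith)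
      have e2 : max (v x - k - -k / 2) 0 = v x - k - -k / 2 := max_eq_left (by linarith)
      simp only [e1, e2]
      ring
    · have hx : -k / 2 < max (v x - k) 0 := lt_max_of_lt_left (by linarith [hv x])
      simp only
      rw [Set.indicator_of_mem (by exact hx), sub_self]
  have h3 := h2.eLpNorm_le hK
  have hs0 : sobExp n ≠ 0 := ((zero_lt_two' ℝ≥0∞).trans_le (two_le_sobExp hn)).ne'
  rw [eLpNorm_zero', mul_zero, nonpos_iff_eq_zero,
    eLpNorm_eq_zero_iff aestronglyMeasurable_const hs0] at h3
  have h4 : (volume.restrict Ω) ≠ 0 := by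
    rw [Ne, Measure.restrict_eq_zero]
    exact (hΩ.measure_pos volume hne).ne'
  have : NeZero (volume.restrict Ω) := ⟨h4⟩
  obtain ⟨x, hx⟩ := h3.exists
  simp at hx
  linarith

end Bound

theorem maxPrincipleConst_pos {n : ℕ} {K lam q t : ℝ} (hK : 0 < K) (hlam : 0 < lam) :
    0 < maxPrincipleConst n K lam q t := by
  have : 0 ≤ deGiorgiConst n K lam q := by
    rw [deGiorgiConst]
    positivity
  rw [maxPrincipleConst]
  positivity

/-- The maximum principle for a given upper bound on the boundary. -/
theorem IsSubsolution.ae_le {n : ℕ} {Ω : Set (Eu n)} {K lam q k t F : ℝ}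
    {A : Eu n → Matrix (Fin n) (Fin n) ℝ} {b c f : Eu n → Eu n} {d g u : Eu n → ℝ}
    (hn : 3 ≤ n) (hK : IsSobolevConstant n K) (hΩ : IsOpen Ω) (hμ : volume Ω ≤ 1)
    (hA : IsBoundedElliptic Ω lam A) (hb : MemLp b n (volume.restrict Ω))
    (hc : MemLp c n (volume.restrict Ω)) (hd : MemLp d ((n : ℝ≥0∞) / 2) (volume.restrict Ω))
    (hdiv : GEDiv Ω d b) (hq : n < q) (hf : MemLp f (ENNReal.ofReal q) (volume.restrict Ω))
    (hg : MemLp g (ENNReal.ofReal (q / 2)) (volume.restrict Ω))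
    (hu : IsSubsolution Ω A b c d g f u) (hk : 0 ≤ k)
    (hbd : BoundaryLE Ω (fun x => max (u x) 0) k) (ht : 0 < t)
    (H : IsSmallAbove Ω (fun x => b x - c x) t (lam / (3 * K)))
    (hF : (eLpNorm f (ENNReal.ofReal q) (volume.restrict Ω)).toReal
      + (eLpNorm g (ENNReal.ofReal (q / 2)) (volume.restrict Ω)).toReal ≤ F) :
    ∀ᵐ x ∂(volume.restrict Ω), u x ≤ k + maxPrincipleConst n K lam q t * F := by
  have := isFiniteMeasure_restrict hμ
  have h3 : (3 : ℝ) ≤ n := by exact_mod_cast hn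
  have h2q : (2 : ℝ≥0∞) ≤ ENNReal.ofReal q := by
    rw [← ENNReal.ofReal_ofNat]
    exact ENNReal.ofReal_le_ofReal (by linarith)
  have hF0 : 0 ≤ F := (add_nonneg ENNReal.toReal_nonneg ENNReal.toReal_nonneg).trans hF
  obtain ⟨D, hE⟩ := hu.hasEnergyIneq hn hK hΩ hA hb hc hd hdiv (hf.mono_exponent h2q)
    (hg.mono_exponent (dualExp_le_half hn hq)) hk hbd
  -- The estimate needs `F > 0`; vanishing data are reached by letting `F + 1/(j+1)` decrease to
  -- `F`.
  have key : ∀ j : ℕ, ∀ᵐ x ∂(volume.restrict Ω),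
      max (u x - k) 0 ≤ maxPrincipleConst n K lam q t * (F + 1 / ((j : ℝ) + 1)) := fun j =>
    hE.ae_le hn hK hμ hA.pos ht H hq hf hg (by positivity)
      (hF.trans (le_add_of_nonneg_right (by positivity)))
  filter_upwards [ae_all_iff.2 key] with x hx
  have hlim := (tendsto_one_div_add_atTop_nhds_zero_nat (𝕜 := ℝ)).const_add F
    |>.const_mul (maxPrincipleConst n K lam q t)
  have := ge_of_tendsto' hlim fun j => (le_max_left _ _).trans (hx j)
  rw [add_zero] at this
  linarith

end

/-! ### The theorem for all exponents and the infimum over boundary levels. -/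

theorem mainTheorem8 (n : ℕ) (hn : 3 ≤ n) (Cn : ℝ) (hCn : IsSobolevConstant n Cn)
    (lam : ℝ) (hlam : 0 < lam) (q : ℝ≥0∞) (hq : (n : ℝ≥0∞) < q) :
    ∃ C : ℝ → ℝ, (∀ r, 0 < C r) ∧
      ∀ (Ω : Set (EuclideanSpace ℝ (Fin n)))
        (A : EuclideanSpace ℝ (Fin n) → Matrix (Fin n) (Fin n) ℝ)
        (b c : EuclideanSpace ℝ (Fin n) → EuclideanSpace ℝ (Fin n))
        (d : EuclideanSpace ℝ (Fin n) → ℝ)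
        (f : EuclideanSpace ℝ (Fin n) → EuclideanSpace ℝ (Fin n))
        (g : EuclideanSpace ℝ (Fin n) → ℝ)
        (u : EuclideanSpace ℝ (Fin n) → ℝ),
        IsOpen Ω → IsConnected Ω → volume Ω ≤ 1 →
        IsBoundedElliptic Ω lam A →
        MemLp b (n : ℝ≥0∞) (volume.restrict Ω) →
        MemLp c (n : ℝ≥0∞) (volume.restrict Ω) →
        MemLp d ((n : ℝ≥0∞) / 2) (volume.restrict Ω) →
        GEDiv Ω d b →
        MemLp f q (volume.restrict Ω) →
        MemLp g (q / 2) (volume.restrict Ω) →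
        IsSubsolution Ω A b c d g f u →
        essSup (fun x => (u x : EReal)) (volume.restrict Ω)
          ≤ boundarySup Ω (fun x => max (u x) 0)
            + ((C (smallR Ω (fun x => b x - c x) (lam / (3 * Cn)))
                * ((eLpNorm f q (volume.restrict Ω)).toReal
                  + (eLpNorm g (q / 2) (volume.restrict Ω)).toReal) : ℝ) : EReal) := by
  -- A finite exponent `p` with `n < p < q` covers `q = ∞` as well. Passing to `p` does not increase
  -- the norms because `|Ω| ≤ 1`, and `p` depends only on `n` and `q`.
  obtain ⟨p, hnp, hpq⟩ := ENNReal.lt_iff_exists_nnreal_btwn.1 hq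
  have hp : (n : ℝ) < p := by exact_mod_cast hnp
  have h3 : (3 : ℝ) ≤ n := by exact_mod_cast hn
  have hpe : ENNReal.ofReal p = p := ENNReal.ofReal_coe_nnreal
  have hpq1 : ENNReal.ofReal p ≤ q := hpe.trans_le hpq.le
  have hpq2 : ENNReal.ofReal ((p : ℝ) / 2) ≤ q / 2 := by
    rw [ENNReal.ofReal_div_of_pos two_pos, ENNReal.ofReal_ofNat]
    gcongr
  have h1p : (1 : ℝ≥0∞) ≤ ENNReal.ofReal ((p : ℝ) / 2) := by
    rw [← ENNReal.ofReal_one]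
    exact ENNReal.ofReal_le_ofReal (by linarith)
  have h1p' : (1 : ℝ≥0∞) ≤ ENNReal.ofReal p := by
    rw [← ENNReal.ofReal_one]
    exact ENNReal.ofReal_le_ofReal (by linarith)
  refine ⟨fun r => maxPrincipleConst n Cn lam p (|r| + 1),
    fun r => maxPrincipleConst_pos hCn.1 hlam, ?_⟩
  intro Ω A b c d f g u hΩ hconn hμ hA hb hc hd hdiv hf hg hu
  have := isFiniteMeasure_restrict hμ
  have hμ' : (volume.restrict Ω) Set.univ ≤ 1 := by rwa [Measure.restrict_apply_univ]
  have hε : 0 < lam / (3 * Cn) := div_pos hlam (mul_pos three_pos hCn.1)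
  have H : IsSmallAbove Ω (fun x => b x - c x) _ _ := isSmallAbove_of_smallR (hb.sub hc) hε
  -- The finite data term is moved to the left to expose the infimum; each admissible `k` is then
  -- treated separately, and if there is none the bound is `+∞`.
  rw [← EReal.sub_le_iff_le_add (Or.inl (EReal.coe_ne_bot _)) (Or.inl (EReal.coe_ne_top _))]
  refine le_iInf₂ fun k hbd => ?_
  rw [EReal.sub_le_iff_le_add (Or.inl (EReal.coe_ne_bot _)) (Or.inl (EReal.coe_ne_top _)),
    ← EReal.coe_add]
  have hk := hbd.nonneg hn hCn hΩ hconn.nonempty fun x => le_max_right _ _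
  have key := hu.ae_le hn hCn hΩ hμ hA hb hc hd hdiv hp (hf.mono_exponent hpq1)
    (hg.mono_exponent hpq2) hk hbd (by positivity) H
    (add_le_add (toReal_eLpNorm_le_of_le hμ' hpq1 hf) (toReal_eLpNorm_le_of_le hμ' hpq2 hg))
  refine essSup_le_of_ae_le _ ?_
  filter_upwards [key] with x hx
  exact EReal.coe_le_coe_iff.2 hx
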